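/- Let $\mathsf{Top}_*$ be the closed symmetric monoidal category of based compactly generated weak Hausdorff spaces with the smash product $\wedge$ and unit $S^0$. A symmetric monoidal $\mathsf{Top}_*$-category is a symmetric monoidal category $(\mathcal C,\barwedge,S)$ that is enriched, tensored (by $X\otimes C$) and cotensored over $\mathsf{Top}_*$, together with a natural transformation $d:(X\wedge Y)\otimes(C\barwedge D)\to(X\otimes C)\barwedge(Y\otimes D)$ that is associative, unital (the composite $X\otimes C\cong(X\wedge S^0)\otimes(C\barwedge S)\xrightarrow{d}(X\otimes C)\barwedge(S^0\otimes S)\cong X\otimes C$ is the identity) and compatible with the symmetry isomorphisms of $\mathsf{Top}_*$ and $\mathcal C$. Let $\mathcal C$ be such a category with all small limits and colimits; it has a null object $*$. For nonempty finite sets $A,B$ and $a\in A$ put $A\cup_aB=(A\setminus\{a\})\amalg B$. An operad $P$ in $\mathcal C$ is a functor from nonempty finite sets and bijections to $\mathcal C$ with natural partial compositions $P(A)\barwedge P(B)\to P(A\cup_aB)$ and a unit $S\to P(1)$, subject to the two associativity axioms (for nested and for disjoint compositions) and the two unit axioms; a cooperad is the dual notion, with cocompositions $Q(A\cup_aB)\to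 Q(A)\barwedge Q(B)$ and a counit $Q(1)\to S$. An operad (cooperad) is reduced if its unit (counit) is an isomorphism. An $A$-labelled tree $T$ is a finite poset with a least element $r$ (the root) and an element $b\ne r$ with $b\le t$ for all $t\neq r$, such that any two elements with a common upper bound are comparable, and such that for $t<u$ with $t\ne r$ there is $v>t$ with $u\not\le v$, together with a bijection between $A$ and the set of leaves (maximal elements). A vertex is an element that is neither the root nor a leaf, the edges are the covering relations, and $i(v)$ is the set of incoming edges of the vertex $v$, i.e. those that connect $v$ to the elements covering it. The edge $r<b$ is the root edge, an edge ending in a leaf is a leaf edge, an edge between two vertices is internal, and $T/e$ is obtained from $T$ by collapsing the internal edge $e$. Let $\mathsf T(A)$ be the set of isomorphism classes of $A$-labelled trees, partially ordered by edge collapse ($T/e\le T$). A weighting on $T$ assigns a length in $[0,1]$ to every edge such that the distance from the root to each leaf is $1$; let $w(T)$ be the space of weightings and let $\overline w(T)$ be the quotient of $w(T)$ by the subspace of weightings for which the root edge or some leaf edge has length zero (with a disjoint basepoint if this subspace is empty). Giving $e$ length zero defines maps $\overline w(T/e)\to\overline w(T)$. Put $P_A(T)=\overline{\bigwedge}_{v}P(i(v))$,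 over the vertices $v$ of $T$; the partial compositions of $P$ define maps $P_A(T)\to P_A(T/e)$. Let $P$ be a reduced operad in $\mathcal C$. Its bar construction is the coend $$B(P)(A)=\int^{T\in\mathsf T(A)}\overline w(T)\otimes P_A(T).$$ For $T\in\mathsf T(A)$, $U\in\mathsf T(B)$ and $a\in A$ let $T\cup_aU\in\mathsf T(A\cup_aB)$ be the grafting, in which the root edge of $U$ is identified with the leaf edge of $T$ labelled $a$. Let $\overline w(T\cup_aU)\to\overline w(T)\wedge\overline w(U)$ be the map that sends a weighting to the following pair: on $T$, all edges other than the leaf edge for $a$ keep their lengths, and the leaf edge for $a$ gets the length that makes the distances from the root to the leaves $1$; on $U$, all lengths (with the root edge of $U$ having the length of the edge of grafting) are divided by the total length of the $U$-part (if that total length is zero, the weighting is sent to the basepoint). Then there are unique maps making the family $B(P)$ a cooperad in $\mathcal C$ such that 1. a bijection $A\to A'$ acts on $B(P)$ by relabelling the leaves of trees; 2. the cocomposition $B(P)(A\cup_aB)\to B(P)(A)\barwedge B(P)(B)$ is given on the summand of $T\cup_aU$ by the above map, the identification $P_{A\cup_aB}(T\cup_aU)\cong P_A(T)\barwedge P_B(U)$,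 and then $d$: $\overline w(T\cup_aU)\otimes P_{A\cup_aB}(T\cup_aU)\to(\overline w(T)\wedge\overline w(U))\otimes(P_A(T)\barwedge P_B(U))\to(\overline w(T)\otimes P_A(T))\barwedge(\overline w(U)\otimes P_B(U))\to B(P)(A)\barwedge B(P)(B)$; and on the summand of a tree that is not of the form $T\cup_aU$ it factors through the null object $*$; 3. the counit is inverse to the canonical map $S\cong S^0\otimes S\cong B(P)(1)$ given by the unique tree with one leaf. The cooperad $B(P)$ is reduced. -/

import Mathlib

open CategoryTheory Topology

namespace BarCooperad

/-! ### Compactly generated weak Hausdorff based spaces -/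

/-- The family of all compact Hausdorff spaces, used as test spaces. -/
abbrev KH (K : CompHaus.{0}) : Type := K

instance (K L : CompHaus.{0}) : IsGeneratedBy KH (KH K × KH L) :=
  inferInstanceAs (IsGeneratedBy KH (KH (CompHaus.of (K × L))))

instance (K : CompHaus.{0}) : CompactSpace (KH K) := K.is_compact

instance (K : CompHaus.{0}) : T2Space (KH K) := K.is_hausdorff

lemma regular_locallyCompact (X : Type) [TopologicalSpace X] [CompactSpace X] [T2Space X] :
    RegularSpace X ∧ LocallyCompactSpace X := ⟨inferInstance, inferInstance⟩

instance (K : CompHaus.{0}) : RegularSpace (KH K) := (regular_locallyCompact (KH K)).1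

instance (K : CompHaus.{0}) : LocallyCompactSpace (KH K) := (regular_locallyCompact (KH K)).2

/-- A space is weak Hausdorff if the image of every continuous map from a compact Hausdorff space
is closed. -/
class WeakHausdorff (X : Type) [TopologicalSpace X] : Prop where
  isClosed_range (K : CompHaus.{0}) (f : C(K, X)) : IsClosed (Set.range f)

instance (X : Type) [TopologicalSpace X] [CompactlyGeneratedSpace X] : IsGeneratedBy KH X := by
  refine ⟨continuous_from_uCompactlyGeneratedSpace.{0} _ fun S g => ?_⟩
  rw [IsGeneratedBy.equiv_symm_comp_continuous_iff]
  exact g.continuous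

lemma compactlyGenerated_of_isGeneratedBy (X : Type) [TopologicalSpace X] [IsGeneratedBy KH X] :
    CompactlyGeneratedSpace X :=
  uCompactlyGeneratedSpace_of_continuous_maps fun f h => by
    rw [IsGeneratedBy.continuous_iff KH]
    exact fun K g => h K g

instance (X : Type) [TopologicalSpace X] :
    CompactlyGeneratedSpace (WithGeneratedByTopology KH X) :=
  compactlyGenerated_of_isGeneratedBy _

lemma isClosed_eqLocus {X : Type} [TopologicalSpace X] [WeakHausdorff X] (K : CompHaus.{0})
    (f g : C(K, X)) : IsClosed {k | f k = g k} := by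
  rw [← isOpen_compl_iff, isOpen_iff_mem_nhds]
  intro a (ha : f a ≠ g a)
  have hpt : IsClosed ({g a} : Set X) := by
    have := WeakHausdorff.isClosed_range (CompHaus.of PUnit) (ContinuousMap.const _ (g a))
    exact Set.range_const (ι := PUnit) ▸ this
  have hU : f ⁻¹' {g a}ᶜ ∈ 𝓝 a := (hpt.isOpen_compl.preimage f.continuous).mem_nhds ha
  obtain ⟨V, hV, hVc, hVs⟩ := exists_mem_nhds_isClosed_subset (X := KH K) hU
  have : CompactSpace V := isCompact_iff_compactSpace.1 hVc.isCompact
  have hcl : IsClosed (f '' V) := by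
    have := WeakHausdorff.isClosed_range (CompHaus.of V)
      (f.comp ⟨Subtype.val, continuous_subtype_val⟩)
    rw [ContinuousMap.coe_comp, Set.range_comp] at this
    change IsClosed (f '' Set.range (Subtype.val : V → K)) at this
    rwa [Subtype.range_coe] at this
  have hW : g ⁻¹' (f '' V)ᶜ ∈ 𝓝 a := by
    refine (hcl.isOpen_compl.preimage g.continuous).mem_nhds ?_
    rintro ⟨b, hb, hb'⟩
    exact hVs hb hb'
  filter_upwards [hV, hW] with x hx hx' hfg
  exact hx' ⟨x, hx, hfg⟩

lemma weakHausdorff_of_eqLocus {X : Type} [TopologicalSpace X] [CompactlyGeneratedSpace X]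
    (h : ∀ (K : CompHaus.{0}) (f g : C(K, X)), IsClosed {k | f k = g k}) : WeakHausdorff X where
  isClosed_range K f := by
    refine UCompactlyGeneratedSpace.isClosed.{0} fun L g => ?_
    have h1 := h (CompHaus.of (K × L)) (f.comp ContinuousMap.fst) (g.comp ContinuousMap.snd)
    have h2 : IsCompact {p : K × L | f p.1 = g p.2} := IsClosed.isCompact h1
    convert (h2.image continuous_snd).isClosed using 1
    ext l
    constructor
    · rintro ⟨k, hk⟩
      exact ⟨(k, l), hk, rfl⟩
    · rintro ⟨⟨k, l'⟩, hk, rfl⟩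
      exact ⟨k, hk⟩

instance (X : Type) [TopologicalSpace X] [T2Space X] : WeakHausdorff X where
  isClosed_range _ f := (isCompact_range f.continuous).isClosed

lemma kCont_iff {X Y : Type} [TopologicalSpace X] [TopologicalSpace Y] [CompactlyGeneratedSpace X]
    {f : X → Y} : ContinuousGeneratedBy KH f ↔ Continuous f :=
  ⟨fun h => (IsGeneratedBy.continuous_iff KH f).2 h, fun h => h.continuousGeneratedBy⟩

lemma kCont_of_quotient {P Q T : Type} [TopologicalSpace P] [TopologicalSpace Q]
    [TopologicalSpace T] [CompactlyGeneratedSpace P] {q : P → Q} (hq : IsQuotientMap q)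
    {h : Q → T} (hh : ContinuousGeneratedBy KH (h ∘ q)) : ContinuousGeneratedBy KH h := by
  have := hq.isGeneratedBy (X := KH)
  have := compactlyGenerated_of_isGeneratedBy Q
  rw [kCont_iff] at hh ⊢
  exact hq.continuous_iff.2 hh

/-- The product of a quotient map of compactly generated spaces with any space is again a quotient
map, for maps continuous on compact Hausdorff test spaces. -/
lemma kCont_of_prod_quotient {P Q Z T : Type} [TopologicalSpace P] [TopologicalSpace Q]
    [TopologicalSpace Z] [TopologicalSpace T] [CompactlyGeneratedSpace P] {q : P → Q}
    (hq : IsQuotientMap q) {h : Z × Q → T}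
    (hh : ContinuousGeneratedBy KH (fun p : Z × P => h (p.1, q p.2))) :
    ContinuousGeneratedBy KH h := by
  let G := ContinuousMapGeneratedBy.curryEquiv (X := KH) ⟨_, hh⟩
  have hG : ∀ (x : Q), ContinuousGeneratedBy KH (fun z => h (z, x)) := fun x => by
    obtain ⟨p, rfl⟩ := hq.surjective x
    exact (G p).prop
  let H : Q → ContinuousMapGeneratedBy KH Z T := fun x => ⟨_, hG x⟩
  have hH : ContinuousGeneratedBy KH H := kCont_of_quotient hq G.prop
  exact (ContinuousMapGeneratedBy.curryEquiv.symm ⟨H, hH⟩).prop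

lemma kCont_swap {X Y : Type} [TopologicalSpace X] [TopologicalSpace Y] :
    ContinuousGeneratedBy KH (Prod.swap : X × Y → Y × X) := continuous_swap.continuousGeneratedBy

lemma kCont_of_quotient_prod {P Q Z T : Type} [TopologicalSpace P] [TopologicalSpace Q]
    [TopologicalSpace Z] [TopologicalSpace T] [CompactlyGeneratedSpace P] {q : P → Q}
    (hq : IsQuotientMap q) {h : Q × Z → T}
    (hh : ContinuousGeneratedBy KH (fun p : P × Z => h (q p.1, p.2))) :
    ContinuousGeneratedBy KH h :=
  (kCont_of_prod_quotient (h := h ∘ Prod.swap) hq (hh.comp kCont_swap)).comp kCont_swap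

lemma kCont_prodMk {W X Y : Type} [TopologicalSpace W] [TopologicalSpace X] [TopologicalSpace Y]
    {f : W → X} {g : W → Y} (hf : ContinuousGeneratedBy KH f) (hg : ContinuousGeneratedBy KH g) :
    ContinuousGeneratedBy KH (fun w => (f w, g w)) :=
  fun _ u => (hf u).prodMk (hg u)

lemma kCont_toK {X : Type} [TopologicalSpace X] :
    ContinuousGeneratedBy KH (WithGeneratedByTopology.equiv (X := KH) (Y := X)).symm :=
  (WithGeneratedByTopology.equivSymmAsContinuousMapGeneratedBy KH X).prop

/-- The relation collapsing a subset `A` to a point. -/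
def collapseSetoid {X : Type} (A : Set X) : Setoid X where
  r x y := x = y ∨ (x ∈ A ∧ y ∈ A)
  iseqv := ⟨fun _ => Or.inl rfl, by rintro x y (h | ⟨h, h'⟩) <;> simp [*], by
    rintro x y z (rfl | ⟨h, h'⟩) (rfl | ⟨h1, h2⟩) <;> simp [*]⟩

instance weakHausdorff_collapse {X : Type} [TopologicalSpace X] [CompactlyGeneratedSpace X]
    [WeakHausdorff X] (A : Set X) [hA : Fact (IsClosed A)] :
    WeakHausdorff (Quotient (collapseSetoid A)) := by
  refine weakHausdorff_of_eqLocus fun K f g => ?_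
  let q : X → Quotient (collapseSetoid A) := Quotient.mk _
  have hq : IsQuotientMap q := isQuotientMap_quotient_mk'
  have key : ContinuousGeneratedBy KH
      (fun p : Quotient (collapseSetoid A) × Quotient (collapseSetoid A) => p.1 ≠ p.2) := by
    refine kCont_of_prod_quotient hq (kCont_of_quotient_prod hq ?_)
    intro L u
    rw [continuous_Prop, ← isClosed_compl_iff]
    have h1 : IsClosed {l | (u l).1 = (u l).2} :=
      isClosed_eqLocus L (ContinuousMap.fst.comp u) (ContinuousMap.snd.comp u)
    have h2 := (hA.out.preimage (continuous_fst.comp u.continuous)).inter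
      (hA.out.preimage (continuous_snd.comp u.continuous))
    convert h1.union h2 using 1
    ext l
    simp only [Set.mem_compl_iff, Set.mem_ofPred_eq, Function.comp, not_not, ne_eq]
    exact Quotient.eq (r := collapseSetoid A)
  have := key (K.1 |> fun _ => f.prodMk g)
  rw [continuous_Prop, ← isClosed_compl_iff] at this
  convert this using 1
  ext k
  simp

/-- A based compactly generated weak Hausdorff space. -/
structure TopStar : Type 1 where
  carrier : Type
  [top : TopologicalSpace carrier]
  [cg : CompactlyGeneratedSpace carrier]
  [wh : WeakHausdorff carrier]
  pt : carrier

namespace TopStar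

instance : CoeSort TopStar Type := ⟨TopStar.carrier⟩

attribute [instance] TopStar.top TopStar.cg TopStar.wh

/-- Basepoint-preserving continuous maps. -/
@[ext]
structure Hom (X Y : TopStar) where
  toFun : X → Y
  cont : Continuous toFun
  map_pt : toFun X.pt = Y.pt

instance : Category TopStar where
  Hom := Hom
  id X := ⟨id, continuous_id, rfl⟩
  comp f g := ⟨g.toFun ∘ f.toFun, g.cont.comp f.cont, by simp [f.map_pt, g.map_pt]⟩

instance (X Y : TopStar) : CoeFun (X ⟶ Y) (fun _ => X → Y) := ⟨Hom.toFun⟩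

@[ext]
lemma hom_ext {X Y : TopStar} {f g : X ⟶ Y} (h : ∀ x, f x = g x) : f = g :=
  Hom.ext (funext h)

@[simp] lemma id_apply {X : TopStar} (x : X) : (𝟙 X : X ⟶ X) x = x := rfl

@[simp] lemma comp_apply {X Y Z : TopStar} (f : X ⟶ Y) (g : Y ⟶ Z) (x : X) :
    (f ≫ g) x = g (f x) := rfl

lemma kCont {X Y : TopStar} (f : X ⟶ Y) : ContinuousGeneratedBy KH f.toFun :=
  f.cont.continuousGeneratedBy

/-- The quotient `X / A` of a space by a closed subset, based at the image of `A`. -/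
def collapse (X : Type) [TopologicalSpace X] [CompactlyGeneratedSpace X] [WeakHausdorff X]
    (A : Set X) (hA : IsClosed A) (a : X) : TopStar :=
  haveI : Fact (IsClosed A) := ⟨hA⟩
  { carrier := Quotient (collapseSetoid A)
    pt := Quotient.mk _ a }

/-- The product `X × Y` with the compactly generated topology. -/
abbrev KProd (X Y : TopStar) : Type := WithGeneratedByTopology KH (X × Y)

instance (X Y : TopStar) : WeakHausdorff (KProd X Y) := by
  refine weakHausdorff_of_eqLocus fun K f g => ?_
  have hc := WithGeneratedByTopology.continuous_equiv (X := KH) (Y := X × Y)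
  have h1 := isClosed_eqLocus K (⟨_, (continuous_fst.comp hc).comp f.continuous⟩ : C(K, X))
    ⟨_, (continuous_fst.comp hc).comp g.continuous⟩
  have h2 := isClosed_eqLocus K (⟨_, (continuous_snd.comp hc).comp f.continuous⟩ : C(K, Y))
    ⟨_, (continuous_snd.comp hc).comp g.continuous⟩
  convert h1.inter h2 using 1
  ext k
  exact Prod.ext_iff

lemma isClosed_pt (X : TopStar) : IsClosed ({X.pt} : Set X) := by
  have := WeakHausdorff.isClosed_range (CompHaus.of PUnit) (ContinuousMap.const _ X.pt)
  exact Set.range_const (ι := PUnit) ▸ this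

/-- The wedge `X ∨ Y` inside the product. -/
def wedge (X Y : TopStar) : Set (KProd X Y) :=
  {p | (WithGeneratedByTopology.equiv p).1 = X.pt ∨ (WithGeneratedByTopology.equiv p).2 = Y.pt}

lemma isClosed_wedge (X Y : TopStar) : IsClosed (wedge X Y) := by
  have hc := WithGeneratedByTopology.continuous_equiv (X := KH) (Y := X × Y)
  exact (X.isClosed_pt.preimage (continuous_fst.comp hc)).union
    (Y.isClosed_pt.preimage (continuous_snd.comp hc))

/-- The smash product `X ∧ Y`. -/
def smash (X Y : TopStar) : TopStar :=
  collapse (KProd X Y) (wedge X Y) (isClosed_wedge X Y)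
    (WithGeneratedByTopology.equiv.symm (X.pt, Y.pt))

/-- The point `x ∧ y` of `X ∧ Y`. -/
def smk {X Y : TopStar} (x : X) (y : Y) : smash X Y :=
  Quotient.mk (collapseSetoid (wedge X Y)) (WithGeneratedByTopology.equiv.symm (x, y))

lemma ind {X Y : TopStar} {p : smash X Y → Prop} (h : ∀ x y, p (smk x y)) (z : smash X Y) : p z :=
  Quotient.inductionOn z fun w => h (WithGeneratedByTopology.equiv w).1
    (WithGeneratedByTopology.equiv w).2

lemma smk_eq_pt {X Y : TopStar} {x : X} {y : Y} (h : x = X.pt ∨ y = Y.pt) :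
    smk x y = (smash X Y).pt :=
  Quotient.sound (Or.inr ⟨h, Or.inl rfl⟩)

@[simp] lemma smk_pt_left {X Y : TopStar} (y : Y) : smk X.pt y = (smash X Y).pt :=
  smk_eq_pt (Or.inl rfl)

@[simp] lemma smk_pt_right {X Y : TopStar} (x : X) : smk x Y.pt = (smash X Y).pt :=
  smk_eq_pt (Or.inr rfl)

lemma smk_kCont (X Y : TopStar) : ContinuousGeneratedBy KH (fun p : X × Y => smk p.1 p.2) :=
  (continuous_quotient_mk'.continuousGeneratedBy).comp kCont_toK

lemma isQuotientMap_mk (X Y : TopStar) :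
    IsQuotientMap (fun p : KProd X Y => smk (WithGeneratedByTopology.equiv p).1
      (WithGeneratedByTopology.equiv p).2) :=
  isQuotientMap_quotient_mk'

/-- The map out of `X ∧ Y` induced by a map out of `X × Y` that collapses `X ∨ Y`. -/
def lift {X Y : TopStar} {Z : Type} (f : X → Y → Z)
    (hf : ∀ x y x' y', (x = X.pt ∨ y = Y.pt) → (x' = X.pt ∨ y' = Y.pt) → f x y = f x' y') :
    smash X Y → Z :=
  Quotient.lift (fun p : KProd X Y => f (WithGeneratedByTopology.equiv p).1
    (WithGeneratedByTopology.equiv p).2) (by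
      rintro p q (h | ⟨h, h'⟩)
      · rw [h]
      · exact hf _ _ _ _ h h')

/-- The based map `X ∧ Y ⟶ Z` induced by a map out of `X × Y` that collapses `X ∨ Y`. -/
def desc {X Y Z : TopStar} (f : X → Y → Z)
    (hf : ContinuousGeneratedBy KH (fun p : X × Y => f p.1 p.2))
    (h0 : ∀ x y, (x = X.pt ∨ y = Y.pt) → f x y = Z.pt) : smash X Y ⟶ Z where
  toFun := lift f fun x y x' y' h h' => (h0 x y h).trans (h0 x' y' h').symm
  cont := by
    rw [(isQuotientMap_mk X Y).continuous_iff, ← kCont_iff]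
    exact hf.comp WithGeneratedByTopology.continuous_equiv.continuousGeneratedBy
  map_pt := h0 _ _ (Or.inl rfl)

@[simp] lemma desc_mk {X Y Z : TopStar} (f : X → Y → Z) (hf h0) (x : X) (y : Y) :
    desc (Z := Z) f hf h0 (smk x y) = f x y := rfl

/-- Smash product of based maps. -/
def smashMap {X X' Y Y' : TopStar} (f : X ⟶ X') (g : Y ⟶ Y') : smash X Y ⟶ smash X' Y' :=
  desc (fun x y => smk (f x) (g y))
    ((smk_kCont X' Y').comp (f := fun p : X × Y => (f p.1, g p.2))
      ((f.cont.comp continuous_fst).prodMk (g.cont.comp continuous_snd)).continuousGeneratedBy)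
    (by rintro x y (rfl | rfl) <;> simp [f.map_pt, g.map_pt])

@[simp] lemma smashMap_mk {X X' Y Y' : TopStar} (f : X ⟶ X') (g : Y ⟶ Y') (x : X) (y : Y) :
    smashMap f g (smk x y) = smk (f x) (g y) := rfl

/-- The zero-sphere. -/
def S0 : TopStar where
  carrier := Bool
  pt := false

/-- `(x ∧ y) ∧ z ↦ x ∧ (y ∧ z)`. -/
def assocHom (X Y Z : TopStar) : smash (smash X Y) Z ⟶ smash X (smash Y Z) :=
  desc (fun w z => lift (fun x y => smk x (smk y z)) (by
      rintro x y x' y' (rfl | rfl) (rfl | rfl) <;> simp) w)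
    (by
      refine kCont_of_quotient_prod (isQuotientMap_mk X Y) ?_
      refine (smk_kCont X (smash Y Z)).comp (kCont_prodMk
        (f := fun p : KProd X Y × Z => (WithGeneratedByTopology.equiv p.1).1) ?_
        ((smk_kCont Y Z).comp
          (f := fun p : KProd X Y × Z => ((WithGeneratedByTopology.equiv p.1).2, p.2)) ?_))
      · exact ((continuous_fst.comp WithGeneratedByTopology.continuous_equiv).comp
          continuous_fst).continuousGeneratedBy
      · exact (((continuous_snd.comp WithGeneratedByTopology.continuous_equiv).comp
          continuous_fst).prodMk continuous_snd).continuousGeneratedBy)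
    (by
      rintro w z (rfl | rfl)
      · exact smk_pt_left _
      · induction w using ind
        exact (congrArg _ (smk_pt_right _)).trans (smk_pt_right _))

/-- `x ∧ (y ∧ z) ↦ (x ∧ y) ∧ z`. -/
def assocInv (X Y Z : TopStar) : smash X (smash Y Z) ⟶ smash (smash X Y) Z :=
  desc (fun x w => lift (fun y z => smk (smk x y) z) (by
      rintro x y x' y' (rfl | rfl) (rfl | rfl) <;> simp) w)
    (by
      refine kCont_of_prod_quotient (isQuotientMap_mk Y Z) ?_
      refine (smk_kCont (smash X Y) Z).comp (kCont_prodMk ((smk_kCont X Y).comp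
        (f := fun p : X × KProd Y Z => (p.1, (WithGeneratedByTopology.equiv p.2).1)) ?_)
        (g := fun p : X × KProd Y Z => (WithGeneratedByTopology.equiv p.2).2) ?_)
      · exact (continuous_fst.prodMk ((continuous_fst.comp
          WithGeneratedByTopology.continuous_equiv).comp continuous_snd)).continuousGeneratedBy
      · exact ((continuous_snd.comp WithGeneratedByTopology.continuous_equiv).comp
          continuous_snd).continuousGeneratedBy)
    (by
      rintro x w (rfl | rfl)
      · induction w using ind
        exact (congrArg (smk · _) (smk_pt_left _)).trans (smk_pt_left _)
      · exact smk_pt_right _)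

@[simp] lemma assocHom_mk {X Y Z : TopStar} (x : X) (y : Y) (z : Z) :
    assocHom X Y Z (smk (smk x y) z) = smk x (smk y z) := rfl

@[simp] lemma assocInv_mk {X Y Z : TopStar} (x : X) (y : Y) (z : Z) :
    assocInv X Y Z (smk x (smk y z)) = smk (smk x y) z := rfl

/-- `x ∧ y ↦ y ∧ x`. -/
def swap (X Y : TopStar) : smash X Y ⟶ smash Y X :=
  desc (fun x y => smk y x) ((smk_kCont Y X).comp kCont_swap)
    (by rintro x y (rfl | rfl) <;> simp)

@[simp] lemma swap_mk {X Y : TopStar} (x : X) (y : Y) : swap X Y (smk x y) = smk y x := rfl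

/-- `b ∧ x ↦ x` for `b` the non-basepoint of the zero-sphere. -/
def unitHom (X : TopStar) : smash S0 X ⟶ X :=
  desc (fun (b : Bool) x => if b then x else X.pt)
    (by
      have : Continuous (fun p : Bool × X => if p.1 then p.2 else X.pt) := by
        rw [continuous_prod_of_discrete_left]
        rintro (_ | _)
        · exact continuous_const
        · exact continuous_id
      exact this.continuousGeneratedBy)
    (by rintro x y (rfl | rfl)
        · rfl
        · exact ite_self _)

lemma unitHom_smk (X : TopStar) (b : Bool) (x : X) :
    unitHom X (smk (X := S0) b x) = if b then x else X.pt := rfl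

/-- `x ↦ b ∧ x` for `b` the non-basepoint of the zero-sphere. -/
def unitInv (X : TopStar) : X ⟶ smash S0 X where
  toFun x := smk (X := S0) true x
  cont := by
    rw [← kCont_iff]
    exact (smk_kCont S0 X).comp (f := fun x => (true, x))
      (continuous_const.prodMk continuous_id).continuousGeneratedBy
  map_pt := smk_pt_right (X := S0) _

instance : MonoidalCategoryStruct TopStar where
  tensorObj := smash
  whiskerLeft X _ _ f := smashMap (𝟙 X) f
  whiskerRight f Y := smashMap f (𝟙 Y)
  tensorHom f g := smashMap f g
  tensorUnit := S0
  associator X Y Z :=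
    { hom := assocHom X Y Z
      inv := assocInv X Y Z
      hom_inv_id := by
        ext w
        induction w using ind with | _ w z
        induction w using ind
        rfl
      inv_hom_id := by
        ext w
        induction w using ind with | _ w z
        induction z using ind
        rfl }
  leftUnitor X :=
    { hom := unitHom X
      inv := unitInv X
      hom_inv_id := by
        ext w
        induction w using ind with | _ b x
        obtain (_ | _) : Bool := b
        · exact (smk_pt_right _).trans (smk_pt_left (X := S0) x).symm
        · rfl
      inv_hom_id := rfl }
  rightUnitor X :=
    { hom := swap X S0 ≫ unitHom X
      inv := unitInv X ≫ swap S0 X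
      hom_inv_id := by
        ext w
        induction w using ind with | _ x b
        obtain (_ | _) : Bool := b
        · exact (smk_pt_left (Y := S0) _).trans (smk_pt_right (Y := S0) x).symm
        · rfl
      inv_hom_id := rfl }

instance : MonoidalCategory TopStar where
  tensorHom_def f g := by
    ext w
    induction w using ind
    rfl
  id_tensorHom_id X Y := by
    ext w
    induction w using ind
    rfl
  tensorHom_comp_tensorHom f g f' g' := by
    ext w
    induction w using ind
    rfl
  whiskerLeft_id X Y := by
    ext w
    induction w using ind
    rfl
  id_whiskerRight X Y := by
    ext w
    induction w using ind
    rfl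
  associator_naturality f g h := by
    ext w
    induction w using ind with | _ w z
    induction w using ind
    rfl
  leftUnitor_naturality f := by
    ext w
    induction w using ind with | _ b x
    obtain (_ | _) : Bool := b
    · exact f.map_pt.symm
    · rfl
  rightUnitor_naturality f := by
    ext w
    induction w using ind with | _ x b
    obtain (_ | _) : Bool := b
    · exact f.map_pt.symm
    · rfl
  pentagon W X Y Z := by
    ext w
    induction w using ind with | _ w z
    induction w using ind with | _ w y
    induction w using ind
    rfl
  triangle X Y := by
    ext w
    induction w using ind with | _ w y
    induction w using ind with | _ x b
    obtain (_ | _) : Bool := b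
    · exact (smk_pt_right _).trans (smk_pt_left _).symm
    · rfl

instance : SymmetricCategory TopStar where
  braiding X Y :=
    { hom := swap X Y
      inv := swap Y X
      hom_inv_id := by
        ext w
        induction w using ind
        rfl
      inv_hom_id := by
        ext w
        induction w using ind
        rfl }
  braiding_naturality_right X _ _ f := by
    ext w
    induction w using ind
    rfl
  braiding_naturality_left f Z := by
    ext w
    induction w using ind
    rfl
  hexagon_forward X Y Z := by
    ext w
    induction w using ind with | _ w z
    induction w using ind
    rfl
  hexagon_reverse X Y Z := by
    ext w
    induction w using ind with | _ w z
    induction z using ind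
    rfl
  symmetry X Y := by
    ext w
    induction w using ind
    rfl

/-- The based continuous maps, with the subspace topology of the space of all maps. -/
abbrev PreMap (X Y : TopStar) : Type := {f : ContinuousMapGeneratedBy KH X Y // f X.pt = Y.pt}

/-- The mapping space `Map(X, Y)` of based maps, with the compactly generated topology. -/
def mapSpace (X Y : TopStar) : TopStar where
  carrier := WithGeneratedByTopology KH (PreMap X Y)
  pt := WithGeneratedByTopology.equiv.symm
    ⟨⟨fun _ => Y.pt, continuous_const.continuousGeneratedBy⟩, rfl⟩
  wh := by
    refine weakHausdorff_of_eqLocus fun K f g => ?_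
    have hev : ∀ x : X, Continuous fun h : WithGeneratedByTopology KH (PreMap X Y) =>
        (WithGeneratedByTopology.equiv h).1 x := fun x => by
      have h1 : Continuous fun h : ContinuousMapGeneratedBy KH X Y => h x := by
        have h2 := ContinuousMapGeneratedBy.continuous_precomp (X := KH) (T := Y)
          (i := CompHaus.of PUnit) (ContinuousMap.const _ x)
        exact (continuous_eval_const (F := C(KH (CompHaus.of PUnit), Y))
          PUnit.unit).comp h2
      exact (h1.comp continuous_subtype_val).comp WithGeneratedByTopology.continuous_equiv
    have := isClosed_iInter fun x : X => isClosed_eqLocus K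
      (⟨_, (hev x).comp f.continuous⟩ : C(K, Y)) ⟨_, (hev x).comp g.continuous⟩
    convert this using 1
    ext k
    rw [Set.mem_iInter]
    refine ⟨fun h x => ?_, fun h => ?_⟩
    · change f k = g k at h
      change (WithGeneratedByTopology.equiv (f k)).1 x = (WithGeneratedByTopology.equiv (g k)).1 x
      rw [h]
    · refine WithGeneratedByTopology.equiv.injective (Subtype.ext ?_)
      exact ContinuousMapGeneratedBy.ext (funext h)

/-- Evaluation of a point of the mapping space. -/
def mapEval {X Y : TopStar} (f : mapSpace X Y) (x : X) : Y :=
  (WithGeneratedByTopology.equiv (X := KH) (Y := PreMap X Y) f).1 x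

lemma mapEval_pt {X Y : TopStar} (f : mapSpace X Y) : mapEval f X.pt = Y.pt :=
  (WithGeneratedByTopology.equiv (X := KH) (Y := PreMap X Y) f).2

/-- The point of the mapping space given by a based map. -/
def mapMk {X Y : TopStar} (f : X → Y) (hf : ContinuousGeneratedBy KH f) (h0 : f X.pt = Y.pt) :
    mapSpace X Y :=
  (WithGeneratedByTopology.equiv (X := KH) (Y := PreMap X Y)).symm ⟨⟨f, hf⟩, h0⟩

@[simp] lemma mapEval_mapMk {X Y : TopStar} (f : X → Y) (hf : ContinuousGeneratedBy KH f)
    (h0 : f X.pt = Y.pt) (x : X) : mapEval (mapMk f hf h0) x = f x := rfl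

lemma mapSpace_ext {X Y : TopStar} {f g : mapSpace X Y} (h : ∀ x, mapEval f x = mapEval g x) :
    f = g :=
  (WithGeneratedByTopology.equiv (X := KH) (Y := PreMap X Y)).injective
    (Subtype.ext (ContinuousMapGeneratedBy.ext (funext h)))

lemma mapEval_basepoint {X Y : TopStar} (x : X) : mapEval (mapSpace X Y).pt x = Y.pt := rfl

/-- The currying bijection `Hom(X ∧ Y, Z) ≃ Hom(Y, Map(X, Z))`. -/
def curryHom (X Y Z : TopStar) : (smash X Y ⟶ Z) ≃ (Y ⟶ mapSpace X Z) where
  toFun g :=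
    { toFun y := mapMk (fun x => g (smk x y))
        ((g.cont.continuousGeneratedBy.comp (smk_kCont X Y)).comp (f := fun x => (x, y))
          (Continuous.prodMk_left y).continuousGeneratedBy)
        (by rw [smk_pt_left]; exact g.map_pt)
      cont := by
        refine (IsGeneratedBy.equiv_symm_comp_continuous_iff (X := KH)
          (g := fun y : Y => (⟨⟨fun x => g (smk x y), _⟩, _⟩ : PreMap X Z))).2 ?_
        refine Continuous.subtype_mk ?_ _
        rw [← kCont_iff]
        exact (ContinuousMapGeneratedBy.curryEquiv
          ⟨_, g.cont.continuousGeneratedBy.comp (smk_kCont X Y)⟩).prop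
      map_pt := mapSpace_ext fun x => by
        change g (smk x Y.pt) = Z.pt
        rw [smk_pt_right]
        exact g.map_pt }
  invFun h := desc (fun x y => mapEval (h y) x)
    (by
      have h1 : Continuous fun y => (WithGeneratedByTopology.equiv (X := KH) (Y := PreMap X Z)
          (h y)).1 :=
        continuous_subtype_val.comp (WithGeneratedByTopology.continuous_equiv.comp h.cont)
      exact (ContinuousMapGeneratedBy.curryEquiv.symm ⟨_, h1.continuousGeneratedBy⟩).prop)
    (by
      rintro x y (rfl | rfl)
      · exact mapEval_pt _
      · rw [h.map_pt]
        rfl)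
  left_inv g := by
    ext w
    induction w using ind
    rfl
  right_inv h := by
    ext y
    exact mapSpace_ext fun x => rfl

/-- Postcomposition on mapping spaces. -/
def mapPost (X : TopStar) {Y Z : TopStar} (p : Y ⟶ Z) : mapSpace X Y ⟶ mapSpace X Z :=
  curryHom X _ Z ((curryHom X _ Y).symm (𝟙 _) ≫ p)

instance : MonoidalClosed TopStar where
  closed X :=
    { rightAdj :=
        { obj := mapSpace X
          map p := mapPost X p
          map_id Y := by
            ext f
            exact mapSpace_ext fun x => rfl
          map_comp p q := by
            ext f
            exact mapSpace_ext fun x => rfl }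
      adj := Adjunction.mkOfHomEquiv
        { homEquiv := curryHom X
          homEquiv_naturality_left_symm f g := by
            ext w
            induction w using ind
            rfl
          homEquiv_naturality_right f g := by
            ext y
            exact mapSpace_ext fun x => rfl } }

end TopStar

open MonoidalCategory BraidedCategory

universe v₁ u₁ v u

/-! ### Enriched, tensored and cotensored symmetric monoidal categories -/

section Enriched

variable (V : Type u₁) [Category.{v₁} V] [MonoidalCategory V] [MonoidalClosed V]
  (C : Type u) [Category.{v} C]

/-- A tensoring of a `V`-category `C`: a functor `V × C ⥤ C`, `(X, c) ↦ X ⊙ c`, with a natural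
isomorphism `Map(X ⊙ c, D) ≅ Map(X, Map(c, D))` in `V`. -/
class Tensoring [EnrichedOrdinaryCategory V C] where
  functor : V ⥤ C ⥤ C
  iso (X : V) (c D : C) : ((functor.obj X).obj c ⟶[V] D) ≅ (ihom X).obj (c ⟶[V] D)
  natural_left {X X' : V} (f : X ⟶ X') (c D : C) :
    eHomWhiskerRight V ((functor.map f).app c) D ≫ (iso X c D).hom =
      (iso X' c D).hom ≫ (MonoidalClosed.pre f).app (c ⟶[V] D)
  natural_middle (X : V) {c c' : C} (g : c ⟶ c') (D : C) :
    eHomWhiskerRight V ((functor.obj X).map g) D ≫ (iso X c D).hom =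
      (iso X c' D).hom ≫ (ihom X).map (eHomWhiskerRight V g D)
  natural_right (X : V) (c : C) {D D' : C} (h : D ⟶ D') :
    eHomWhiskerLeft V ((functor.obj X).obj c) h ≫ (iso X c D').hom =
      (iso X c D).hom ≫ (ihom X).map (eHomWhiskerLeft V c h)

/-- A cotensoring of a `V`-category `C`: a functor `Vᵒᵖ × C ⥤ C`, `(X, D) ↦ D ^ X`, with a natural
isomorphism `Map(c, D ^ X) ≅ Map(X, Map(c, D))` in `V`. -/
class Cotensoring [EnrichedOrdinaryCategory V C] where
  functor : Vᵒᵖ ⥤ C ⥤ C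
  iso (X : V) (c D : C) : (c ⟶[V] (functor.obj (.op X)).obj D) ≅ (ihom X).obj (c ⟶[V] D)
  natural_left {X X' : V} (f : X ⟶ X') (c D : C) :
    eHomWhiskerLeft V c ((functor.map f.op).app D) ≫ (iso X c D).hom =
      (iso X' c D).hom ≫ (MonoidalClosed.pre f).app (c ⟶[V] D)
  natural_middle (X : V) {c c' : C} (g : c ⟶ c') (D : C) :
    eHomWhiskerRight V g ((functor.obj (.op X)).obj D) ≫ (iso X c D).hom =
      (iso X c' D).hom ≫ (ihom X).map (eHomWhiskerRight V g D)
  natural_right (X : V) (c : C) {D D' : C} (h : D ⟶ D') :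
    eHomWhiskerLeft V c ((functor.obj (.op X)).map h) ≫ (iso X c D').hom =
      (iso X c D).hom ≫ (ihom X).map (eHomWhiskerLeft V c h)

variable {V C} [EnrichedOrdinaryCategory V C] [Tensoring V C]

/-- The tensor `X ⊙ c` of an object `X` of `V` and an object `c` of `C`. -/
abbrev tens (X : V) (c : C) : C := ((Tensoring.functor (V := V) (C := C)).obj X).obj c

/-- Functoriality of the tensor in both variables. -/
abbrev tensMap {X X' : V} {c c' : C} (f : X ⟶ X') (g : c ⟶ c') : tens X c ⟶ tens X' c' :=
  ((Tensoring.functor (V := V) (C := C)).map f).app c ≫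
    ((Tensoring.functor (V := V) (C := C)).obj X').map g

/-- The map `X ⟶ Map(c, X ⊙ c)` adjoint to the identity of `X ⊙ c`. -/
def tensCoev (X : V) (c : C) : X ⟶ (c ⟶[V] tens X c) :=
  (ρ_ X).inv ≫ MonoidalClosed.uncurry (eId V (tens X c) ≫ (Tensoring.iso X c (tens X c)).hom)

variable (V) in
/-- The canonical isomorphism `c ⟶ I ⊙ c`, for `I` the unit object of `V`: it is the morphism that
corresponds to the point `I ⟶ Map(c, I ⊙ c)` adjoint to the identity of `I ⊙ c`. -/
def tensUnit (c : C) : c ⟶ tens (𝟙_ V) c :=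
  (eHomEquiv V).symm (tensCoev (𝟙_ V) c)

end Enriched

/-- A symmetric monoidal `V`-category: a symmetric monoidal category `C`, enriched, tensored and
cotensored over `V`, with a natural associative, unital and symmetric transformation
`d : (X ⊗ Y) ⊙ (c ⊗ c') ⟶ (X ⊙ c) ⊗ (Y ⊙ c')`. -/
class SymmetricMonoidalVCategory (V : Type u₁) [Category.{v₁} V] [MonoidalCategory V]
    [SymmetricCategory V] [MonoidalClosed V] (C : Type u) [Category.{v} C] [MonoidalCategory C]
    [SymmetricCategory C] [EnrichedOrdinaryCategory V C] [Tensoring V C] [Cotensoring V C] where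
  d (X Y : V) (c c' : C) : tens (X ⊗ Y) (c ⊗ c') ⟶ tens X c ⊗ tens Y c'
  natural {X X' Y Y' : V} {c c' e e' : C} (f : X ⟶ X') (g : Y ⟶ Y') (h : c ⟶ c') (k : e ⟶ e') :
    tensMap (f ⊗ₘ g) (h ⊗ₘ k) ≫ d X' Y' c' e' = d X Y c e ≫ (tensMap f h ⊗ₘ tensMap g k)
  assoc (X Y Z : V) (c c' c'' : C) :
    d (X ⊗ Y) Z (c ⊗ c') c'' ≫ d X Y c c' ▷ tens Z c'' ≫ (α_ _ _ _).hom =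
      tensMap (α_ X Y Z).hom (α_ c c' c'').hom ≫ d X (Y ⊗ Z) c (c' ⊗ c'') ≫
        tens X c ◁ d Y Z c' c''
  unit (X : V) (c : C) :
    tensMap (ρ_ X).inv (ρ_ c).inv ≫ d X (𝟙_ V) c (𝟙_ C) =
      (ρ_ (tens X c)).inv ≫ tens X c ◁ tensUnit V (𝟙_ C)
  symm (X Y : V) (c c' : C) :
    d X Y c c' ≫ (β_ (tens X c) (tens Y c')).hom =
      tensMap (β_ X Y).hom (β_ c c').hom ≫ d Y X c' c

/-! ### Operads and cooperads -/

/-- Nonempty finite sets. -/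
structure NFin : Type 1 where
  carrier : Type
  [fintype : Fintype carrier]
  [decEq : DecidableEq carrier]
  [nonempty : Nonempty carrier]

namespace NFin

instance : CoeSort NFin Type := ⟨NFin.carrier⟩

attribute [instance] NFin.fintype NFin.decEq NFin.nonempty

/-- The one-element set `1`. -/
abbrev one : NFin := ⟨Unit⟩

/-- The set `A ∪ₐ B = (A \ {a}) ⨿ B`. -/
abbrev ins (A : NFin) (a : A) (B : NFin) : NFin := ⟨{x : A // x ≠ a} ⊕ B⟩

/-- Functoriality of `A ∪ₐ B` in bijections of `A` and of `B`. -/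
def insCongr {A A' B B' : NFin} (σ : A ≃ A') (τ : B ≃ B') (a : A) :
    ins A a B ≃ ins A' (σ a) B' :=
  Equiv.sumCongr (σ.subtypeEquiv fun _ => by simp) τ

/-- `(A ∪ₐ B) ∪_b D = A ∪ₐ (B ∪_b D)` for `b ∈ B`. -/
def insAssoc (A : NFin) (a : A) (B : NFin) (b : B) (D : NFin) :
    ins (ins A a B) (Sum.inr b) D ≃ ins A a (ins B b D) where
  toFun
    | Sum.inl ⟨Sum.inl x, _⟩ => Sum.inl x
    | Sum.inl ⟨Sum.inr y, h⟩ => Sum.inr (Sum.inl ⟨y, fun e => h (congrArg _ e)⟩)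
    | Sum.inr z => Sum.inr (Sum.inr z)
  invFun
    | Sum.inl x => Sum.inl ⟨Sum.inl x, Sum.inl_ne_inr⟩
    | Sum.inr (Sum.inl y) => Sum.inl ⟨Sum.inr y.1, fun e => y.2 (Sum.inr_injective e)⟩
    | Sum.inr (Sum.inr z) => Sum.inr z
  left_inv := by rintro (⟨_ | _, _⟩ | _) <;> rfl
  right_inv := by rintro (_ | _ | _) <;> rfl

/-- `(A ∪ₐ B) ∪_{a'} D = (A ∪_{a'} D) ∪ₐ B` for `a ≠ a'` in `A`. -/
def insComm (A : NFin) (a a' : A) (h : a ≠ a') (B D : NFin) :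
    ins (ins A a B) (Sum.inl ⟨a', h.symm⟩) D ≃ ins (ins A a' D) (Sum.inl ⟨a, h⟩) B where
  toFun
    | Sum.inl ⟨Sum.inl x, hx⟩ => Sum.inl ⟨Sum.inl ⟨x.1, fun e => hx (congrArg Sum.inl
        (Subtype.ext e))⟩, fun e => x.2 (congrArg Subtype.val (Sum.inl_injective e))⟩
    | Sum.inl ⟨Sum.inr y, _⟩ => Sum.inr y
    | Sum.inr z => Sum.inl ⟨Sum.inr z, Sum.inr_ne_inl⟩
  invFun
    | Sum.inl ⟨Sum.inl x, hx⟩ => Sum.inl ⟨Sum.inl ⟨x.1, fun e => hx (congrArg Sum.inl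
        (Subtype.ext e))⟩, fun e => x.2 (congrArg Subtype.val (Sum.inl_injective e))⟩
    | Sum.inl ⟨Sum.inr y, _⟩ => Sum.inr y
    | Sum.inr z => Sum.inl ⟨Sum.inr z, Sum.inr_ne_inl⟩
  left_inv := by rintro (⟨_ | _, _⟩ | _) <;> rfl
  right_inv := by rintro (⟨_ | _, _⟩ | _) <;> rfl

/-- `1 ∪₁ A = A`. -/
def oneIns (A : NFin) : ins one () A ≃ A where
  toFun
    | Sum.inl x => (x.2 rfl).elim
    | Sum.inr y => y
  invFun := Sum.inr
  left_inv := by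
    rintro (x | y)
    · exact (x.2 rfl).elim
    · rfl
  right_inv _ := rfl

/-- `A ≃ A ∪ₐ 1`. -/
def insOne (A : NFin) (a : A) : A ≃ ins A a one where
  toFun x := if h : x = a then Sum.inr () else Sum.inl ⟨x, h⟩
  invFun
    | Sum.inl x => x.1
    | Sum.inr _ => a
  left_inv x := by by_cases h : x = a <;> simp [h]
  right_inv := by
    rintro (x | y)
    · exact dif_neg x.2
    · exact dif_pos rfl

end NFin

section Operads

open NFin

variable (C : Type u) [Category.{v} C] [MonoidalCategory C] [SymmetricCategory C]

/-- An operad in `C`: a functor from nonempty finite sets and bijections to `C`, with natural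
partial compositions and a unit. -/
structure Operad where
  obj : NFin → C
  map {A B : NFin} : (A ≃ B) → (obj A ⟶ obj B)
  map_refl (A : NFin) : map (Equiv.refl A) = 𝟙 (obj A)
  map_trans {A B D : NFin} (σ : A ≃ B) (τ : B ≃ D) : map (σ.trans τ) = map σ ≫ map τ
  circ (A : NFin) (a : A) (B : NFin) : obj A ⊗ obj B ⟶ obj (ins A a B)
  unit : 𝟙_ C ⟶ obj one
  circ_natural {A A' B B' : NFin} (σ : A ≃ A') (τ : B ≃ B') (a : A) :
    circ A a B ≫ map (insCongr σ τ a) = (map σ ⊗ₘ map τ) ≫ circ A' (σ a) B'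
  circ_assoc (A : NFin) (a : A) (B : NFin) (b : B) (D : NFin) :
    circ A a B ▷ obj D ≫ circ (ins A a B) (Sum.inr b) D ≫ map (insAssoc A a B b D) =
      (α_ _ _ _).hom ≫ obj A ◁ circ B b D ≫ circ A a (ins B b D)
  circ_comm (A : NFin) (a a' : A) (h : a ≠ a') (B D : NFin) :
    circ A a B ▷ obj D ≫ circ (ins A a B) (Sum.inl ⟨a', h.symm⟩) D ≫
        map (insComm A a a' h B D) =
      (α_ _ _ _).hom ≫ obj A ◁ (β_ (obj B) (obj D)).hom ≫ (α_ _ _ _).inv ≫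
        circ A a' D ▷ obj B ≫ circ (ins A a' D) (Sum.inl ⟨a, h⟩) B
  unit_circ (A : NFin) :
    (λ_ (obj A)).inv ≫ unit ▷ obj A ≫ circ one () A ≫ map (oneIns A) = 𝟙 (obj A)
  circ_unit (A : NFin) (a : A) :
    (ρ_ (obj A)).inv ≫ obj A ◁ unit ≫ circ A a one = map (insOne A a)

variable {C}

/-- An operad is reduced if its unit map is an isomorphism. -/
def Operad.IsReduced (P : Operad C) : Prop := IsIso P.unit

/-- A cooperad structure on the family of objects `Q(A)`: the structure of a functor on nonempty
finite sets and bijections, with natural cocompositions and a counit that satisfy the duals of the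
axioms for an operad. -/
@[ext]
structure CooperadStructure (Q : NFin → C) where
  map {A B : NFin} : (A ≃ B) → (Q A ⟶ Q B)
  cocomp (A : NFin) (a : A) (B : NFin) : Q (ins A a B) ⟶ Q A ⊗ Q B
  counit : Q one ⟶ 𝟙_ C
  map_refl (A : NFin) : map (Equiv.refl A) = 𝟙 (Q A)
  map_trans {A B D : NFin} (σ : A ≃ B) (τ : B ≃ D) : map (σ.trans τ) = map σ ≫ map τ
  cocomp_natural {A A' B B' : NFin} (σ : A ≃ A') (τ : B ≃ B') (a : A) :
    cocomp A a B ≫ (map σ ⊗ₘ map τ) = map (insCongr σ τ a) ≫ cocomp A' (σ a) B'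
  cocomp_assoc (A : NFin) (a : A) (B : NFin) (b : B) (D : NFin) :
    cocomp (ins A a B) (Sum.inr b) D ≫ cocomp A a B ▷ Q D ≫ (α_ _ _ _).hom =
      map (insAssoc A a B b D) ≫ cocomp A a (ins B b D) ≫ Q A ◁ cocomp B b D
  cocomp_comm (A : NFin) (a a' : A) (h : a ≠ a') (B D : NFin) :
    cocomp (ins A a B) (Sum.inl ⟨a', h.symm⟩) D ≫ cocomp A a B ▷ Q D =
      map (insComm A a a' h B D) ≫ cocomp (ins A a' D) (Sum.inl ⟨a, h⟩) B ≫
        cocomp A a' D ▷ Q B ≫ (α_ _ _ _).hom ≫ Q A ◁ (β_ (Q D) (Q B)).hom ≫ (α_ _ _ _).inv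
  counit_cocomp (A : NFin) :
    cocomp one () A ≫ counit ▷ Q A ≫ (λ_ (Q A)).hom = map (oneIns A)
  cocomp_counit (A : NFin) (a : A) :
    map (insOne A a) ≫ cocomp A a one ≫ Q A ◁ counit ≫ (ρ_ (Q A)).hom = 𝟙 (Q A)

/-- A cooperad is reduced if its counit map is an isomorphism. -/
def CooperadStructure.IsReduced {Q : NFin → C} (S : CooperadStructure Q) : Prop := IsIso S.counit

end Operads

/-! ### Unordered tensor products -/

section BigTensor

variable {C : Type u} [Category.{v} C] [MonoidalCategory C] [SymmetricCategory C]

/-- The tensor product of the objects `X i`, taken in the order given by a list. -/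
def listTensor {ι : Type} (X : ι → C) : List ι → C
  | [] => 𝟙_ C
  | i :: l => X i ⊗ listTensor X l

/-- The symmetry isomorphism that moves the factor `X i` to the front. -/
def listTensorFront {ι : Type} [DecidableEq ι] (X : ι → C) (i : ι) :
    (l : List ι) → i ∈ l → (listTensor X l ⟶ X i ⊗ listTensor X (l.erase i))
  | j :: l, h =>
    if hij : j = i then
      eqToHom (by subst hij; simp [listTensor])
    else
      X j ◁ listTensorFront X i l (by simpa [Ne.symm hij] using h) ≫ (α_ _ _ _).inv ≫
        (β_ (X j) (X i)).hom ▷ _ ≫ (α_ _ _ _).hom ≫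
        eqToHom (by rw [List.erase_cons_tail (by simpa using hij)]; rfl)

/-- The symmetry isomorphism between the tensor products taken in two different orders. -/
def listTensorReorder {ι : Type} [DecidableEq ι] (X : ι → C) :
    (l l' : List ι) → l.Perm l' → (listTensor X l ⟶ listTensor X l')
  | l, [], h => eqToHom (by rw [h.eq_nil])
  | l, i :: l', h =>
    listTensorFront X i l (h.mem_iff.2 List.mem_cons_self) ≫
      X i ◁ listTensorReorder X (l.erase i) l' (by simpa using h.erase i)

/-- The map of tensor products induced by maps `X (f k) ⟶ Y (g k)`. -/
def listTensorMap {κ ι ι' : Type} {X : ι → C} {Y : ι' → C} (f : κ → ι) (g : κ → ι')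
    (φ : ∀ k, X (f k) ⟶ Y (g k)) :
    (l : List κ) → (listTensor X (l.map f) ⟶ listTensor Y (l.map g))
  | [] => 𝟙 _
  | k :: l => φ k ⊗ₘ listTensorMap f g φ l

/-- The associativity isomorphism that splits a tensor product in two. -/
def listTensorSplit {ι : Type} (X : ι → C) (l' : List ι) :
    (l : List ι) → (listTensor X (l ++ l') ⟶ listTensor X l ⊗ listTensor X l')
  | [] => (λ_ _).inv
  | i :: l => X i ◁ listTensorSplit X l' l ≫ (α_ _ _ _).inv

/-- The tensor product `⨂ᵢ X i` over a finite index set, in a chosen order. -/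
noncomputable def bigTensor {ι : Type} [Fintype ι] (X : ι → C) : C := listTensor X Finset.univ.toList

end BigTensor

/-! ### Trees -/

/-- An isomorphism class of trees labelled by `A`. A non-root element `t` of a labelled tree, and
the edge below it, are recorded by the cluster of all labels of leaves above `t`. Thus `univ` is
the root edge, the singletons are the leaf edges, and `t ≤ t'` means that the cluster of `t`
contains that of `t'`. -/
@[ext]
structure LTree (A : NFin) where
  clusters : Finset (Finset A)
  univ_mem : Finset.univ ∈ clusters
  singleton_mem (a : A) : {a} ∈ clusters
  nonempty {c : Finset A} : c ∈ clusters → c.Nonempty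
  nested {c d : Finset A} : c ∈ clusters → d ∈ clusters → c ⊆ d ∨ d ⊆ c ∨ Disjoint c d

namespace LTree

variable {A : NFin} (T : LTree A)

/-- The elements of a tree other than the root and the leaves. -/
def vertices : Finset (Finset A) := T.clusters.filter fun c => 1 < c.card

/-- The type of vertices of a tree. -/
abbrev Vertex : Type := {v : Finset A // v ∈ T.vertices}

variable {T} in
lemma Vertex.mem (v : T.Vertex) : v.1 ∈ T.clusters := (Finset.mem_filter.1 v.2).1

variable {T} in
lemma Vertex.card (v : T.Vertex) : 1 < v.1.card := (Finset.mem_filter.1 v.2).2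

/-- The incoming edges of an element `t` of a tree: the maximal clusters below that of `t`. -/
def children (t : Finset A) : Finset (Finset A) :=
  T.clusters.filter fun c => c ⊂ t ∧ ∀ d ∈ T.clusters, c ⊂ d → ¬ d ⊂ t

lemma mem_children {t c : Finset A} :
    c ∈ T.children t ↔ c ∈ T.clusters ∧ c ⊂ t ∧ ∀ d ∈ T.clusters, c ⊂ d → ¬ d ⊂ t :=
  Finset.mem_filter

lemma exists_child {t c : Finset A} (hc : c ∈ T.clusters) (h : c ⊂ t) :
    ∃ d ∈ T.children t, c ⊆ d := by
  obtain ⟨d, hd, hmax⟩ := (T.clusters.filter fun d => c ⊆ d ∧ d ⊂ t).exists_max_image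
    Finset.card ⟨c, by simp [hc, h]⟩
  simp only [Finset.mem_filter] at hd hmax
  refine ⟨d, T.mem_children.2 ⟨hd.1, hd.2.2, fun e he hde het => ?_⟩, hd.2.1⟩
  exact absurd (Finset.card_lt_card hde) (not_lt.2 (hmax e ⟨he, hd.2.1.trans hde.subset, het⟩))

/-- The set `i(v)` of incoming edges of a vertex. -/
def inc (v : T.Vertex) : NFin where
  carrier := {c : Finset A // c ∈ T.children v.1}
  nonempty := by
    obtain ⟨a, ha⟩ := T.nonempty v.mem
    have h : {a} ⊂ v.1 := by
      refine Finset.ssubset_iff_subset_ne.2 ⟨Finset.singleton_subset_iff.2 ha, fun h => ?_⟩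
      have := v.card
      rw [← h] at this
      simp at this
    obtain ⟨d, hd, -⟩ := T.exists_child (T.singleton_mem a) h
    exact ⟨⟨d, hd⟩⟩

lemma children_image {A A' : NFin} {T : LTree A} {T' : LTree A'} (f : Finset A → Finset A')
    (hf : ∀ c d, f c ⊆ f d ↔ c ⊆ d) (t : Finset A)
    (hmem : ∀ c ∈ T.clusters, c ⊂ t → f c ∈ T'.clusters)
    (hcov : ∀ x ∈ T'.clusters, x ⊂ f t → ∃ c ∈ T.clusters, c ⊂ t ∧ x ⊆ f c) (x : Finset A') :
    x ∈ T'.children (f t) ↔ ∃ c ∈ T.children t, f c = x := by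
  have hf' : ∀ c d, f c ⊂ f d ↔ c ⊂ d := fun c d => by simp [Finset.ssubset_def, hf]
  constructor
  · intro h
    obtain ⟨hx, hxt, hmax⟩ := (T'.mem_children).1 h
    obtain ⟨c, hc, hct, hxc⟩ := hcov x hx hxt
    have hxc' : x = f c := by
      by_contra hne
      exact hmax _ (hmem c hc hct) (Finset.ssubset_iff_subset_ne.2 ⟨hxc, hne⟩) ((hf' _ _).2 hct)
    subst hxc'
    refine ⟨c, T.mem_children.2 ⟨hc, hct, fun d hd hcd hdt => ?_⟩, rfl⟩
    exact hmax _ (hmem d hd hdt) ((hf' _ _).2 hcd) ((hf' _ _).2 hdt)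
  · rintro ⟨c, hc, rfl⟩
    obtain ⟨hc, hct, hmax⟩ := T.mem_children.1 hc
    refine T'.mem_children.2 ⟨hmem c hc hct, (hf' _ _).2 hct, fun d hd hcd hdt => ?_⟩
    obtain ⟨e, he, het, hde⟩ := hcov d hd hdt
    exact hmax e he ((hf' _ _).1 (hcd.trans_subset hde)) het

/-- The bijection of incoming edges induced by an order embedding of the clusters of one tree
into those of another. -/
noncomputable def childEquiv {A A' : NFin} {T : LTree A} {T' : LTree A'}
    (f : Finset A → Finset A') (hf : ∀ c d, f c ⊆ f d ↔ c ⊆ d) (t : Finset A)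
    (hmem : ∀ c ∈ T.clusters, c ⊂ t → f c ∈ T'.clusters)
    (hcov : ∀ x ∈ T'.clusters, x ⊂ f t → ∃ c ∈ T.clusters, c ⊂ t ∧ x ⊆ f c) :
    {c // c ∈ T.children t} ≃ {x // x ∈ T'.children (f t)} :=
  Equiv.ofBijective (fun c => ⟨f c.1, (children_image f hf t hmem hcov _).2 ⟨c.1, c.2, rfl⟩⟩)
    ⟨fun c d h => Subtype.ext (by
      have h' : f c.1 = f d.1 := congrArg Subtype.val h
      exact Finset.Subset.antisymm ((hf _ _).1 h'.subset) ((hf _ _).1 h'.symm.subset)),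
    fun x => by
      obtain ⟨c, hc, h⟩ := (children_image f hf t hmem hcov x.1).1 x.2
      exact ⟨⟨c, hc⟩, Subtype.ext h⟩⟩

/-! ### Edge collapse -/

/-- An internal edge of a tree: its lower and its upper endpoint are vertices. -/
structure InternalEdge where
  lower : T.Vertex
  upper : T.Vertex
  mem : upper.1 ∈ T.children lower.1

variable {T}

lemma InternalEdge.upper_ssubset (e : T.InternalEdge) : e.upper.1 ⊂ e.lower.1 :=
  (T.mem_children.1 e.mem).2.1

variable (T) in
/-- The tree `T / e`. -/
def contract (e : T.InternalEdge) : LTree A where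
  clusters := T.clusters.erase e.upper.1
  univ_mem := Finset.mem_erase.2 ⟨fun h => by
    have := e.upper_ssubset
    rw [← h] at this
    exact this.2 (Finset.subset_univ _), T.univ_mem⟩
  singleton_mem a := Finset.mem_erase.2 ⟨fun h => by
    have := e.upper.card
    rw [← h] at this
    simp at this, T.singleton_mem a⟩
  nonempty h := T.nonempty (Finset.mem_of_mem_erase h)
  nested h h' := T.nested (Finset.mem_of_mem_erase h) (Finset.mem_of_mem_erase h')

/-- A vertex of `T / e`, as a vertex of `T`. -/
def contractVertex (e : T.InternalEdge) (w : (T.contract e).Vertex) : T.Vertex :=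
  ⟨w.1, Finset.mem_filter.2 ⟨Finset.mem_of_mem_erase w.mem, w.card⟩⟩

/-- The vertex `u ∘ v` of `T / e` that results from identifying the endpoints `u`, `v` of `e`. -/
def merged (e : T.InternalEdge) : (T.contract e).Vertex :=
  ⟨e.lower.1, Finset.mem_filter.2
    ⟨Finset.mem_erase.2 ⟨e.upper_ssubset.ne', e.lower.mem⟩, e.lower.card⟩⟩

/-- The other vertices of `T / e` have the same incoming edges as in `T`. -/
noncomputable def contractInc (e : T.InternalEdge) (w : (T.contract e).Vertex)
    (hw : w ≠ merged e) : T.inc (contractVertex e w) ≃ (T.contract e).inc w :=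
  (childEquiv (T := T.contract e) (T' := T) id (fun _ _ => Iff.rfl) w.1
    (fun _ hc _ => Finset.mem_of_mem_erase hc)
    (fun x hx hxw => by
      by_cases h : x = e.upper.1
      · subst h
        have hlw : e.lower.1 ⊆ w.1 := by
          rcases T.nested e.lower.mem (contractVertex e w).mem with h | h | h
          · exact h
          · have h' : (contractVertex e w).1 ⊂ e.lower.1 :=
              Finset.ssubset_iff_subset_ne.2 ⟨h, fun h' => hw (Subtype.ext h')⟩
            exact absurd h' ((T.mem_children.1 e.mem).2.2 _ (contractVertex e w).mem hxw)
          · obtain ⟨y, hy⟩ := T.nonempty hx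
            exact absurd (hxw.subset hy) (Finset.disjoint_left.1 h (e.upper_ssubset.subset hy))
        exact ⟨e.lower.1, (merged e).mem, Finset.ssubset_iff_subset_ne.2
          ⟨hlw, fun h => hw (Subtype.ext h.symm)⟩, e.upper_ssubset.subset⟩
      · exact ⟨x, Finset.mem_erase.2 ⟨h, hx⟩, hxw, subset_rfl⟩)).symm

/-- `i(u) ∪ᵥ i(v) ≃ i(u ∘ v)`. -/
noncomputable def mergedInc (e : T.InternalEdge) :
    NFin.ins (T.inc e.lower) ⟨e.upper.1, e.mem⟩ (T.inc e.upper) ≃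
      (T.contract e).inc (merged e) := by
  refine Equiv.ofBijective (Sum.elim (fun x => ⟨x.1.1, ?_⟩) (fun y => ⟨y.1, ?_⟩)) ⟨?_, ?_⟩
  · obtain ⟨h1, h2, h3⟩ := T.mem_children.1 x.1.2
    exact (T.contract e).mem_children.2 ⟨Finset.mem_erase.2
      ⟨fun h => x.2 (Subtype.ext h), h1⟩, h2, fun d hd => h3 d (Finset.mem_of_mem_erase hd)⟩
  · obtain ⟨h1, h2, h3⟩ := T.mem_children.1 y.2
    refine (T.contract e).mem_children.2 ⟨Finset.mem_erase.2 ⟨h2.ne, h1⟩,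
      h2.trans e.upper_ssubset, fun d hd hyd hdl => ?_⟩
    obtain ⟨hd, hd'⟩ := Finset.mem_erase.1 hd
    rcases T.nested hd' e.upper.mem with h | h | h
    · exact h3 d hd' hyd (Finset.ssubset_iff_subset_ne.2 ⟨h, hd⟩)
    · exact (T.mem_children.1 e.mem).2.2 d hd'
        (Finset.ssubset_iff_subset_ne.2 ⟨h, hd.symm⟩) hdl
    · obtain ⟨z, hz⟩ := T.nonempty h1
      exact Finset.disjoint_left.1 h (hyd.subset hz) (h2.subset hz)
  · have key : ∀ (x : {x : T.inc e.lower // x ≠ ⟨e.upper.1, e.mem⟩}) (y : T.inc e.upper),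
        x.1.1 ≠ y.1 := fun x y h => by
      have h1 := (T.mem_children.1 y.2).2.1
      rw [← h] at h1
      exact (T.mem_children.1 x.1.2).2.2 _ e.upper.mem h1 e.upper_ssubset
    rintro (x | x) (y | y) h <;> have h' := Subtype.ext_iff.1 h
    · exact congrArg _ (Subtype.ext (Subtype.ext h'))
    · exact absurd h' (key x y)
    · exact absurd h'.symm (key y x)
    · exact congrArg _ (Subtype.ext h')
  · rintro ⟨x, hx⟩
    obtain ⟨h1, h2, h3⟩ := (T.contract e).mem_children.1 hx
    obtain ⟨hxv, hxT⟩ := Finset.mem_erase.1 h1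
    by_cases h : x ⊆ e.upper.1
    · refine ⟨Sum.inr ⟨x, T.mem_children.2 ⟨hxT, Finset.ssubset_iff_subset_ne.2 ⟨h, hxv⟩,
        fun d hd hxd hdv => ?_⟩⟩, rfl⟩
      exact h3 d (Finset.mem_erase.2 ⟨hdv.ne, hd⟩) hxd (hdv.trans e.upper_ssubset)
    · refine ⟨Sum.inl ⟨⟨x, T.mem_children.2 ⟨hxT, h2, fun d hd hxd hdl => ?_⟩⟩,
        fun h' => hxv (congrArg Subtype.val h')⟩, rfl⟩
      by_cases hdv : d = e.upper.1
      · exact h (hdv ▸ hxd.subset)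
      · exact h3 d (Finset.mem_erase.2 ⟨hdv, hd⟩) hxd hdl

/-! ### Relabelling -/

lemma map_subset_iff {A A' : NFin} (σ : A ≃ A') (c d : Finset A) :
    c.map σ.toEmbedding ⊆ d.map σ.toEmbedding ↔ c ⊆ d := Finset.map_subset_map

/-- Relabelling of a tree along a bijection. -/
def relabel {A' : NFin} (σ : A ≃ A') (T : LTree A) : LTree A' where
  clusters := T.clusters.image fun c => c.map σ.toEmbedding
  univ_mem := Finset.mem_image.2 ⟨_, T.univ_mem, by simp⟩
  singleton_mem a := Finset.mem_image.2 ⟨_, T.singleton_mem (σ.symm a), by simp⟩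
  nonempty h := by
    obtain ⟨c, hc, rfl⟩ := Finset.mem_image.1 h
    exact (T.nonempty hc).map
  nested h h' := by
    obtain ⟨c, hc, rfl⟩ := Finset.mem_image.1 h
    obtain ⟨d, hd, rfl⟩ := Finset.mem_image.1 h'
    simpa using T.nested hc hd

/-- Relabelling of a vertex. -/
def relabelVertex {A' : NFin} (σ : A ≃ A') (v : T.Vertex) : (T.relabel σ).Vertex :=
  ⟨v.1.map σ.toEmbedding, Finset.mem_filter.2
    ⟨Finset.mem_image_of_mem _ v.mem, by simpa using v.card⟩⟩

/-- Relabelling of incoming edges. -/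
noncomputable def relabelInc {A' : NFin} (σ : A ≃ A') (v : T.Vertex) :
    T.inc v ≃ (T.relabel σ).inc (relabelVertex σ v) :=
  childEquiv (fun c => c.map σ.toEmbedding) (map_subset_iff σ) v.1
    (fun _ hc _ => Finset.mem_image_of_mem _ hc)
    (fun x hx hxv => by
      obtain ⟨c, hc, rfl⟩ := Finset.mem_image.1 hx
      exact ⟨c, hc, by simpa using hxv, subset_rfl⟩)

/-! ### Grafting -/

section Graft

variable {A B : NFin} (a : A)

/-- The set of labels obtained from `c` by replacing the label `a` by all labels in `B`. -/
def lowerCluster (B : NFin) (c : Finset A) : Finset (NFin.ins A a B) :=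
  Finset.univ.filter fun x => Sum.elim (fun y => y.1) (fun _ => a) x ∈ c

/-- A set of labels in `B`, as a subset of `A ∪ₐ B`. -/
def upperCluster (c : Finset B) : Finset (NFin.ins A a B) :=
  c.map ⟨Sum.inr, Sum.inr_injective⟩

@[simp] lemma inl_mem_lowerCluster (c : Finset A) (x : {x : A // x ≠ a}) :
    (Sum.inl x : {x : A // x ≠ a} ⊕ B) ∈ lowerCluster a B c ↔ x.1 ∈ c := by
  simp [lowerCluster]

@[simp] lemma inr_mem_lowerCluster (c : Finset A) (x : B) :
    (Sum.inr x : {x : A // x ≠ a} ⊕ B) ∈ lowerCluster a B c ↔ a ∈ c := by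
  simp [lowerCluster]

@[simp] lemma inl_mem_upperCluster (c : Finset B) (x : {x : A // x ≠ a}) :
    (Sum.inl x : {x : A // x ≠ a} ⊕ B) ∈ upperCluster a c ↔ False := by
  simp [upperCluster]

@[simp] lemma inr_mem_upperCluster (c : Finset B) (x : B) :
    (Sum.inr x : {x : A // x ≠ a} ⊕ B) ∈ upperCluster a c ↔ x ∈ c := by
  simp [upperCluster]

lemma lowerCluster_subset (c d : Finset A) :
    lowerCluster a B c ⊆ lowerCluster a B d ↔ c ⊆ d := by
  refine ⟨fun h x hx => ?_, ?_⟩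
  · by_cases hxa : x = a
    · subst hxa
      obtain ⟨b⟩ := B.nonempty
      exact (inr_mem_lowerCluster x d b).1 (h ((inr_mem_lowerCluster x c b).2 hx))
    · exact (inl_mem_lowerCluster a d ⟨x, hxa⟩).1 (h ((inl_mem_lowerCluster a c ⟨x, hxa⟩).2 hx))
  · rintro h (x | x) hx
    · exact (inl_mem_lowerCluster a d x).2 (h ((inl_mem_lowerCluster a c x).1 hx))
    · exact (inr_mem_lowerCluster a d x).2 (h ((inr_mem_lowerCluster a c x).1 hx))

lemma upperCluster_subset (c d : Finset B) : upperCluster a c ⊆ upperCluster a d ↔ c ⊆ d :=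
  Finset.map_subset_map

lemma lowerCluster_ssubset (c d : Finset A) :
    lowerCluster a B c ⊂ lowerCluster a B d ↔ c ⊂ d := by
  rw [Finset.ssubset_def, Finset.ssubset_def, lowerCluster_subset, lowerCluster_subset]

lemma upperCluster_ssubset (c d : Finset B) : upperCluster a c ⊂ upperCluster a d ↔ c ⊂ d := by
  rw [Finset.ssubset_def, Finset.ssubset_def, upperCluster_subset, upperCluster_subset]

lemma lowerCluster_singleton : lowerCluster a B {a} = upperCluster a Finset.univ := by
  ext (x | x)
  · rw [inl_mem_lowerCluster, inl_mem_upperCluster]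
    simpa using x.2
  · rw [inr_mem_lowerCluster, inr_mem_upperCluster]
    simp

lemma lowerCluster_injective : Function.Injective (lowerCluster a B) := fun c d h =>
  Finset.Subset.antisymm ((lowerCluster_subset a c d).1 h.subset)
    ((lowerCluster_subset a d c).1 h.symm.subset)

lemma upperCluster_injective : Function.Injective (upperCluster (B := B) a) :=
  Finset.map_injective _

lemma eq_singleton_of_lowerCluster_eq {c : Finset A} (hc : c.Nonempty) {d : Finset B}
    (h : lowerCluster a B c = upperCluster a d) : c = {a} := by
  refine Finset.eq_singleton_iff_nonempty_unique_mem.2 ⟨hc, fun x hx => ?_⟩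
  by_contra hxa
  have := (inl_mem_lowerCluster (B := B) a c ⟨x, hxa⟩).2 hx
  rw [h, inl_mem_upperCluster] at this
  exact this

/-- The grafting `T ∪ₐ U` of `U` onto `T` at `a`. -/
def graft (T : LTree A) (a : A) (U : LTree B) : LTree (NFin.ins A a B) where
  clusters := T.clusters.image (lowerCluster a B) ∪ U.clusters.image (upperCluster a)
  univ_mem := Finset.mem_union_left _ (Finset.mem_image.2 ⟨_, T.univ_mem, by
    ext (x | x)
    · simpa using (inl_mem_lowerCluster a _ x).2 (Finset.mem_univ _)
    · simpa using (inr_mem_lowerCluster a _ x).2 (Finset.mem_univ _)⟩)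
  singleton_mem := by
    rintro (x | x)
    · refine Finset.mem_union_left _ (Finset.mem_image.2 ⟨_, T.singleton_mem x.1, ?_⟩)
      ext (y | y)
      · rw [inl_mem_lowerCluster, Finset.mem_singleton, Finset.mem_singleton, Sum.inl.injEq,
          Subtype.ext_iff]
      · rw [inr_mem_lowerCluster, Finset.mem_singleton, Finset.mem_singleton]
        simpa using x.2.symm
    · refine Finset.mem_union_right _ (Finset.mem_image.2 ⟨_, U.singleton_mem x, ?_⟩)
      simp [upperCluster]
  nonempty h := by
    rcases Finset.mem_union.1 h with h | h
    · obtain ⟨c, hc, rfl⟩ := Finset.mem_image.1 h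
      obtain ⟨x, hx⟩ := T.nonempty hc
      by_cases hxa : x = a
      · subst hxa
        obtain ⟨b⟩ := B.nonempty
        exact ⟨_, (inr_mem_lowerCluster x c b).2 hx⟩
      · exact ⟨_, (inl_mem_lowerCluster a c ⟨x, hxa⟩).2 hx⟩
    · obtain ⟨c, hc, rfl⟩ := Finset.mem_image.1 h
      exact (U.nonempty hc).map
  nested {c d} h h' := by
    have mixed : ∀ c : Finset A, ∀ d : Finset B, upperCluster a d ⊆ lowerCluster a B c ∨
        Disjoint (lowerCluster a B c) (upperCluster a d) := fun c d => by
      by_cases ha : a ∈ c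
      · left
        rintro (x | x) hx
        · exact ((inl_mem_upperCluster a d x).1 hx).elim
        · exact (inr_mem_lowerCluster a c x).2 ha
      · right
        rw [Finset.disjoint_left]
        rintro (x | x) hx hx'
        · exact (inl_mem_upperCluster a d x).1 hx'
        · exact ha ((inr_mem_lowerCluster a c x).1 hx)
    rcases Finset.mem_union.1 h with h | h <;> rcases Finset.mem_union.1 h' with h' | h' <;>
      obtain ⟨c, hc, rfl⟩ := Finset.mem_image.1 h <;>
      obtain ⟨d, hd, rfl⟩ := Finset.mem_image.1 h'
    · rcases T.nested hc hd with h | h | h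
      · exact Or.inl ((lowerCluster_subset a c d).2 h)
      · exact Or.inr (Or.inl ((lowerCluster_subset a d c).2 h))
      · refine Or.inr (Or.inr (Finset.disjoint_left.2 ?_))
        rintro (x | x) hx hx'
        · exact Finset.disjoint_left.1 h ((inl_mem_lowerCluster a c x).1 hx)
            ((inl_mem_lowerCluster a d x).1 hx')
        · exact Finset.disjoint_left.1 h ((inr_mem_lowerCluster a c x).1 hx)
            ((inr_mem_lowerCluster a d x).1 hx')
    · rcases mixed c d with h | h
      · exact Or.inr (Or.inl h)
      · exact Or.inr (Or.inr h)
    · rcases mixed d c with h | h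
      · exact Or.inl h
      · exact Or.inr (Or.inr h.symm)
    · rcases U.nested hc hd with h | h | h
      · exact Or.inl ((upperCluster_subset a c d).2 h)
      · exact Or.inr (Or.inl ((upperCluster_subset a d c).2 h))
      · exact Or.inr (Or.inr ((Finset.disjoint_map _).2 h))

variable (T : LTree A) (U : LTree B)

variable {T} in
/-- A vertex of `T`, as a vertex of `T ∪ₐ U`. -/
def lowerVertex (v : T.Vertex) : (T.graft a U).Vertex :=
  ⟨lowerCluster a B v.1, Finset.mem_filter.2
    ⟨Finset.mem_union_left _ (Finset.mem_image_of_mem _ v.mem), by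
      obtain ⟨b⟩ := B.nonempty
      refine v.card.trans_le (Finset.card_le_card_of_injOn
        (fun x => if h : x = a then Sum.inr b else Sum.inl ⟨x, h⟩) ?_ ?_)
      · intro x hx
        by_cases h : x = a
        · subst h
          simpa using (inr_mem_lowerCluster x v.1 b).2 hx
        · simpa [h] using (inl_mem_lowerCluster a v.1 ⟨x, h⟩).2 hx
      · intro x _ y _ hxy
        by_cases h : x = a <;> by_cases h' : y = a <;> simp_all⟩⟩

variable {U} in
/-- A vertex of `U`, as a vertex of `T ∪ₐ U`. -/
def upperVertex (v : U.Vertex) : (T.graft a U).Vertex :=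
  ⟨upperCluster a v.1, Finset.mem_filter.2
    ⟨Finset.mem_union_right _ (Finset.mem_image_of_mem _ v.mem), by
      simpa [upperCluster] using v.card⟩⟩

variable {T} in
/-- A vertex of `T` has the same incoming edges in `T ∪ₐ U`. -/
noncomputable def lowerInc (v : T.Vertex) :
    T.inc v ≃ (T.graft a U).inc (lowerVertex a U v) :=
  childEquiv (lowerCluster a B) (lowerCluster_subset a) v.1
    (fun _ hc _ => Finset.mem_union_left _ (Finset.mem_image_of_mem _ hc))
    (fun x hx hxv => by
      rcases Finset.mem_union.1 hx with h | h
      · obtain ⟨c, hc, rfl⟩ := Finset.mem_image.1 h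
        exact ⟨c, hc, (lowerCluster_ssubset a c v.1).1 hxv, subset_rfl⟩
      · obtain ⟨d, hd, rfl⟩ := Finset.mem_image.1 h
        obtain ⟨b, hb⟩ := U.nonempty hd
        have ha : a ∈ v.1 := (inr_mem_lowerCluster a v.1 b).1
          (hxv.subset ((inr_mem_upperCluster a d b).2 hb))
        refine ⟨{a}, T.singleton_mem a, Finset.ssubset_iff_subset_ne.2
          ⟨Finset.singleton_subset_iff.2 ha, fun h => ?_⟩, ?_⟩
        · have := v.card
          rw [← h] at this
          simp at this
        · rw [lowerCluster_singleton, upperCluster_subset]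
          exact Finset.subset_univ _)

variable {U} in
/-- A vertex of `U` has the same incoming edges in `T ∪ₐ U`. -/
noncomputable def upperInc (v : U.Vertex) :
    U.inc v ≃ (T.graft a U).inc (upperVertex a T v) :=
  childEquiv (upperCluster a) (upperCluster_subset a) v.1
    (fun _ hc _ => Finset.mem_union_right _ (Finset.mem_image_of_mem _ hc))
    (fun x hx hxv => by
      rcases Finset.mem_union.1 hx with h | h
      · obtain ⟨c, hc, rfl⟩ := Finset.mem_image.1 h
        obtain ⟨y, hy⟩ := T.nonempty hc
        exfalso
        have hca : c = {a} := by
          refine Finset.eq_singleton_iff_nonempty_unique_mem.2 ⟨⟨y, hy⟩, fun z hz => ?_⟩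
          by_contra hza
          exact (inl_mem_upperCluster a v.1 ⟨z, hza⟩).1
            (hxv.subset ((inl_mem_lowerCluster a c ⟨z, hza⟩).2 hz))
        rw [hca, lowerCluster_singleton] at hxv
        exact hxv.2 ((upperCluster_subset a _ _).2 (Finset.subset_univ _))
      · obtain ⟨d, hd, rfl⟩ := Finset.mem_image.1 h
        exact ⟨d, hd, (upperCluster_ssubset a d v.1).1 hxv, subset_rfl⟩)

end Graft

end LTree

/-! ### Labelled trees as posets -/

/-- A tree labelled by `A`: a finite poset with a root `r` and an element `b ≠ r` below all other
elements, such that elements with a common upper bound are comparable and no element other than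
the root has exactly one incoming edge, together with a bijection of `A` with the set of leaves,
that is, of maximal elements. -/
structure PosetTree (A : NFin) where
  carrier : Type
  [order : PartialOrder carrier]
  [finite : Finite carrier]
  root : carrier
  base : carrier
  base_ne : base ≠ root
  root_le (t : carrier) : root ≤ t
  base_le (t : carrier) : t ≠ root → base ≤ t
  comparable (t u v : carrier) : u ≤ t → v ≤ t → u ≤ v ∨ v ≤ u
  reduced (t u : carrier) : t < u → t ≠ root → ∃ v, t < v ∧ ¬ u ≤ v
  leaf : A → carrier
  leaf_injective : Function.Injective leaf
  isMax_iff (t : carrier) : IsMax t ↔ ∃ a, leaf a = t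

namespace PosetTree

instance {A : NFin} : CoeSort (PosetTree A) Type := ⟨PosetTree.carrier⟩

attribute [instance] PosetTree.order PosetTree.finite

variable {A : NFin} (X : PosetTree A)

lemma exists_leaf (t : X) : ∃ a, t ≤ X.leaf a := by
  obtain ⟨m, hm, hmax⟩ := Finite.exists_le_maximal (p := fun _ : X => True) (a := t) trivial
  obtain ⟨a, rfl⟩ := (X.isMax_iff m).1 fun b hb => hmax.2 trivial hb
  exact ⟨a, hm⟩

lemma leaf_le_iff (a : A) (t : X) : X.leaf a ≤ t ↔ X.leaf a = t :=
  ⟨fun h => le_antisymm h ((X.isMax_iff _).2 ⟨a, rfl⟩ h), fun h => h.le⟩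

lemma leaf_ne_root (a : A) : X.leaf a ≠ X.root := fun h => by
  have := (X.leaf_le_iff a X.base).1 (h ▸ X.root_le _)
  exact X.base_ne (this.symm.trans h)

open Classical in
/-- The set of labels of the leaves above `t`. -/
noncomputable def cluster (t : X) : Finset A := Finset.univ.filter fun a => t ≤ X.leaf a

@[simp] lemma mem_cluster (t : X) (a : A) : a ∈ X.cluster t ↔ t ≤ X.leaf a := by simp [cluster]

lemma cluster_leaf (a : A) : X.cluster (X.leaf a) = {a} := by
  ext x
  rw [mem_cluster, leaf_le_iff, Finset.mem_singleton, X.leaf_injective.eq_iff, eq_comm]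

lemma cluster_subset_iff {t u : X} (hu : u ≠ X.root) :
    X.cluster u ⊆ X.cluster t ↔ t ≤ u := by
  refine ⟨fun h => ?_, fun h a ha => ?_⟩
  · by_contra htu
    obtain ⟨a, ha⟩ := X.exists_leaf u
    have hta : t ≤ X.leaf a := (X.mem_cluster t a).1 (h ((X.mem_cluster u a).2 ha))
    have hut : u < t := lt_of_le_not_ge ((X.comparable _ _ _ hta ha).resolve_left htu) htu
    obtain ⟨w, huw, hwt⟩ := exists_covBy_le_of_lt hut
    obtain ⟨v, huv, hwv⟩ := X.reduced u w huw.lt hu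
    obtain ⟨b, hb⟩ := X.exists_leaf v
    have htb : t ≤ X.leaf b :=
      (X.mem_cluster t b).1 (h ((X.mem_cluster u b).2 (huv.le.trans hb)))
    have hvw := (X.comparable _ _ _ hb (hwt.trans htb)).resolve_right hwv
    exact huw.2 huv (lt_of_le_not_ge hvw hwv)
  · exact (X.mem_cluster t a).2 (h.trans ((X.mem_cluster u a).1 ha))

/-- The isomorphism class of a labelled tree. -/
noncomputable def toLTree : LTree A where
  clusters := open Classical in
    (Set.toFinite {c | ∃ t, t ≠ X.root ∧ X.cluster t = c}).toFinset
  univ_mem := (Set.Finite.mem_toFinset _).2 ⟨X.base, X.base_ne, by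
    ext a
    simpa using X.base_le _ (X.leaf_ne_root a)⟩
  singleton_mem a := (Set.Finite.mem_toFinset _).2 ⟨X.leaf a, X.leaf_ne_root a, X.cluster_leaf a⟩
  nonempty h := by
    obtain ⟨t, -, rfl⟩ := (Set.Finite.mem_toFinset _).1 h
    obtain ⟨a, ha⟩ := X.exists_leaf t
    exact ⟨a, (X.mem_cluster t a).2 ha⟩
  nested h h' := by
    obtain ⟨t, ht, rfl⟩ := (Set.Finite.mem_toFinset _).1 h
    obtain ⟨u, hu, rfl⟩ := (Set.Finite.mem_toFinset _).1 h'
    rw [X.cluster_subset_iff ht, X.cluster_subset_iff hu]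
    by_cases hd : Disjoint (X.cluster t) (X.cluster u)
    · exact Or.inr (Or.inr hd)
    · obtain ⟨a, ha, ha'⟩ := Finset.not_disjoint_iff.1 hd
      rcases X.comparable _ _ _ ((X.mem_cluster t a).1 ha) ((X.mem_cluster u a).1 ha') with h | h
      exacts [Or.inr (Or.inl h), Or.inl h]

lemma mem_toLTree (c : Finset A) :
    c ∈ X.toLTree.clusters ↔ ∃ t, t ≠ X.root ∧ X.cluster t = c := by simp [toLTree]

/-- Two labelled trees have the same class if and only if they are isomorphic. -/
theorem toLTree_eq_iff (X Y : PosetTree A) :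
    X.toLTree = Y.toLTree ↔ ∃ f : X ≃o Y, ∀ a, f (X.leaf a) = Y.leaf a := by
  constructor
  · intro h
    have h1 : ∀ t : X, ∃ y : Y, (t = X.root ↔ y = Y.root) ∧
        (t ≠ X.root → Y.cluster y = X.cluster t) := fun t => by
      by_cases ht : t = X.root
      · exact ⟨Y.root, by simp [ht], fun h => (h ht).elim⟩
      · have := (X.mem_toLTree _).2 ⟨t, ht, rfl⟩
        rw [h] at this
        obtain ⟨y, hy, hyt⟩ := (Y.mem_toLTree _).1 this
        exact ⟨y, by simp [ht, hy], fun _ => hyt⟩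
    choose f hf hf' using h1
    have hle : ∀ t u, f t ≤ f u ↔ t ≤ u := fun t u => by
      by_cases ht : t = X.root
      · rw [(hf t).1 ht, ht]
        exact iff_of_true (Y.root_le _) (X.root_le _)
      by_cases hu : u = X.root
      · refine iff_of_false (fun h => ht ((hf t).2 ?_)) fun h => ht ?_
        · rw [(hf u).1 hu] at h
          exact le_antisymm h (Y.root_le _)
        · exact le_antisymm (hu ▸ h) (X.root_le _)
      · rw [← Y.cluster_subset_iff (fun h => hu ((hf u).2 h)), hf' u hu, hf' t ht,
          X.cluster_subset_iff hu]
    have hinj : ∀ y y' : Y, y ≠ Y.root → y' ≠ Y.root → Y.cluster y = Y.cluster y' → y = y' :=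
      fun y y' hy hy' h => le_antisymm ((Y.cluster_subset_iff hy').1 h.symm.subset)
        ((Y.cluster_subset_iff hy).1 h.subset)
    refine ⟨RelIso.ofSurjective (OrderEmbedding.ofMapLEIff f hle) fun y => ?_, fun a => ?_⟩
    · by_cases hy : y = Y.root
      · exact ⟨X.root, ((hf _).1 rfl).trans hy.symm⟩
      · have := (Y.mem_toLTree _).2 ⟨y, hy, rfl⟩
        rw [← h] at this
        obtain ⟨t, ht, hty⟩ := (X.mem_toLTree _).1 this
        exact ⟨t, hinj _ _ (fun h => ht ((hf t).2 h)) hy ((hf' t ht).trans hty)⟩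
    · refine hinj _ _ (fun h => X.leaf_ne_root a ((hf _).2 h)) (Y.leaf_ne_root a) ?_
      exact (hf' _ (X.leaf_ne_root a)).trans ((X.cluster_leaf a).trans (Y.cluster_leaf a).symm)
  · rintro ⟨f, hf⟩
    have hr : f X.root = Y.root := by
      refine le_antisymm ?_ (Y.root_le _)
      rw [← f.le_symm_apply]
      exact X.root_le _
    have hc : ∀ t, Y.cluster (f t) = X.cluster t := fun t => by
      ext a
      rw [mem_cluster, mem_cluster, ← hf, f.le_iff_le]
    refine LTree.ext (Finset.ext fun c => ?_)
    rw [mem_toLTree, mem_toLTree]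
    constructor
    · rintro ⟨t, ht, rfl⟩
      exact ⟨f t, fun h => ht (f.injective (h.trans hr.symm)), hc t⟩
    · rintro ⟨y, hy, rfl⟩
      obtain ⟨t, rfl⟩ := f.surjective y
      exact ⟨t, fun h => hy (h ▸ hr), (hc t).symm⟩

/-- Every family of clusters is the class of a labelled tree. -/
theorem toLTree_surjective (T : LTree A) : ∃ X : PosetTree A, X.toLTree = T := by
  let X : PosetTree A :=
    { carrier := WithBot {c : Finset A // c ∈ T.clusters}ᵒᵈ
      root := ⊥
      base := ((OrderDual.toDual ⟨_, T.univ_mem⟩ : {c : Finset A // c ∈ T.clusters}ᵒᵈ) : WithBot _)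
      base_ne := WithBot.coe_ne_bot
      root_le := fun _ => bot_le
      base_le := fun t ht => by
        induction t with
        | bot => exact (ht rfl).elim
        | coe t => exact WithBot.coe_le_coe.2 (Finset.subset_univ t.ofDual.1)
      comparable := fun t u v hu hv => by
        induction u with
        | bot => exact Or.inl bot_le
        | coe u =>
          induction v with
          | bot => exact Or.inr bot_le
          | coe v =>
            induction t with
            | bot => exact (WithBot.not_coe_le_bot _ hu).elim
            | coe t =>
              have hu' : t.ofDual.1 ⊆ u.ofDual.1 :=
                (WithBot.coe_le_coe (α := {c : Finset A // c ∈ T.clusters}ᵒᵈ)).1 hu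
              have hv' : t.ofDual.1 ⊆ v.ofDual.1 :=
                (WithBot.coe_le_coe (α := {c : Finset A // c ∈ T.clusters}ᵒᵈ)).1 hv
              rw [WithBot.coe_le_coe, WithBot.coe_le_coe]
              rcases T.nested u.ofDual.2 v.ofDual.2 with h | h | h
              · exact Or.inr h
              · exact Or.inl h
              · obtain ⟨x, hx⟩ := T.nonempty t.ofDual.2
                exact absurd (hv' hx) (Finset.disjoint_left.1 h (hu' hx))
      reduced := fun t u htu ht => by
        induction t with
        | bot => exact (ht rfl).elim
        | coe t =>
          induction u with
          | bot => exact (not_lt_bot htu).elim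
          | coe u =>
            have h : u.ofDual.1 ⊂ t.ofDual.1 :=
              (WithBot.coe_lt_coe (α := {c : Finset A // c ∈ T.clusters}ᵒᵈ)).1 htu
            obtain ⟨x, hx, hxu⟩ := Finset.exists_of_ssubset h
            refine ⟨((OrderDual.toDual ⟨{x}, T.singleton_mem x⟩ :
              {c : Finset A // c ∈ T.clusters}ᵒᵈ) : WithBot _), WithBot.coe_lt_coe.2 ?_, fun h' => ?_⟩
            · change ({x} : Finset A) ⊂ t.ofDual.1
              refine Finset.ssubset_iff_subset_ne.2 ⟨Finset.singleton_subset_iff.2 hx, fun h' => ?_⟩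
              rw [← h'] at h
              rw [Finset.ssubset_singleton_iff] at h
              exact (T.nonempty u.ofDual.2).ne_empty h
            · have h' : ({x} : Finset A) ⊆ u.ofDual.1 :=
                (WithBot.coe_le_coe (α := {c : Finset A // c ∈ T.clusters}ᵒᵈ)).1 h'
              exact hxu (Finset.singleton_subset_iff.1 h')
      leaf := fun a => ((OrderDual.toDual ⟨{a}, T.singleton_mem a⟩ :
        {c : Finset A // c ∈ T.clusters}ᵒᵈ) : WithBot _)
      leaf_injective := fun a a' h => Finset.singleton_injective
        (congrArg (fun c : {c : Finset A // c ∈ T.clusters}ᵒᵈ => c.ofDual.1) (WithBot.coe_injective h))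
      isMax_iff := fun t => by
        constructor
        · intro h
          induction t with
          | bot =>
            have := h (b := ((OrderDual.toDual ⟨_, T.univ_mem⟩ :
              {c : Finset A // c ∈ T.clusters}ᵒᵈ) : WithBot _)) bot_le
            exact (WithBot.not_coe_le_bot _ this).elim
          | coe t =>
            obtain ⟨x, hx⟩ := T.nonempty t.ofDual.2
            refine ⟨x, le_antisymm (h ?_) ?_⟩ <;>
              exact WithBot.coe_le_coe.2 (Finset.singleton_subset_iff.2 hx)
        · rintro ⟨a, rfl⟩ s hs
          induction s with
          | bot => exact bot_le
          | coe s =>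
            have h : s.ofDual.1 ⊆ {a} :=
                (WithBot.coe_le_coe (α := {c : Finset A // c ∈ T.clusters}ᵒᵈ)).1 hs
            refine WithBot.coe_le_coe.2 ?_
            change {a} ⊆ s.ofDual.1
            rw [(Finset.Nonempty.subset_singleton_iff (T.nonempty s.ofDual.2)).1 h] }
  have hX : ∀ t : {c : Finset A // c ∈ T.clusters}ᵒᵈ, X.cluster (t : WithBot _) = t.ofDual.1 :=
    fun t => by
      ext a
      rw [mem_cluster]
      exact WithBot.coe_le_coe.trans Finset.singleton_subset_iff
  refine ⟨X, LTree.ext (Finset.ext fun c => ?_)⟩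
  rw [mem_toLTree]
  constructor
  · rintro ⟨t, ht, rfl⟩
    change WithBot _ at t
    induction t with
    | bot => exact (ht rfl).elim
    | coe t =>
      rw [hX]
      exact t.ofDual.2
  · exact fun hc => ⟨((OrderDual.toDual ⟨c, hc⟩ : {c : Finset A // c ∈ T.clusters}ᵒᵈ) : WithBot _),
      WithBot.coe_ne_bot, hX _⟩

end PosetTree

namespace LTree

/-! ### Weightings -/

section Weighting

variable {A : NFin}

/-- Weightings on a tree: nonnegative lengths of the edges such that the distance from the root to
each leaf is `1`. A weighting is extended by zero to all sets of labels. -/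
def Weighting (T : LTree A) : Type :=
  {l : Finset A → ℝ // (∀ c, 0 ≤ l c) ∧ (∀ c, c ∉ T.clusters → l c = 0) ∧
    ∀ x : A, ∑ c ∈ T.clusters with x ∈ c, l c = 1}

/-- The length of an edge. -/
def Weighting.len {T : LTree A} (l : T.Weighting) (c : Finset A) : ℝ := l.1 c

/-- The space of weightings has the subspace topology of the product. -/
instance (T : LTree A) : TopologicalSpace T.Weighting := instTopologicalSpaceSubtype

namespace Weighting

variable {T : LTree A}

lemma nonneg (l : T.Weighting) (c : Finset A) : 0 ≤ l.len c := l.2.1 c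

lemma eq_zero (l : T.Weighting) {c : Finset A} (h : c ∉ T.clusters) : l.len c = 0 := l.2.2.1 c h

lemma sum_eq (l : T.Weighting) (x : A) : ∑ c ∈ T.clusters with x ∈ c, l.len c = 1 := l.2.2.2 x

lemma ext {l m : T.Weighting} (h : ∀ c ∈ T.clusters, l.len c = m.len c) : l = m :=
  Subtype.ext (funext fun c => by
    by_cases hc : c ∈ T.clusters
    · exact h c hc
    · exact (l.eq_zero hc).trans (m.eq_zero hc).symm)

lemma continuous_len (c : Finset A) : Continuous fun l : T.Weighting => l.len c :=
  (continuous_apply c).comp continuous_subtype_val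

lemma len_le_one (l : T.Weighting) (c : Finset A) : l.len c ≤ 1 := by
  by_cases hc : c ∈ T.clusters
  · obtain ⟨x, hx⟩ := T.nonempty hc
    rw [← l.sum_eq x]
    exact Finset.single_le_sum (f := l.len) (fun d _ => l.nonneg d) (Finset.mem_filter.2 ⟨hc, hx⟩)
  · rw [l.eq_zero hc]
    exact zero_le_one

instance : T2Space T.Weighting := inferInstanceAs (T2Space (Subtype _))

instance : CompactSpace T.Weighting := by
  refine isCompact_iff_compactSpace.1 (IsCompact.of_isClosed_subset
    (isCompact_univ_pi fun _ => isCompact_Icc (a := (0 : ℝ)) (b := 1)) ?_ fun l hl c _ =>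
      ⟨hl.1 c, len_le_one ⟨l, hl⟩ c⟩)
  refine IsClosed.and ?_ (IsClosed.and ?_ ?_)
  · simp only [Set.ofPred_forall]
    exact isClosed_iInter fun c => isClosed_le continuous_const (continuous_apply c)
  · simp only [Set.ofPred_forall]
    exact isClosed_iInter fun c => isClosed_iInter fun _ =>
      isClosed_eq (continuous_apply c) continuous_const
  · simp only [Set.ofPred_forall]
    exact isClosed_iInter fun x =>
      isClosed_eq (continuous_finsetSum _ fun c _ => continuous_apply c) continuous_const

/-- The root edge or a leaf edge has length zero. -/
def IsDegenerate (l : T.Weighting) : Prop := l.len Finset.univ = 0 ∨ ∃ x : A, l.len {x} = 0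

lemma isClosed_isDegenerate : IsClosed {l : T.Weighting | l.IsDegenerate} := by
  refine IsClosed.union (s₁ := {l : T.Weighting | l.len Finset.univ = 0})
    (s₂ := {l : T.Weighting | ∃ x : A, l.len {x} = 0}) ?_ ?_
  · exact isClosed_eq (continuous_len _) continuous_const
  · simp only [Set.ofPred_exists]
    exact isClosed_iUnion_of_finite fun x => isClosed_eq (continuous_len _) continuous_const

end Weighting

/-- The degenerate weightings, together with a disjoint basepoint. -/
def degenerate (T : LTree A) : Set (T.Weighting ⊕ Unit) :=
  {x | ∀ l, x = Sum.inl l → l.IsDegenerate}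

lemma isClosed_degenerate (T : LTree A) : IsClosed T.degenerate := by
  rw [isClosed_sum_iff]
  constructor
  · convert Weighting.isClosed_isDegenerate (T := T) using 1
    ext l
    exact ⟨fun h => h l rfl, fun h m hm => Sum.inl_injective hm ▸ h⟩
  · exact isClosed_discrete _

/-- The space `w̄(T)` of weightings modulo the degenerate ones. (A disjoint basepoint is added if
there are no degenerate weightings.) -/
def wbar (T : LTree A) : TopStar :=
  TopStar.collapse (T.Weighting ⊕ Unit) T.degenerate T.isClosed_degenerate (Sum.inr ())

/-- The point of `w̄(T)` given by a weighting. -/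
def wpt {T : LTree A} (l : T.Weighting) : T.wbar := Quotient.mk (collapseSetoid T.degenerate) (.inl l)

lemma wpt_eq_pt {T : LTree A} {l : T.Weighting} (h : l.IsDegenerate) : wpt l = T.wbar.pt :=
  Quotient.sound (Or.inr ⟨fun _ h' => Sum.inl_injective h' ▸ h, fun _ h' => nomatch h'⟩)

lemma continuous_wpt {T : LTree A} : Continuous (wpt (T := T)) :=
  continuous_quotient_mk'.comp continuous_inl

/-- The based map out of `w̄(T)` induced by a map that collapses the degenerate weightings. -/
def wbarDesc {T : LTree A} {Z : TopStar} (f : T.Weighting → Z) (hf : Continuous f)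
    (h0 : ∀ l : T.Weighting, l.IsDegenerate → f l = Z.pt) : T.wbar ⟶ Z where
  toFun := Quotient.lift (Sum.elim f fun _ => Z.pt) (by
    have h : ∀ x ∈ T.degenerate, Sum.elim f (fun _ => Z.pt) x = Z.pt := by
      rintro (l | _) hl
      · exact h0 l (hl l rfl)
      · rfl
    rintro x y (rfl | ⟨hx, hy⟩)
    · rfl
    · rw [h x hx, h y hy])
  cont := Continuous.quotient_lift (hf.sumElim continuous_const) _
  map_pt := rfl

@[simp] lemma wbarDesc_wpt {T : LTree A} {Z : TopStar} (f : T.Weighting → Z) (hf h0)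
    (l : T.Weighting) : wbarDesc f hf h0 (wpt l) = f l := rfl

/-- A weighting on `T / e`, as the weighting on `T` for which `e` has length zero. -/
def contractWeighting {T : LTree A} (e : T.InternalEdge) (l : (T.contract e).Weighting) :
    T.Weighting :=
  ⟨l.len, l.nonneg, fun c hc => l.eq_zero fun h => hc (Finset.mem_of_mem_erase h), fun x => by
    rw [← l.sum_eq x]
    refine (Finset.sum_subset (Finset.filter_subset_filter _ (Finset.erase_subset _ _))
      fun c hc hc' => l.eq_zero fun h => hc' ?_).symm
    exact Finset.mem_filter.2 ⟨h, (Finset.mem_filter.1 hc).2⟩⟩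

/-- The map `w̄(T / e) ⟶ w̄(T)`. -/
def wbarContract {T : LTree A} (e : T.InternalEdge) : (T.contract e).wbar ⟶ T.wbar :=
  wbarDesc (fun l => wpt (contractWeighting e l))
    (continuous_wpt.comp (continuous_subtype_val.subtype_mk _)) fun _ h => wpt_eq_pt h

/-- Relabelling of a weighting. -/
def relabelWeighting {A' : NFin} (σ : A ≃ A') {T : LTree A} (l : T.Weighting) :
    (T.relabel σ).Weighting :=
  ⟨fun c => l.len (c.map σ.symm.toEmbedding), fun _ => l.nonneg _, fun c hc => l.eq_zero fun h =>
      hc (Finset.mem_image.2 ⟨_, h, by ext; simp⟩), fun x => by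
    rw [← l.sum_eq (σ.symm x)]
    refine Finset.sum_bij' (fun c _ => c.map σ.symm.toEmbedding) (fun c _ => c.map σ.toEmbedding)
      ?_ ?_ ?_ ?_ ?_
    · intro c hc
      obtain ⟨hc, hx⟩ := Finset.mem_filter.1 hc
      obtain ⟨d, hd, rfl⟩ := Finset.mem_image.1 hc
      refine Finset.mem_filter.2 ⟨?_, Finset.mem_map_of_mem _ hx⟩
      rwa [Finset.map_map, Equiv.toEmbedding, Equiv.toEmbedding, show
        (σ.toEmbedding.trans σ.symm.toEmbedding) = .refl _ from by ext; simp, Finset.map_refl]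
    · intro c hc
      obtain ⟨hc, hx⟩ := Finset.mem_filter.1 hc
      exact Finset.mem_filter.2 ⟨Finset.mem_image_of_mem _ hc, by simpa using hx⟩
    · intro c _
      ext
      simp
    · intro c _
      ext
      simp
    · intro c _
      rfl⟩

/-- The map `w̄(T) ⟶ w̄(T')` for `T'` obtained from `T` by relabelling. -/
def wbarRelabel {A' : NFin} (T : LTree A) (σ : A ≃ A') : T.wbar ⟶ (T.relabel σ).wbar :=
  wbarDesc (fun l => wpt (relabelWeighting σ l))
    (continuous_wpt.comp (Continuous.subtype_mk (continuous_pi fun c =>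
      Weighting.continuous_len _) _)) fun l h => wpt_eq_pt (by
        rcases h with h | ⟨x, h⟩
        · exact Or.inl (by simpa [Weighting.len, relabelWeighting] using h)
        · exact Or.inr ⟨σ x, by simpa [Weighting.len, relabelWeighting] using h⟩)

end Weighting

end LTree

namespace LTree

/-! ### Ungrafting of weightings -/

section Key

variable {A B : NFin} {T : LTree A} {a : A} {U : LTree B} (l : (T.graft a U).Weighting)

lemma lowerCluster_mem {c : Finset A} (h : c ∈ T.clusters) :
    lowerCluster a B c ∈ (T.graft a U).clusters :=
  Finset.mem_union_left _ (Finset.mem_image_of_mem _ h)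

lemma upperCluster_mem {d : Finset B} (h : d ∈ U.clusters) :
    upperCluster a d ∈ (T.graft a U).clusters :=
  Finset.mem_union_right _ (Finset.mem_image_of_mem _ h)

lemma sum_inl (x : {x : A // x ≠ a}) :
    ∑ c ∈ T.clusters with x.1 ∈ c, l.len (lowerCluster a B c) = 1 := by
  rw [← l.sum_eq (Sum.inl x)]
  refine Finset.sum_bij (fun c _ => lowerCluster a B c) ?_ ?_ ?_ ?_
  · intro c hc
    obtain ⟨hc, hx⟩ := Finset.mem_filter.1 hc
    exact Finset.mem_filter.2 ⟨lowerCluster_mem hc, (inl_mem_lowerCluster a c x).2 hx⟩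
  · exact fun c _ d _ h => lowerCluster_injective a h
  · intro c hc
    obtain ⟨hc, hx⟩ := Finset.mem_filter.1 hc
    rcases Finset.mem_union.1 hc with h | h
    · obtain ⟨c, hcT, rfl⟩ := Finset.mem_image.1 h
      exact ⟨c, Finset.mem_filter.2 ⟨hcT, (inl_mem_lowerCluster a c x).1 hx⟩, rfl⟩
    · obtain ⟨d, hd, rfl⟩ := Finset.mem_image.1 h
      exact ((inl_mem_upperCluster a d x).1 hx).elim
  · exact fun _ _ => rfl

/-- The total length of the edges of `T`, other than the leaf edge for `a`, between the root and
the leaf `a`. -/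
def lowerLength : ℝ := ∑ c ∈ T.clusters.erase {a} with a ∈ c, l.len (lowerCluster a B c)

lemma sum_inr (b : B) :
    lowerLength l + ∑ d ∈ U.clusters with b ∈ d, l.len (upperCluster a d) = 1 := by
  have h1 : lowerLength l = ∑ c ∈ ((T.clusters.erase {a}).filter (a ∈ ·)).image
      (lowerCluster a B), l.len c :=
    (Finset.sum_image fun c _ d _ h => lowerCluster_injective a h).symm
  have h2 : ∑ d ∈ U.clusters with b ∈ d, l.len (upperCluster a d) =
      ∑ d ∈ (U.clusters.filter (b ∈ ·)).image (upperCluster a), l.len d :=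
    (Finset.sum_image fun c _ d _ h => upperCluster_injective a h).symm
  rw [h1, h2, ← Finset.sum_union, ← l.sum_eq (Sum.inr b)]
  · congr 1
    ext x
    simp only [Finset.mem_union, Finset.mem_image, Finset.mem_filter, Finset.mem_erase]
    constructor
    · rintro (⟨c, ⟨⟨-, hc⟩, ha⟩, rfl⟩ | ⟨d, ⟨hd, hb⟩, rfl⟩)
      · exact ⟨lowerCluster_mem hc, (inr_mem_lowerCluster a c b).2 ha⟩
      · exact ⟨upperCluster_mem hd, (inr_mem_upperCluster a d b).2 hb⟩
    · rintro ⟨hx, hb⟩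
      rcases Finset.mem_union.1 hx with h | h
      · obtain ⟨c, hc, rfl⟩ := Finset.mem_image.1 h
        by_cases hca : c = {a}
        · subst hca
          rw [lowerCluster_singleton]
          exact Or.inr ⟨_, ⟨U.univ_mem, Finset.mem_univ b⟩, rfl⟩
        · exact Or.inl ⟨c, ⟨⟨hca, hc⟩, (inr_mem_lowerCluster a c b).1 hb⟩, rfl⟩
      · obtain ⟨d, hd, rfl⟩ := Finset.mem_image.1 h
        exact Or.inr ⟨d, ⟨hd, (inr_mem_upperCluster a d b).1 hb⟩, rfl⟩
  · rw [Finset.disjoint_left]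
    rintro x hx hx'
    obtain ⟨c, hc, rfl⟩ := Finset.mem_image.1 hx
    obtain ⟨d, hd, h⟩ := Finset.mem_image.1 hx'
    have hc' := Finset.mem_erase.1 (Finset.mem_filter.1 hc).1
    exact hc'.1 (eq_singleton_of_lowerCluster_eq a (T.nonempty hc'.2) h.symm)

/-- The total length of the `U`-part, from the bottom of its root edge to its leaves. -/
def upperLength : ℝ := 1 - lowerLength l

lemma upperLength_eq (b : B) :
    upperLength l = ∑ d ∈ U.clusters with b ∈ d, l.len (upperCluster a d) := by
  rw [upperLength, ← sum_inr l b]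
  ring

lemma upperLength_nonneg : 0 ≤ upperLength l := by
  obtain ⟨b⟩ := B.nonempty
  rw [upperLength_eq l b]
  exact Finset.sum_nonneg fun _ _ => l.nonneg _

/-- The weighting on `T` in which the leaf edge for `a` gets the total length of the `U`-part, and
the other edges keep their lengths. -/
def lowerWeighting : T.Weighting :=
  ⟨fun c => if c ∈ T.clusters then if c = {a} then upperLength l else l.len (lowerCluster a B c)
      else 0, fun c => by
    dsimp only
    split_ifs
    exacts [upperLength_nonneg l, l.nonneg _, le_rfl], fun c hc => if_neg hc, fun x => by
    by_cases hx : x = a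
    · subst hx
      have h : T.clusters.filter (x ∈ ·) = insert {x} ((T.clusters.erase {x}).filter (x ∈ ·)) := by
        ext c
        by_cases hc : c = {x} <;> simp [hc, T.singleton_mem]
      rw [h, Finset.sum_insert (by simp), if_pos (T.singleton_mem x), if_pos rfl]
      have h' : upperLength l + lowerLength l = 1 := by
        rw [upperLength]
        ring
      rw [← h']
      congr 1
      refine Finset.sum_congr rfl fun c hc => ?_
      have hc' := Finset.mem_erase.1 (Finset.mem_filter.1 hc).1
      rw [if_pos hc'.2, if_neg hc'.1]
    · rw [← sum_inl l ⟨x, hx⟩]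
      refine Finset.sum_congr rfl fun c hc => ?_
      obtain ⟨hc, hxc⟩ := Finset.mem_filter.1 hc
      dsimp only
      rw [if_pos hc, if_neg]
      rintro rfl
      exact hx (Finset.mem_singleton.1 hxc)⟩

lemma lowerWeighting_len {c : Finset A} (hc : c ∈ T.clusters) (hca : c ≠ {a}) :
    (lowerWeighting l).len c = l.len (lowerCluster a B c) :=
  (if_pos hc).trans (if_neg hca)

lemma lowerWeighting_len_self : (lowerWeighting l).len {a} = upperLength l :=
  (if_pos (T.singleton_mem a)).trans (if_pos rfl)

/-- The weighting on `U` obtained by rescaling the lengths of the `U`-part by the inverse of its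
total length. If the total length is zero, this is an arbitrary weighting. -/
noncomputable def upperWeighting : U.Weighting :=
  ⟨fun d => if d ∈ U.clusters then
      if upperLength l = 0 then (if d = Finset.univ then 1 else 0)
      else l.len (upperCluster a d) / upperLength l
    else 0, fun d => by
      dsimp only
      split_ifs
      exacts [zero_le_one, le_rfl, div_nonneg (l.nonneg _) (upperLength_nonneg l), le_rfl],
    fun d hd => if_neg hd, fun b => by
      rw [Finset.sum_congr rfl fun d hd => if_pos (Finset.mem_filter.1 hd).1]
      split_ifs with h
      · rw [Finset.sum_ite_eq', if_pos (Finset.mem_filter.2 ⟨U.univ_mem, Finset.mem_univ b⟩)]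
      · rw [← Finset.sum_div, ← upperLength_eq l b, div_self h]⟩

lemma upperWeighting_len {d : Finset B} (hd : d ∈ U.clusters) (h : upperLength l ≠ 0) :
    (upperWeighting l).len d = l.len (upperCluster a d) / upperLength l :=
  (if_pos hd).trans (if_neg h)

lemma len_upperCluster_le {d : Finset B} (hd : d ∈ U.clusters) :
    l.len (upperCluster a d) ≤ upperLength l := by
  obtain ⟨b, hb⟩ := U.nonempty hd
  rw [upperLength_eq l b]
  exact Finset.single_le_sum (f := fun d => l.len (upperCluster a d)) (fun _ _ => l.nonneg _)
    (Finset.mem_filter.2 ⟨hd, hb⟩)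

/-- The point of `w̄(T) ∧ w̄(U)` determined by a weighting on `T ∪ₐ U`. -/
noncomputable def keyPoint : TopStar.smash T.wbar U.wbar :=
  TopStar.smk (wpt (lowerWeighting l)) (wpt (upperWeighting l))

lemma keyPoint_eq_pt_left (h : (lowerWeighting l).IsDegenerate) :
    keyPoint l = (TopStar.smash T.wbar U.wbar).pt :=
  TopStar.smk_eq_pt (Or.inl (wpt_eq_pt h))

lemma keyPoint_eq_pt_right (h : (upperWeighting l).IsDegenerate) :
    keyPoint l = (TopStar.smash T.wbar U.wbar).pt :=
  TopStar.smk_eq_pt (Or.inr (wpt_eq_pt h))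

lemma keyPoint_eq_pt (h : l.IsDegenerate) : keyPoint l = (TopStar.smash T.wbar U.wbar).pt := by
  by_cases hs : upperLength l = 0
  · exact keyPoint_eq_pt_left l (Or.inr ⟨a, (lowerWeighting_len_self l).trans hs⟩)
  have h_up : ∀ d ∈ U.clusters, l.len (upperCluster a d) = 0 → (upperWeighting l).len d = 0 :=
    fun d hd h => by rw [upperWeighting_len l hd hs, h, zero_div]
  have h_univ : (Finset.univ : Finset (NFin.ins A a B)) = lowerCluster a B Finset.univ := by
    ext (x | x)
    · simpa using (inl_mem_lowerCluster a _ x).2 (Finset.mem_univ _)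
    · simpa using (inr_mem_lowerCluster a _ x).2 (Finset.mem_univ _)
  rcases h with h | ⟨x | b, h⟩
  · rw [h_univ] at h
    by_cases ha : (Finset.univ : Finset A) = {a}
    · rw [ha, lowerCluster_singleton] at h
      exact keyPoint_eq_pt_right l (Or.inl (h_up _ U.univ_mem h))
    · exact keyPoint_eq_pt_left l (Or.inl ((lowerWeighting_len l T.univ_mem ha).trans h))
  · have hx : ({Sum.inl x} : Finset (NFin.ins A a B)) = lowerCluster a B {x.1} := by
      ext (y | y)
      · rw [inl_mem_lowerCluster, Finset.mem_singleton, Finset.mem_singleton, Sum.inl.injEq,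
          Subtype.ext_iff]
      · rw [inr_mem_lowerCluster, Finset.mem_singleton, Finset.mem_singleton]
        simpa using x.2.symm
    rw [hx] at h
    exact keyPoint_eq_pt_left l (Or.inr ⟨x.1, (lowerWeighting_len l (T.singleton_mem _)
      fun h => x.2 (Finset.singleton_injective h)).trans h⟩)
  · have hb : ({Sum.inr b} : Finset (NFin.ins A a B)) = upperCluster a {b} := by
      simp [upperCluster]
    rw [hb] at h
    exact keyPoint_eq_pt_right l (Or.inr ⟨b, h_up _ (U.singleton_mem b) h⟩)

/-- The weightings on `T ∪ₐ U`, `T` and `U` that are compatible up to a rescaling. -/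
def Compatible (p : (T.graft a U).Weighting × T.Weighting × U.Weighting) : Prop :=
  (∀ c ∈ T.clusters, c ≠ {a} → p.2.1.len c = p.1.len (lowerCluster a B c)) ∧
    ∀ d ∈ U.clusters, p.1.len (upperCluster a d) = p.2.1.len {a} * p.2.2.len d

lemma compatible_self : Compatible (l, lowerWeighting l, upperWeighting l) := by
  refine ⟨fun c hc hca => lowerWeighting_len l hc hca, fun d hd => ?_⟩
  rw [lowerWeighting_len_self]
  by_cases hs : upperLength l = 0
  · rw [hs, zero_mul]
    exact le_antisymm (hs ▸ len_upperCluster_le l hd) (l.nonneg _)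
  · rw [upperWeighting_len l hd hs]
    field_simp

lemma keyPoint_of_compatible {p : (T.graft a U).Weighting × T.Weighting × U.Weighting}
    (h : Compatible p) : keyPoint p.1 = TopStar.smk (wpt p.2.1) (wpt p.2.2) := by
  obtain ⟨l, t, m⟩ := p
  have hs : t.len {a} = upperLength l := by
    obtain ⟨b⟩ := B.nonempty
    rw [upperLength_eq l b]
    refine Eq.symm ((Finset.sum_congr rfl fun d hd => h.2 d (Finset.mem_filter.1 hd).1).trans ?_)
    rw [← Finset.mul_sum, m.sum_eq b, mul_one]
  have ht : lowerWeighting l = t := Weighting.ext fun c hc => by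
    by_cases hca : c = {a}
    · subst hca
      rw [lowerWeighting_len_self, hs]
    · exact (lowerWeighting_len l hc hca).trans (h.1 c hc hca).symm
  by_cases h0 : upperLength l = 0
  · have hd : (lowerWeighting l).IsDegenerate := Or.inr ⟨a, (lowerWeighting_len_self l).trans h0⟩
    rw [keyPoint_eq_pt_left l hd]
    exact (TopStar.smk_eq_pt (Or.inl (wpt_eq_pt (ht ▸ hd)))).symm
  · have hm : upperWeighting l = m := Weighting.ext fun d hd => by
      rw [upperWeighting_len l hd h0, div_eq_iff h0]
      exact (h.2 d hd).trans (by rw [hs, mul_comm])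
    rw [keyPoint, ht, hm]

lemma continuous_keyPoint : Continuous (keyPoint (T := T) (a := a) (U := U)) := by
  have hcl : IsClosed {p : (T.graft a U).Weighting × T.Weighting × U.Weighting | Compatible p} := by
    have h1 : ∀ c, Continuous fun p : (T.graft a U).Weighting × T.Weighting × U.Weighting =>
      p.1.len c := fun c => (Weighting.continuous_len c).comp continuous_fst
    have h2 : ∀ c, Continuous fun p : (T.graft a U).Weighting × T.Weighting × U.Weighting =>
      p.2.1.len c := fun c => (Weighting.continuous_len c).comp continuous_snd.fst
    have h3 : ∀ c, Continuous fun p : (T.graft a U).Weighting × T.Weighting × U.Weighting =>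
      p.2.2.len c := fun c => (Weighting.continuous_len c).comp continuous_snd.snd
    refine IsClosed.and ?_ ?_
    · simp only [Set.ofPred_forall]
      exact isClosed_iInter fun c => isClosed_iInter fun _ => isClosed_iInter fun _ =>
        isClosed_eq (h2 c) (h1 _)
    · simp only [Set.ofPred_forall]
      exact isClosed_iInter fun d => isClosed_iInter fun _ =>
        isClosed_eq (h1 _) ((h2 _).mul (h3 d))
  have : CompactSpace {p : (T.graft a U).Weighting × T.Weighting × U.Weighting // Compatible p} :=
    isCompact_iff_compactSpace.1 hcl.isCompact
  have hc : Continuous fun p : {p : (T.graft a U).Weighting × T.Weighting × U.Weighting //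
    Compatible p} => p.1.1 := continuous_subtype_val.fst
  have hq : IsQuotientMap fun p : {p : (T.graft a U).Weighting × T.Weighting × U.Weighting //
      Compatible p} => p.1.1 :=
    hc.isClosedMap.isQuotientMap hc fun l => ⟨⟨_, compatible_self l⟩, rfl⟩
  rw [hq.continuous_iff, ← kCont_iff]
  have h : (keyPoint (T := T) (a := a) (U := U) ∘ fun p : {p : (T.graft a U).Weighting ×
      T.Weighting × U.Weighting // Compatible p} => p.1.1) =
      (fun p : T.wbar × U.wbar => TopStar.smk p.1 p.2) ∘
        fun p => (wpt p.1.2.1, wpt p.1.2.2) := funext fun p => keyPoint_of_compatible p.2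
  rw [h]
  exact (TopStar.smk_kCont _ _).comp (((continuous_wpt.comp continuous_subtype_val.snd.fst).prodMk
    (continuous_wpt.comp continuous_subtype_val.snd.snd)).continuousGeneratedBy)

/-- The ungrafting map `w̄(T ∪ₐ U) ⟶ w̄(T) ∧ w̄(U)`. -/
noncomputable def wbarUngraft (T : LTree A) (a : A) (U : LTree B) :
    (T.graft a U).wbar ⟶ T.wbar ⊗ U.wbar :=
  wbarDesc keyPoint continuous_keyPoint keyPoint_eq_pt

end Key

/-! ### The tree with one leaf and no vertices -/

section One

lemma eq_univ_of_one (T : LTree NFin.one) {c : Finset NFin.one} (hc : c ∈ T.clusters) :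
    c = Finset.univ := by
  obtain ⟨x, hx⟩ := T.nonempty hc
  exact Finset.eq_univ_iff_forall.2 fun _ => hx

instance (T : LTree NFin.one) : IsEmpty T.Vertex :=
  ⟨fun v => by
    have h := v.card
    rw [T.eq_univ_of_one v.mem] at h
    exact absurd h (by simp)⟩

/-- The weighting on a tree with one leaf. -/
def oneWeighting (T : LTree NFin.one) : T.Weighting :=
  ⟨fun c => if c ∈ T.clusters then 1 else 0, fun c => by
    dsimp only
    split_ifs
    exacts [zero_le_one, le_rfl], fun c hc => if_neg hc, fun x => by
    have h : T.clusters.filter (x ∈ ·) = {Finset.univ} := by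
      ext c
      rw [Finset.mem_filter, Finset.mem_singleton]
      refine ⟨fun h => T.eq_univ_of_one h.1, ?_⟩
      rintro rfl
      exact ⟨T.univ_mem, Finset.mem_univ x⟩
    rw [h, Finset.sum_singleton, if_pos T.univ_mem]⟩

/-- The map from the zero-sphere to `w̄(T)`, for a tree `T` with one leaf. -/
def wbarOne (T : LTree NFin.one) : 𝟙_ TopStar ⟶ T.wbar where
  toFun b := if (show Bool from b) then wpt T.oneWeighting else T.wbar.pt
  cont := continuous_of_discreteTopology (α := Bool)
  map_pt := rfl

end One

end LTree

open MonoidalCategory BraidedCategory Limits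

/-! ### The functor `P_A` on trees -/

lemma perm_univ {ι : Type} [Fintype ι] {l : List ι} (h : l.Nodup) (h' : ∀ i, i ∈ l) :
    Finset.univ.toList.Perm l :=
  (List.perm_ext_iff_of_nodup (Finset.nodup_toList _) h).2 fun i => by simp [h' i]

section PA

variable {C : Type u} [Category.{v} C] [MonoidalCategory C] [SymmetricCategory C]
  (P : Operad C) {A B : NFin}

open LTree

/-- `P_A(T) = ⨂ᵥ P(i(v))`. -/
noncomputable def PA (T : LTree A) : C := bigTensor fun v : T.Vertex => P.obj (T.inc v)

/-- The vertices of `T / e` other than the one at which `e` was collapsed. -/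
noncomputable def otherVertices {T : LTree A} (e : T.InternalEdge) :
    List {w : (T.contract e).Vertex // w ≠ merged e} := Finset.univ.toList

lemma perm_contract {T : LTree A} (e : T.InternalEdge) :
    (Finset.univ : Finset T.Vertex).toList.Perm
      (e.lower :: e.upper :: (otherVertices e).map fun w => contractVertex e w.1) := by
  have key : ∀ w : (T.contract e).Vertex, contractVertex e w ≠ e.upper := fun w h =>
    (Finset.mem_erase.1 w.mem).1 (congrArg Subtype.val h)
  refine perm_univ ?_ fun v => ?_
  · rw [List.nodup_cons, List.nodup_cons]
    refine ⟨?_, ?_, (Finset.nodup_toList _).map fun w w' h => ?_⟩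
    · rw [List.mem_cons, List.mem_map]
      rintro (h | ⟨w, -, h⟩)
      · exact e.upper_ssubset.ne' (congrArg Subtype.val h)
      · have h' : w.1.1 = e.lower.1 := Subtype.ext_iff.1 h
        exact w.2 (Subtype.ext h')
    · rw [List.mem_map]
      rintro ⟨w, -, h⟩
      exact key _ h
    · have h' : (contractVertex e w.1).1 = (contractVertex e w'.1).1 := congrArg Subtype.val h
      exact Subtype.ext (Subtype.ext h')
  · rw [List.mem_cons, List.mem_cons, List.mem_map]
    by_cases h : v = e.lower
    · exact Or.inl h
    by_cases h' : v = e.upper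
    · exact Or.inr (Or.inl h')
    refine Or.inr (Or.inr ⟨⟨⟨v.1, Finset.mem_filter.2 ⟨Finset.mem_erase.2 ⟨fun h'' =>
      h' (Subtype.ext h''), v.mem⟩, v.card⟩⟩, fun h'' => h (Subtype.ext ?_)⟩, ?_, rfl⟩)
    · exact congrArg (Subtype.val (p := (· ∈ (T.contract e).vertices))) h''
    · simp [otherVertices]

lemma perm_merged {T : LTree A} (e : T.InternalEdge) :
    (Finset.univ : Finset (T.contract e).Vertex).toList.Perm
      (merged e :: (otherVertices e).map Subtype.val) := by
  refine perm_univ ?_ fun v => ?_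
  · rw [List.nodup_cons]
    refine ⟨?_, (Finset.nodup_toList _).map Subtype.val_injective⟩
    rw [List.mem_map]
    rintro ⟨w, -, h⟩
    exact w.2 h
  · rw [List.mem_cons, List.mem_map]
    by_cases h : v = merged e
    · exact Or.inl h
    · exact Or.inr ⟨⟨v, h⟩, by simp [otherVertices], rfl⟩

/-- The map `P_A(T) ⟶ P_A(T / e)` given by the partial composition at the edge `e`. -/
noncomputable def PAContract {T : LTree A} (e : T.InternalEdge) : PA P T ⟶ PA P (T.contract e) :=
  listTensorReorder _ _ _ (perm_contract e) ≫ (α_ _ _ _).inv ≫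
    ((P.circ (T.inc e.lower) ⟨e.upper.1, e.mem⟩ (T.inc e.upper) ≫ P.map (mergedInc e)) ⊗ₘ
      listTensorMap (Y := fun w => P.obj ((T.contract e).inc w)) (fun w => contractVertex e w.1)
        Subtype.val (fun w => P.map (contractInc e w.1 w.2)) (otherVertices e)) ≫
    listTensorReorder (fun w => P.obj ((T.contract e).inc w)) (merged e :: (otherVertices e).map Subtype.val) _ (perm_merged e).symm

lemma perm_relabel {A' : NFin} (σ : A ≃ A') (T : LTree A) :
    (Finset.univ : Finset (T.relabel σ).Vertex).toList.Perm
      ((Finset.univ : Finset T.Vertex).toList.map (relabelVertex σ)) := by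
  refine perm_univ ((Finset.nodup_toList _).map fun v w h => ?_) fun v => ?_
  · have h' : v.1.map σ.toEmbedding = w.1.map σ.toEmbedding := congrArg Subtype.val h
    exact Subtype.ext (Finset.map_injective _ h')
  · obtain ⟨c, hc, h⟩ := Finset.mem_image.1 v.mem
    refine List.mem_map.2 ⟨⟨c, Finset.mem_filter.2 ⟨hc, ?_⟩⟩, by simp, Subtype.ext h⟩
    rw [← Finset.card_map σ.toEmbedding, h]
    exact v.card

/-- The map `P_A(T) ⟶ P_A'(T')` for `T'` obtained from `T` by relabelling. -/
noncomputable def PARelabel {A' : NFin} (σ : A ≃ A') (T : LTree A) :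
    PA P T ⟶ PA P (T.relabel σ) :=
  eqToHom (by rw [PA, bigTensor, List.map_id]) ≫
    listTensorMap (X := fun v => P.obj (T.inc v)) (Y := fun v => P.obj ((T.relabel σ).inc v)) id
      (relabelVertex σ) (fun v => P.map (relabelInc σ v)) Finset.univ.toList ≫
    listTensorReorder _ _ _ (perm_relabel σ T).symm

lemma perm_graft (T : LTree A) (a : A) (U : LTree B) :
    (Finset.univ : Finset (T.graft a U).Vertex).toList.Perm
      ((Finset.univ : Finset T.Vertex).toList.map (lowerVertex a U) ++
        (Finset.univ : Finset U.Vertex).toList.map (upperVertex a T)) := by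
  refine perm_univ (List.nodup_append.2 ⟨(Finset.nodup_toList _).map fun v w h => ?_,
    (Finset.nodup_toList _).map fun v w h => ?_, ?_⟩) fun v => ?_
  · exact Subtype.ext (lowerCluster_injective a (congrArg Subtype.val h))
  · exact Subtype.ext (upperCluster_injective a (congrArg Subtype.val h))
  · intro x hx y hy h
    obtain ⟨v, -, rfl⟩ := List.mem_map.1 hx
    obtain ⟨w, -, rfl⟩ := List.mem_map.1 hy
    have h1 := eq_singleton_of_lowerCluster_eq a (T.nonempty v.mem) (congrArg Subtype.val h)
    have h2 := v.card
    rw [h1] at h2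
    simp at h2
  · have hv := v.card
    rw [List.mem_append, List.mem_map, List.mem_map]
    by_cases hu : ∃ d ∈ U.clusters, upperCluster a d = v.1
    · obtain ⟨d, hd, h⟩ := hu
      rw [← h, upperCluster, Finset.card_map] at hv
      exact Or.inr ⟨⟨d, Finset.mem_filter.2 ⟨hd, hv⟩⟩, by simp, Subtype.ext h⟩
    · rcases Finset.mem_union.1 v.mem with h | h
      · obtain ⟨c, hc, h⟩ := Finset.mem_image.1 h
        refine Or.inl ⟨⟨c, Finset.mem_filter.2 ⟨hc, ?_⟩⟩, by simp, Subtype.ext h⟩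
        by_contra hcard
        obtain ⟨x, rfl⟩ := Finset.card_eq_one.1 (le_antisymm (not_lt.1 hcard)
          (Finset.card_pos.2 (T.nonempty hc)))
        by_cases hx : x = a
        · subst hx
          exact hu ⟨_, U.univ_mem, (lowerCluster_singleton x).symm.trans h⟩
        · have h1 : lowerCluster a B {x} = {Sum.inl ⟨x, hx⟩} := by
            ext (y | y)
            · rw [inl_mem_lowerCluster, Finset.mem_singleton, Finset.mem_singleton,
                Sum.inl.injEq, Subtype.ext_iff]
            · rw [inr_mem_lowerCluster, Finset.mem_singleton, Finset.mem_singleton]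
              simpa using fun h => hx h.symm
          rw [← h, h1, Finset.card_singleton] at hv
          exact lt_irrefl _ hv
      · obtain ⟨d, hd, h⟩ := Finset.mem_image.1 h
        exact (hu ⟨d, hd, h⟩).elim

/-- The map `P_{A ∪ₐ B}(T ∪ₐ U) ⟶ P_A(T) ⊗ P_B(U)`. -/
noncomputable def PAUngraft (T : LTree A) (a : A) (U : LTree B) :
    PA P (T.graft a U) ⟶ PA P T ⊗ PA P U :=
  listTensorReorder _ _ _ (perm_graft T a U) ≫ listTensorSplit _ _ _ ≫
    ((listTensorMap (Y := fun v => P.obj (T.inc v)) (lowerVertex a U) id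
        (fun v => P.map (lowerInc a U v).symm) Finset.univ.toList ≫
          eqToHom (by rw [PA, bigTensor, List.map_id])) ⊗ₘ
      (listTensorMap (Y := fun v => P.obj (U.inc v)) (upperVertex a T) id
        (fun v => P.map (upperInc a T v).symm) Finset.univ.toList ≫
          eqToHom (by rw [PA, bigTensor, List.map_id])))

/-- The identification of `P(T)` with the unit object for the tree `T` without vertices. -/
noncomputable def PAOne (T : LTree NFin.one) : 𝟙_ C ⟶ PA P T :=
  eqToHom (by rw [PA, bigTensor, Finset.univ_eq_empty, Finset.toList_empty, listTensor])

end PA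

/-! ### The bar construction -/

section Bar

variable {C : Type u} [Category.{v} C] [MonoidalCategory C] [SymmetricCategory C]
  [EnrichedOrdinaryCategory TopStar C] [Tensoring TopStar C] [Cotensoring TopStar C] (P : Operad C)

/-- The diagram whose colimit is the coend of `w̄(-) ⊙ P_A(-)`: for each internal edge `e` of a
tree `T`, the maps from `w̄(T / e) ⊙ P_A(T)` to `w̄(T / e) ⊙ P_A(T / e)` and `w̄(T) ⊙ P_A(T)`. -/
noncomputable def barDiagram (A : NFin) :
    MultispanIndex
      { L := Σ T : LTree A, T.InternalEdge
        R := LTree A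
        fst := fun x => x.1.contract x.2
        snd := fun x => x.1 } C where
  left x := tens (x.1.contract x.2).wbar (PA P x.1)
  right T := tens T.wbar (PA P T)
  fst x := tensMap (𝟙 (x.1.contract x.2).wbar) (PAContract P x.2)
  snd x := tensMap (LTree.wbarContract x.2) (𝟙 (PA P x.1))

variable [HasColimitsOfSize.{0, 0} C]

/-- The bar construction `B(P)(A)`: the coend of `w̄(-) ⊙ P_A(-)` over the `A`-labelled trees. -/
noncomputable def barObj (A : NFin) : C := multicoequalizer (barDiagram P A)

/-- The map `w̄(T) ⊙ P_A(T) ⟶ B(P)(A)`. -/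
noncomputable def barι {A : NFin} (T : LTree A) : tens T.wbar (PA P T) ⟶ barObj P A :=
  Multicoequalizer.π (barDiagram P A) T

/-- The structure maps on `B(P)` are the ones given by relabelling, by ungrafting of trees (and by
the zero map for trees that are not graftings), and by the isomorphism `S ≅ B(P)(1)`. -/
structure IsUngrafting [SymmetricMonoidalVCategory TopStar C]
    (S : CooperadStructure (barObj P)) : Prop where
  map_eq {A A' : NFin} (σ : A ≃ A') (T : LTree A) :
    barι P T ≫ S.map σ = tensMap (T.wbarRelabel σ) (PARelabel P σ T) ≫ barι P (T.relabel σ)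
  cocomp_graft {A : NFin} (T : LTree A) (a : A) {B : NFin} (U : LTree B) :
    barι P (T.graft a U) ≫ S.cocomp A a B =
      tensMap (T.wbarUngraft a U) (PAUngraft P T a U) ≫
        SymmetricMonoidalVCategory.d T.wbar U.wbar (PA P T) (PA P U) ≫ (barι P T ⊗ₘ barι P U)
  cocomp_zero {A : NFin} (a : A) {B : NFin} (V : LTree (NFin.ins A a B))
    (hV : ∀ (T : LTree A) (U : LTree B), V ≠ T.graft a U) :
    ∃ Z : C, IsZero Z ∧ ∃ (f : tens V.wbar (PA P V) ⟶ Z) (g : Z ⟶ barObj P A ⊗ barObj P B),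
      barι P V ≫ S.cocomp A a B = f ≫ g
  counit_eq (T : LTree NFin.one) :
    tensUnit TopStar (𝟙_ C) ≫ tensMap T.wbarOne (PAOne P T) ≫ barι P T ≫ S.counit = 𝟙 (𝟙_ C)

end Bar

end BarCooperad

universe v u

/-!
The bar construction `B(P)(A)` is a quotient of the coproduct of the tensors `w̄(T) ⊙ P(T)` over the
`A`-labelled trees, so a map out of it is a family of maps out of these tensors that is compatible
with edge collapse (`barDesc`), and two such maps agree if they agree on each of them
(`barObj_hom_ext`). This gives uniqueness at once (`IsUngrafting.eq_barCooperad`): a tree determines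
the trees of which it is a grafting, a map through a null object is zero, and the counit is
determined because `S ≅ B(P)(1)`.

For existence, the maps are defined tree by tree. The essential point is that the cocomposition is
compatible with the collapse of an internal edge `e` of `V` (`treeCocomp_contract`). If `V = T ∪ₐ U`,
then `e` is an edge of `T`, an edge of `U`, or the edge of grafting. In the first two cases `V / e` is
the grafting of `T / e` or of `U / e`, and both the ungrafting of weightings and the identification
`P(T) ⊗ P(U) ≅ P(V)` commute with the collapse. In the third case `V / e` is not a grafting, so the
cocomposition is zero on its summand; and a weighting for which `e` has length zero goes to the
basepoint, as then the `U`-part has length zero or its root edge does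
(`wbarContract_ungraftWbar_eq_zero`). If `V` is not a grafting, neither is `V / e`, since `V` is a
grafting exactly if `B` is one of its clusters.

The cooperad axioms are checked on each summand. Where the tree is an iterated grafting they split
into an identity of maps of spaces of weightings, an identity of symmetry isomorphisms between tensor
products over the vertices, and the associativity, unit or symmetry law of `d`. Where it is not, both
sides vanish.

* A weighting of `T ∪ₐ U` restricts to a pair of weightings in the sense of `LTree.Restricts`: all
  lengths on `T` away from the leaf `a` are kept, and those on `U` are multiplied by the length of
  the leaf edge of `a`. The pair represents the image in `w̄(T) ∧ w̄(U)`, so the identities of weightings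
  reduce to identities of clusters, and where the rescaling is undefined everything is at the
  basepoint.
* For the tensor products, `permMap` and `pairMap` are the maps induced by maps of factors along a
  reindexing. They are closed under composition and are determined by what they do to the factors
  and to their indices, so relabelling, grafting and collapse are all treated as maps induced by
  maps of clusters that preserve vertices and incoming edges (`LTree.IsEmb`), and the identities
  between them follow from identities between maps of clusters.
-/

namespace BarCooperad

open MonoidalCategory BraidedCategory Limits

/-! ### Symmetry isomorphisms of tensor products over lists -/

section ListCoherence

variable {C : Type u} [Category.{v} C] [MonoidalCategory C] [SymmetricCategory C]

/-- The symmetry that exchanges the two leading factors of a triple tensor product. -/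
def swapFront (X Y Z : C) : X ⊗ (Y ⊗ Z) ⟶ Y ⊗ (X ⊗ Z) :=
  (α_ _ _ _).inv ≫ (β_ X Y).hom ▷ Z ≫ (α_ _ _ _).hom

lemma swapFront_swapFront (X Y Z : C) : swapFront X Y Z ≫ swapFront Y X Z = 𝟙 _ := by
  simp only [swapFront, Category.assoc, Iso.hom_inv_id_assoc]
  rw [← comp_whiskerRight_assoc, SymmetricCategory.symmetry]
  simp

lemma swapFront_natural {X X' Y Y' Z Z' : C} (f : X ⟶ X') (g : Y ⟶ Y') (h : Z ⟶ Z') :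
    (f ⊗ₘ (g ⊗ₘ h)) ≫ swapFront X' Y' Z' = swapFront X Y Z ≫ (g ⊗ₘ (f ⊗ₘ h)) := by
  simp only [swapFront, associator_inv_naturality_assoc, Category.assoc, ← associator_naturality]
  rw [← tensorHom_id, ← tensorHom_id, tensorHom_comp_tensorHom_assoc,
      tensorHom_comp_tensorHom_assoc,
    braiding_naturality]
  simp

lemma swapFront_whiskerLeft (X Y : C) {Z Z' : C} (h : Z ⟶ Z') :
    X ◁ Y ◁ h ≫ swapFront X Y Z' = swapFront X Y Z ≫ Y ◁ X ◁ h := by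
  simpa using swapFront_natural (𝟙 X) (𝟙 Y) h

lemma swapFront_yangBaxter (X Y Z W : C) :
    X ◁ swapFront Y Z W ≫ swapFront X Z (Y ⊗ W) ≫ Z ◁ swapFront X Y W =
      swapFront X Y (Z ⊗ W) ≫ Y ◁ swapFront X Z W ≫ swapFront Y Z (X ⊗ W) := by
  have h := congrArg (fun f : (X ⊗ Y) ⊗ Z ⟶ (Z ⊗ Y) ⊗ X =>
    (𝟙 (X ⊗ (Y ⊗ (Z ⊗ W))) ⊗≫ f ▷ W ⊗≫ 𝟙 (Z ⊗ (Y ⊗ (X ⊗ W))))) (yang_baxter' X Y Z)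
  refine Eq.trans ?_ (h.symm.trans ?_) <;> simp only [swapFront] <;> monoidal

variable {ι : Type} [DecidableEq ι] (X : ι → C)

/-- The defining decomposition of a tensor product along a nonempty list. -/
def consIso {ι : Type} (X : ι → C) (i : ι) (l : List ι) :
    listTensor X (i :: l) ≅ X i ⊗ listTensor X l := Iso.refl _

/-- The symmetry isomorphism that moves the factor `X i` to the front, with the list of the
remaining factors given up to equality. -/
def moveFront (i : ι) (l m : List ι) (h : i ∈ l) (hm : l.erase i = m) :
    listTensor X l ⟶ X i ⊗ listTensor X m :=
  listTensorFront X i l h ≫ eqToHom (by rw [hm])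

lemma moveFront_head (i : ι) (l : List ι) (h : i ∈ i :: l) (hm : (i :: l).erase i = l) :
    moveFront X i (i :: l) l h hm = (consIso X i l).hom := by
  simp only [moveFront, listTensorFront, ↓reduceDIte, eqToHom_trans]
  rfl

lemma moveFront_tail {i j : ι} (hij : j ≠ i) (l m : List ι) (h : i ∈ l) (hm : l.erase i = m)
    (h' : i ∈ j :: l) (hm' : (j :: l).erase i = j :: m) :
    moveFront X i (j :: l) (j :: m) h' hm' = (consIso X j l).hom ≫ X j ◁ moveFront X i l m h hm ≫
      swapFront _ _ _ ≫ X i ◁ (consIso X j m).inv := by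
  subst hm
  have aux : ∀ {X₁ X₂ X₃ X₄ X₅ X₆ : C} (a a' : X₁ ⟶ X₂) (b : X₂ ⟶ X₃) (c : X₃ ⟶ X₄) (d : X₄ ⟶ X₅)
      (k : X₅ ⟶ X₅) (h : X₅ = X₆) (h' : X₆ = X₅), a' = a → k = 𝟙 _ →
      (a ≫ b ≫ c ≫ d ≫ eqToHom h) ≫ eqToHom h' = 𝟙 _ ≫ a' ≫ (b ≫ c ≫ d) ≫ k := by
    intros
    subst_vars
    simp
  simp only [moveFront, listTensorFront, dif_neg hij]
  exact aux _ _ _ _ _ _ _ _ (congrArg _ (Category.comp_id _)) (whiskerLeft_id ..)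

/-- Moving two factors to the front in either order gives the same map up to their symmetry.
This is the braid relation behind `reorder_trans`. -/
lemma moveFront_comm {i j : ι} (hij : i ≠ j) (l m m' n : List ι) (hi : i ∈ l) (hj : j ∈ l)
    (hm : l.erase i = m) (hm' : l.erase j = m') (hjm : j ∈ m) (him : i ∈ m')
    (hn : m.erase j = n) (hn' : m'.erase i = n) :
    moveFront X i l m hi hm ≫ X i ◁ moveFront X j m n hjm hn =
      moveFront X j l m' hj hm' ≫ X j ◁ moveFront X i m' n him hn' ≫ swapFront _ _ _ := by
  induction l generalizing m m' n with
  | nil => simp at hi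
  | cons k l ih =>
    by_cases hki : k = i
    · subst hki
      rw [List.erase_cons_head] at hm
      subst hm
      rw [List.erase_cons_tail (by simpa using hij)] at hm'
      subst hm'
      rw [List.erase_cons_head] at hn'
      subst hn'
      rw [moveFront_head, moveFront_head, moveFront_tail X hij l _ hjm rfl]
      simp only [Category.assoc]
      rw [← whiskerLeft_comp_assoc, Iso.inv_hom_id, whiskerLeft_id, Category.id_comp,
        swapFront_swapFront, Category.comp_id]
    by_cases hkj : k = j
    · subst hkj
      rw [List.erase_cons_head] at hm'
      subst hm'
      rw [List.erase_cons_tail (by simpa using hij.symm)] at hm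
      subst hm
      rw [List.erase_cons_head] at hn
      subst hn
      rw [moveFront_head, moveFront_head, moveFront_tail X hki l _ him rfl]
      simp only [Category.assoc]
      rw [← whiskerLeft_comp, Iso.inv_hom_id, whiskerLeft_id, Category.comp_id]
    · have hi' : i ∈ l := by simpa [Ne.symm hki] using hi
      have hj' : j ∈ l := by simpa [Ne.symm hkj] using hj
      rw [List.erase_cons_tail (by simpa using hki)] at hm
      subst hm
      rw [List.erase_cons_tail (by simpa using hkj)] at hm'
      subst hm'
      rw [List.erase_cons_tail (by simpa using hkj)] at hn
      subst hn
      have hjm' : j ∈ l.erase i := by simpa [Ne.symm hkj] using hjm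
      have him' : i ∈ l.erase j := by simpa [Ne.symm hki] using him
      have hc : (l.erase j).erase i = (l.erase i).erase j := List.erase_comm j i
      rw [moveFront_tail X hki l _ hi' rfl, moveFront_tail X hkj l _ hj' rfl,
        moveFront_tail X hkj _ _ hjm' rfl, moveFront_tail X hki _ _ him' hc]
      simp only [whiskerLeft_comp, Category.assoc]
      rw [whiskerLeft_inv_hom_assoc, whiskerLeft_inv_hom_assoc]
      rw [swapFront_whiskerLeft, ← reassoc_of% swapFront_whiskerLeft,
        ← reassoc_of% swapFront_whiskerLeft,
        ← reassoc_of% (swapFront_yangBaxter (X k) (X j) (X i)), ← whiskerLeft_comp_assoc,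
        ih _ _ _ hi' hj' rfl rfl hjm' him' rfl hc]
      simp only [whiskerLeft_comp, Category.assoc]

/-- The symmetry isomorphism between the tensor products taken in two different orders, for the
classical choice of decidable equality. -/
noncomputable def reorder {ι : Type} (X : ι → C) (l l' : List ι) (h : l.Perm l') :
    listTensor X l ⟶ listTensor X l' :=
  open Classical in listTensorReorder X l l' h

lemma reorder_eq {ι : Type} [inst : DecidableEq ι] (X : ι → C) (l l' : List ι) (h : l.Perm l') :
    listTensorReorder X l l' h = reorder X l l' h := by
  rw [reorder]
  congr!

open Classical in
lemma reorder_cons {ι : Type} (X : ι → C) (i : ι) (l l' m : List ι) (h : l.Perm (i :: l'))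
    (hm : l.erase i = m) :
    reorder X l (i :: l') h = moveFront X i l m (h.mem_iff.2 List.mem_cons_self) hm ≫
      X i ◁ reorder X m l' (by subst hm; simpa using h.erase i) ≫ (consIso X i l').inv := by
  subst hm
  simp only [reorder, listTensorReorder, moveFront, eqToHom_refl, Category.comp_id]
  exact congrArg _ (Category.comp_id _).symm

open Classical in
lemma reorder_cons_cons {ι : Type} (X : ι → C) (i : ι) (l l' : List ι)
    (h : (i :: l).Perm (i :: l')) :
    reorder X (i :: l) (i :: l') h =
      (consIso X i l).hom ≫ X i ◁ reorder X l l' h.cons_inv ≫ (consIso X i l').inv := by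
  rw [reorder_cons X i (i :: l) l' l h (List.erase_cons_head ..), moveFront_head]

lemma reorder_self {ι : Type} (X : ι → C) (l : List ι) (h : l.Perm l) :
    reorder X l l h = 𝟙 _ := by
  induction l with
  | nil => simp [reorder, listTensorReorder]
  | cons i l ih =>
    rw [reorder_cons_cons, ih]
    simp

open Classical in
lemma reorder_moveFront {ι : Type} (X : ι → C) (i : ι) (l l' m m' : List ι) (h : l.Perm l')
    (hi : i ∈ l) (hi' : i ∈ l') (hm : l.erase i = m) (hm' : l'.erase i = m') :
    reorder X l l' h ≫ moveFront X i l' m' hi' hm' =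
      moveFront X i l m hi hm ≫ X i ◁ reorder X m m' (by subst hm hm'; exact h.erase i) := by
  induction l' generalizing l m m' with
  | nil => simp at hi'
  | cons j l' ih =>
    by_cases hij : j = i
    · subst hij
      rw [List.erase_cons_head] at hm'
      subst hm'
      rw [moveFront_head, reorder_cons X j l l' m h hm]
      simp
    · have hi'' : i ∈ l' := by simpa [Ne.symm hij] using hi'
      rw [List.erase_cons_tail (by simpa using hij)] at hm'
      subst hm hm'
      have hjl : j ∈ l := h.mem_iff.2 List.mem_cons_self
      have hp : (l.erase j).Perm l' := by simpa using h.erase j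
      have hp' : (l.erase i).Perm (j :: l'.erase i) := by
        have := h.erase i
        rwa [List.erase_cons_tail (by simpa using hij)] at this
      have hil : i ∈ l.erase j := hp.mem_iff.2 hi''
      have he : (l.erase j).erase i = (l.erase i).erase j := List.erase_comm j i
      rw [moveFront_tail X hij l' _ hi'' rfl, reorder_cons X j l l' _ h rfl,
        reorder_cons X j (l.erase i) (l'.erase i) _ hp' rfl]
      simp only [Category.assoc, Iso.inv_hom_id_assoc]
      rw [← whiskerLeft_comp_assoc, ih (l.erase j) ((l.erase i).erase j) _ hp hil hi'' he rfl]
      simp only [whiskerLeft_comp, Category.assoc]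
      have hc := moveFront_comm X (Ne.symm hij) l _ _ ((l.erase i).erase j) hi hjl rfl rfl
        (hp'.mem_iff.2 List.mem_cons_self) hil rfl he
      rw [reassoc_of% swapFront_whiskerLeft, ← reassoc_of% hc]

open Classical in
/-- Coherence: reordering depends only on the two orders, not on the steps in between. -/
lemma reorder_trans {ι : Type} (X : ι → C) (l l' l'' : List ι) (h : l.Perm l')
    (h' : l'.Perm l'') :
    reorder X l l' h ≫ reorder X l' l'' h' = reorder X l l'' (h.trans h') := by
  induction l'' generalizing l l' with
  | nil =>
    obtain rfl := h'.eq_nil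
    rw [reorder_self, Category.comp_id]
  | cons i l'' ih =>
    have hi := h'.mem_iff.2 (List.mem_cons_self (a := i) (l := l''))
    rw [reorder_cons X i l' l'' _ h' rfl, reorder_cons X i l l'' _ (h.trans h') rfl,
      reassoc_of% (reorder_moveFront X i l l' _ _ h (h.mem_iff.2 hi) hi rfl rfl),
      ← whiskerLeft_comp_assoc, ih]

lemma eqToHom_eq_reorder {ι : Type} (X : ι → C) {l l' : List ι} (h : l = l') :
    eqToHom (congrArg (listTensor X) h) = reorder X l l' (h ▸ List.Perm.refl _) := by
  subst h
  rw [reorder_self, eqToHom_refl]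

end ListCoherence

/-! ### Maps of tensor products over lists -/

section ListMaps

set_option linter.unusedSectionVars false

variable {C : Type u} [Category.{v} C] [MonoidalCategory C] [SymmetricCategory C]
variable {ι κ μ ν : Type} {X : ι → C} {Y : κ → C} {W : ν → C} {Z : μ → C}

/-- The tensor product of the morphisms `f i`, over the entries of a list. -/
def listMap (φ : ι → κ) (f : ∀ i, X i ⟶ Y (φ i)) :
    (l : List ι) → (listTensor X l ⟶ listTensor Y (l.map φ))
  | [] => 𝟙 (𝟙_ C)
  | i :: l => (consIso X i l).hom ≫ (f i ⊗ₘ listMap φ f l) ≫ (consIso Y (φ i) (l.map φ)).inv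

lemma listMap_nil (φ : ι → κ) (f : ∀ i, X i ⟶ Y (φ i)) :
    listMap φ f [] = 𝟙 (𝟙_ C) := rfl

lemma listMap_cons (φ : ι → κ) (f : ∀ i, X i ⟶ Y (φ i)) (i : ι) (l : List ι) :
    listMap φ f (i :: l) =
      (consIso X i l).hom ≫ (f i ⊗ₘ listMap φ f l) ≫ (consIso Y (φ i) (l.map φ)).inv := rfl

/-- The map of tensor products induced by morphisms `X i ⟶ Y (φ i)`, where the target is taken in
any order. -/
noncomputable def permMap (φ : ι → κ) (f : ∀ i, X i ⟶ Y (φ i)) (l : List ι) (m : List κ)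
    (h : (l.map φ).Perm m) : listTensor X l ⟶ listTensor Y m :=
  listMap φ f l ≫ reorder Y (l.map φ) m h

open Classical in
lemma listMap_moveFront (φ : ι → κ) (hφ : Function.Injective φ) (f : ∀ i, X i ⟶ Y (φ i)) (i : ι)
    (l m : List ι) (hi : i ∈ l) (hm : l.erase i = m) :
    listMap φ f l ≫ moveFront Y (φ i) (l.map φ) (m.map φ) (List.mem_map_of_mem hi)
        (by rw [← hm, List.map_erase hφ]) =
      moveFront X i l m hi hm ≫ (f i ⊗ₘ listMap φ f m) := by
  induction l generalizing m with
  | nil => simp at hi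
  | cons j l ih =>
    by_cases hij : j = i
    · subst hij
      rw [List.erase_cons_head] at hm
      subst hm
      rw [moveFront_head, listMap_cons]
      have h := moveFront_head Y (φ j) (l.map φ) List.mem_cons_self (List.erase_cons_head ..)
      refine (congrArg (fun g => _ ≫ g) h).trans ?_
      simp
    · have hi' : i ∈ l := by simpa [Ne.symm hij] using hi
      rw [List.erase_cons_tail (by simpa using hij)] at hm
      subst hm
      have hij' : φ j ≠ φ i := fun h => hij (hφ h)
      have hm' : (l.map φ).erase (φ i) = (l.erase i).map φ := by rw [List.map_erase hφ]
      have h := moveFront_tail Y hij' (l.map φ) ((l.erase i).map φ) (List.mem_map_of_mem hi') hm'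
        (List.mem_map_of_mem hi) (by rw [List.erase_cons_tail (by simpa using hij'), hm'])
      refine (congrArg (fun g => _ ≫ g) h).trans ?_
      rw [moveFront_tail X hij l _ hi' rfl, listMap_cons, listMap_cons]
      simp only [Category.assoc, Iso.inv_hom_id_assoc]
      rw [← id_tensorHom, tensorHom_comp_tensorHom_assoc, ih _ hi' rfl, Category.comp_id]
      have h1 : f j ⊗ₘ (moveFront X i l (l.erase i) hi' rfl ≫ (f i ⊗ₘ listMap φ f (l.erase i))) =
          X j ◁ moveFront X i l (l.erase i) hi' rfl ≫
            (f j ⊗ₘ (f i ⊗ₘ listMap φ f (l.erase i))) := by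
        rw [← id_tensorHom, tensorHom_comp_tensorHom, Category.id_comp]
      rw [h1, Category.assoc, reassoc_of% swapFront_natural]
      simp only [← id_tensorHom, tensorHom_comp_tensorHom, Category.comp_id, Category.id_comp,
        Iso.inv_hom_id_assoc]

open Classical in
lemma reorder_listMap (φ : ι → κ) (hφ : Function.Injective φ) (f : ∀ i, X i ⟶ Y (φ i))
    (l l' : List ι) (h : l.Perm l') :
    reorder X l l' h ≫ listMap φ f l' = listMap φ f l ≫ reorder Y _ _ (h.map φ) := by
  induction l' generalizing l with
  | nil =>
    obtain rfl := h.eq_nil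
    rw [reorder_self, reorder_self, Category.id_comp, Category.comp_id]
  | cons i l' ih =>
    have hp : (l.erase i).Perm l' := by simpa using h.erase i
    have hi : i ∈ l := h.mem_iff.2 List.mem_cons_self
    have hr := reorder_cons Y (φ i) (l.map φ) (l'.map φ) ((l.erase i).map φ) (h.map φ)
      (by rw [List.map_erase hφ])
    refine Eq.trans ?_ (congrArg (fun g => listMap φ f l ≫ g) hr.symm)
    rw [reassoc_of% (listMap_moveFront φ hφ f i l _ hi rfl), reorder_cons X i l l' _ h rfl,
      listMap_cons]
    simp only [Category.assoc, Iso.inv_hom_id_assoc]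
    rw [← id_tensorHom, ← id_tensorHom, tensorHom_comp_tensorHom_assoc,
      tensorHom_comp_tensorHom_assoc, ih _ hp]
    simp

lemma listMap_comp (φ : ι → κ) (f : ∀ i, X i ⟶ Y (φ i)) (ψ : κ → μ) (g : ∀ k, Y k ⟶ Z (ψ k))
    (l : List ι) (h : (l.map (ψ ∘ φ)).Perm ((l.map φ).map ψ)) :
    listMap φ f l ≫ listMap ψ g (l.map φ) =
      listMap (ψ ∘ φ) (fun i => f i ≫ g (φ i)) l ≫ reorder Z _ _ h := by
  induction l with
  | nil => exact ((reorder_self Z [] h).symm ▸ rfl)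
  | cons i l ih =>
    have h1 := reorder_cons_cons Z (ψ (φ i)) _ _ h
    refine Eq.trans ?_ (congrArg (fun g => listMap (ψ ∘ φ) _ (i :: l) ≫ g) h1.symm)
    have h2 := listMap_cons ψ g (φ i) (l.map φ)
    refine (congrArg (fun g => listMap φ f (i :: l) ≫ g) h2).trans ?_
    rw [listMap_cons, listMap_cons]
    have h3 := ih (by rw [List.map_map])
    simp only [Category.assoc, Iso.inv_hom_id_assoc, tensorHom_comp_tensorHom_assoc]
    rw [h3, ← id_tensorHom]
    refine congrArg _ ?_
    refine Eq.trans ?_ (congrArg (fun g => _ ≫ g)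
      (Iso.inv_hom_id_assoc (consIso Z (ψ (φ i)) _) _).symm)
    rw [tensorHom_comp_tensorHom_assoc]
    exact congrArg (fun g => (g ⊗ₘ _) ≫ _) (Category.comp_id _).symm

lemma permMap_comp (φ : ι → κ) (f : ∀ i, X i ⟶ Y (φ i)) (ψ : κ → μ) (hψ : Function.Injective ψ)
    (g : ∀ k, Y k ⟶ Z (ψ k)) (l : List ι) (m : List κ) (n : List μ)
    (h : (l.map φ).Perm m) (h' : (m.map ψ).Perm n) :
    permMap φ f l m h ≫ permMap ψ g m n h' =
      permMap (ψ ∘ φ) (fun i => f i ≫ g (φ i)) l n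
        (by rw [← List.map_map]; exact (h.map ψ).trans h') := by
  rw [permMap, permMap, Category.assoc, reassoc_of% (reorder_listMap ψ hψ g _ _ h), reorder_trans,
    reassoc_of% (listMap_comp φ f ψ g l (by rw [List.map_map])), reorder_trans, permMap]

lemma reorder_permMap (φ : ι → κ) (hφ : Function.Injective φ) (f : ∀ i, X i ⟶ Y (φ i))
    (l l' : List ι) (m : List κ) (h : l.Perm l') (h' : (l'.map φ).Perm m) :
    reorder X l l' h ≫ permMap φ f l' m h' = permMap φ f l m ((h.map φ).trans h') := by
  rw [permMap, reassoc_of% (reorder_listMap φ hφ f _ _ h), reorder_trans, permMap]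

lemma permMap_id (l m : List ι) (h : (l.map id).Perm m) :
    permMap (X := X) id (fun i => 𝟙 (X i)) l m h = reorder X l m (by simpa using h) := by
  have h1 : ∀ h', listMap (X := X) (Y := X) id (fun i => 𝟙 (X i)) l =
      reorder X l (l.map id) h' := fun h' => by
    induction l generalizing m with
    | nil => exact (reorder_self X [] h').symm
    | cons i l ih =>
      have := reorder_cons_cons X i _ _ h'
      rw [listMap_cons]
      refine Eq.trans ?_ this.symm
      rw [ih _ (List.Perm.refl _) (by simp), ← id_tensorHom]
      rfl
  rw [permMap, h1 (by simp), reorder_trans]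

/-- The associativity isomorphism that joins two tensor products. -/
def joinList (X : ι → C) (l' : List ι) :
    (l : List ι) → (listTensor X l ⊗ listTensor X l' ⟶ listTensor X (l ++ l'))
  | [] => (λ_ _).hom
  | i :: l => (consIso X i l).hom ▷ _ ≫ (α_ _ _ _).hom ≫ X i ◁ joinList X l' l ≫
      (consIso X i (l ++ l')).inv

lemma joinList_nil (l' : List ι) : joinList X l' [] = (λ_ _).hom := rfl

lemma joinList_cons (i : ι) (l l' : List ι) :
    joinList X l' (i :: l) = (consIso X i l).hom ▷ _ ≫ (α_ _ _ _).hom ≫ X i ◁ joinList X l' l ≫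
      (consIso X i (l ++ l')).inv := rfl

lemma listTensorSplit_joinList (l l' : List ι) :
    listTensorSplit X l' l ≫ joinList X l' l = 𝟙 _ := by
  induction l with
  | nil => exact Iso.inv_hom_id _
  | cons i l ih =>
    have h : listTensorSplit X l' (i :: l) = (consIso X i (l ++ l')).hom ≫
        X i ◁ listTensorSplit X l' l ≫ (α_ _ _ _).inv ≫ (consIso X i l).inv ▷ _ := by
      refine (Category.id_comp _).symm.trans (congrArg _ (congrArg _ ?_))
      refine (Category.comp_id _).symm.trans (congrArg _ ?_)
      exact (id_whiskerRight _ _).symm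
    rw [h, joinList_cons]
    simp only [Category.assoc, inv_hom_whiskerRight_assoc, Iso.inv_hom_id_assoc]
    rw [← whiskerLeft_comp_assoc, ih]
    simp

lemma joinList_listTensorSplit (l l' : List ι) :
    joinList X l' l ≫ listTensorSplit X l' l = 𝟙 _ := by
  induction l with
  | nil => exact Iso.hom_inv_id _
  | cons i l ih =>
    have h : listTensorSplit X l' (i :: l) = (consIso X i (l ++ l')).hom ≫
        X i ◁ listTensorSplit X l' l ≫ (α_ _ _ _).inv ≫ (consIso X i l).inv ▷ _ := by
      refine (Category.id_comp _).symm.trans (congrArg _ (congrArg _ ?_))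
      refine (Category.comp_id _).symm.trans (congrArg _ ?_)
      exact (id_whiskerRight _ _).symm
    rw [h, joinList_cons]
    simp only [Category.assoc, Iso.inv_hom_id_assoc]
    rw [← whiskerLeft_comp_assoc, ih]
    simp

instance (l l' : List ι) : IsIso (joinList X l' l) :=
  ⟨listTensorSplit X l' l, joinList_listTensorSplit l l', listTensorSplit_joinList l l'⟩

instance (l l' : List ι) (h : l.Perm l') : IsIso (reorder X l l' h) :=
  ⟨reorder X l' l h.symm, by rw [reorder_trans, reorder_self],
    by rw [reorder_trans, reorder_self]⟩

lemma isIso_listMap (φ : ι → κ) (f : ∀ i, X i ⟶ Y (φ i)) [∀ i, IsIso (f i)] (l : List ι) :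
    IsIso (listMap φ f l) := by
  induction l with
  | nil => exact inferInstanceAs (IsIso (𝟙 _))
  | cons i l ih =>
    rw [listMap_cons]
    exact inferInstanceAs (IsIso (_ ≫ (f i ⊗ₘ listMap φ f l) ≫ _))

lemma joinList_listMap (φ : ι → κ) (f : ∀ i, X i ⟶ Y (φ i)) (l l' : List ι)
    (h : (l.map φ ++ l'.map φ).Perm ((l ++ l').map φ)) :
    joinList X l' l ≫ listMap φ f (l ++ l') =
      (listMap φ f l ⊗ₘ listMap φ f l') ≫ joinList Y _ _ ≫ reorder Y _ _ h := by
  induction l with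
  | nil =>
    have h1 : reorder Y ([].map φ ++ l'.map φ) (([] ++ l').map φ) h = 𝟙 _ := reorder_self Y _ _
    rw [h1, Category.comp_id, listMap_nil]
    refine (leftUnitor_naturality (listMap φ f l')).symm.trans ?_
    rw [← id_tensorHom]
    rfl
  | cons i l ih =>
    have h1 := reorder_cons_cons Y (φ i) (l.map φ ++ l'.map φ) ((l ++ l').map φ) h
    have h2 := listMap_cons φ f i (l ++ l')
    refine (congrArg (fun g => joinList X l' (i :: l) ≫ g) h2).trans ?_
    refine Eq.trans ?_ (congrArg (fun g => (listMap φ f (i :: l) ⊗ₘ listMap φ f l') ≫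
      joinList Y (l'.map φ) ((i :: l).map φ) ≫ g) h1.symm)
    refine Eq.trans ?_ (congrArg (fun g => (listMap φ f (i :: l) ⊗ₘ listMap φ f l') ≫ g ≫ _)
      (joinList_cons (φ i) (l.map φ) (l'.map φ)).symm)
    rw [joinList_cons, listMap_cons]
    simp only [Category.assoc, Iso.inv_hom_id_assoc]
    have h3 := ih (by rw [List.map_append])
    rw [← tensorHom_id, ← tensorHom_id, ← id_tensorHom, ← id_tensorHom, ← id_tensorHom,
      tensorHom_comp_tensorHom_assoc, h3, tensorHom_comp_tensorHom_assoc]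
    simp only [Category.assoc, Iso.inv_hom_id, Category.comp_id, Category.id_comp]
    have h4 : (consIso X i l).hom ≫ (f i ⊗ₘ listMap φ f l) ⊗ₘ listMap φ f l' =
      ((consIso X i l).hom ⊗ₘ 𝟙 _) ≫ ((f i ⊗ₘ listMap φ f l) ⊗ₘ listMap φ f l') := by
        rw [tensorHom_comp_tensorHom, Category.id_comp]
    rw [h4, Category.assoc, associator_naturality_assoc, tensorHom_comp_tensorHom_assoc,
      tensorHom_comp_tensorHom_assoc]
    simp

end ListMaps

/-! ### Concatenation of tensor products over lists -/

section ListJoin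

variable {C : Type u} [Category.{v} C] [MonoidalCategory C] [SymmetricCategory C]
variable {ι κ μ ν : Type} {X : ι → C} {Y : κ → C} {W : ν → C} {Z : μ → C}

lemma joinList_reorder_right (l m m' : List ι) (h : m.Perm m') :
    listTensor X l ◁ reorder X m m' h ≫ joinList X m' l =
      joinList X m l ≫ reorder X _ _ (h.append_left l) := by
  induction l with
  | nil => exact leftUnitor_naturality _
  | cons i l ih =>
    have h1 := reorder_cons_cons X i (l ++ m) (l ++ m') (h.append_left (i :: l))
    refine Eq.trans ?_ (congrArg (fun g => joinList X m (i :: l) ≫ g) h1.symm)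
    rw [joinList_cons, joinList_cons]
    simp only [Category.assoc, Iso.inv_hom_id_assoc]
    rw [whisker_exchange_assoc, tensor_whiskerLeft_assoc, Iso.inv_hom_id_assoc,
      ← whiskerLeft_comp_assoc, ih, whiskerLeft_comp_assoc]

open Classical in
lemma joinList_moveFront (i : ι) (l l' m : List ι) (hi : i ∈ l) (hm : l.erase i = m) :
    joinList X l' l ≫ moveFront X i (l ++ l') (m ++ l') (List.mem_append_left _ hi)
        (by rw [List.erase_append_left _ hi, hm]) =
      moveFront X i l m hi hm ▷ _ ≫ (α_ _ _ _).hom ≫ X i ◁ joinList X l' m := by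
  induction l generalizing m with
  | nil => simp at hi
  | cons j l ih =>
    by_cases hij : j = i
    · subst hij
      rw [List.erase_cons_head] at hm
      subst hm
      have h := moveFront_head X j (l ++ l') List.mem_cons_self (List.erase_cons_head ..)
      refine (congrArg (fun g => _ ≫ g) h).trans ?_
      rw [moveFront_head, joinList_cons]
      simp
    · have hi' : i ∈ l := by simpa [Ne.symm hij] using hi
      rw [List.erase_cons_tail (by simpa using hij)] at hm
      subst hm
      have hm' : (l ++ l').erase i = l.erase i ++ l' := List.erase_append_left _ hi'
      have h := moveFront_tail X hij (l ++ l') (l.erase i ++ l') (List.mem_append_left _ hi') hm'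
        (List.mem_append_left (as := j :: l) _ hi)
        (by rw [List.erase_cons_tail (by simpa using hij), hm'])
      refine (congrArg (fun g => _ ≫ g) h).trans ?_
      rw [moveFront_tail X hij l _ hi' rfl, joinList_cons, joinList_cons]
      simp only [Category.assoc, Iso.inv_hom_id_assoc]
      rw [← whiskerLeft_comp_assoc, ih _ hi' rfl]
      simp only [comp_whiskerRight, Category.assoc, whiskerLeft_comp]
      congr 1
      have e : (X i ◁ (consIso X j (l.erase i)).inv) ▷ listTensor X l' ≫ (α_ _ _ _).hom ≫
          X i ◁ (consIso X j (l.erase i)).hom ▷ listTensor X l' = (α_ _ _ _).hom := by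
        rw [associator_naturality_middle_assoc, ← whiskerLeft_comp, inv_hom_whiskerRight,
          whiskerLeft_id, Category.comp_id]
      rw [reassoc_of% e, reassoc_of% swapFront_whiskerLeft, ← associator_naturality_middle_assoc]
      congr 1
      have e2 : (α_ (X j) (X i ⊗ listTensor X (l.erase i)) (listTensor X l')).hom ≫
          X j ◁ (α_ (X i) (listTensor X (l.erase i)) (listTensor X l')).hom ≫
          swapFront (X j) (X i) (listTensor X (l.erase i) ⊗ listTensor X l') =
        swapFront _ _ _ ▷ _ ≫ (α_ _ _ _).hom ≫ X i ◁ (α_ _ _ _).hom := by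
        simp only [swapFront]
        monoidal
      rw [reassoc_of% e2]

lemma joinList_reorder_left (l l' m : List ι) (h : l.Perm l') :
    reorder X l l' h ▷ listTensor X m ≫ joinList X m l' =
      joinList X m l ≫ reorder X _ _ (h.append_right m) := by
  classical
  induction l' generalizing l with
  | nil =>
    obtain rfl := h.eq_nil
    rw [reorder_self, reorder_self, id_whiskerRight, Category.id_comp, Category.comp_id]
  | cons i l' ih =>
    have hi := h.mem_iff.2 (List.mem_cons_self (a := i) (l := l'))
    have h1 := reorder_cons X i (l ++ m) (l' ++ m) (l.erase i ++ m) (h.append_right m)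
      (List.erase_append_left _ hi)
    refine Eq.trans ?_ (congrArg (fun g => joinList X m l ≫ g) h1.symm)
    rw [reassoc_of% (joinList_moveFront (X := X) i l m _ hi rfl), reorder_cons X i l l' _ h rfl,
      joinList_cons, ← whiskerLeft_comp_assoc, ← ih (l.erase i) (by simpa using h.erase i)]
    simp

lemma joinList_reorder (l l' m m' : List ι) (h : l.Perm l') (h' : m.Perm m') :
    (reorder X l l' h ⊗ₘ reorder X m m' h') ≫ joinList X m' l' =
      joinList X m l ≫ reorder X _ _ (h.append h') := by
  rw [MonoidalCategory.tensorHom_def, Category.assoc, joinList_reorder_right,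
    reassoc_of% (joinList_reorder_left (X := X)), reorder_trans]

lemma joinList_assoc (l l' l'' : List ι) (h : (l ++ l' ++ l'').Perm (l ++ (l' ++ l''))) :
    joinList X l' l ▷ listTensor X l'' ≫ joinList X l'' (l ++ l') ≫ reorder X _ _ h =
      (α_ _ _ _).hom ≫ listTensor X l ◁ joinList X l'' l' ≫ joinList X (l' ++ l'') l := by
  induction l with
  | nil =>
    have h1 : reorder X ([] ++ l' ++ l'') ([] ++ (l' ++ l'')) h = 𝟙 _ := reorder_self X _ _
    rw [h1, Category.comp_id, joinList_nil, joinList_nil]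
    have h2 : listTensor X [] ◁ joinList X l'' l' ≫ (λ_ _).hom = (λ_ _).hom ≫ joinList X l'' l' :=
      leftUnitor_naturality _
    rw [h2]
    have h3 : (α_ (𝟙_ C) (listTensor X l') (listTensor X l'')).hom ≫ (λ_ _).hom =
        (λ_ _).hom ▷ _ := by simp
    exact (congrArg (fun g => g ≫ joinList X l'' l') h3.symm).trans (Category.assoc ..)
  | cons i l ih =>
    have h1 := reorder_cons_cons X i (l ++ l' ++ l'') (l ++ (l' ++ l'')) h
    have h2 := joinList_cons (X := X) i (l ++ l') l''
    refine (congrArg (fun g => joinList X l' (i :: l) ▷ listTensor X l'' ≫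
      joinList X l'' (i :: l ++ l') ≫ g) h1).trans ?_
    refine (congrArg (fun g => joinList X l' (i :: l) ▷ listTensor X l'' ≫ g ≫ _) h2).trans ?_
    rw [joinList_cons, joinList_cons]
    have h3 := ih (by rw [List.append_assoc])
    simp only [Category.assoc, Iso.inv_hom_id_assoc, comp_whiskerRight]
    rw [inv_hom_whiskerRight_assoc, associator_naturality_middle_assoc, ← whiskerLeft_comp_assoc,
      ← whiskerLeft_comp_assoc, Category.assoc, h3]
    rw [whisker_exchange_assoc]
    simp

lemma joinList_nil_right (l : List ι) (h : (l ++ []).Perm l) :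
    joinList X [] l ≫ reorder X _ _ h = (ρ_ (listTensor X l)).hom := by
  induction l with
  | nil =>
    have h1 : reorder X ([] ++ []) [] h = 𝟙 _ := reorder_self X _ _
    rw [h1, joinList_nil]
    exact (Category.comp_id _).trans unitors_equal
  | cons i l ih =>
    have h' : (i :: (l ++ [])).Perm (i :: l) := h
    have h1 := reorder_cons_cons X i (l ++ []) l h'
    refine (congrArg (fun g => joinList X [] (i :: l) ≫ g) h1).trans ?_
    rw [joinList_cons]
    simp only [Category.assoc, Iso.inv_hom_id_assoc]
    rw [← whiskerLeft_comp_assoc, ih (by simp)]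
    have h2 : (ρ_ (listTensor X (i :: l))).hom =
      (consIso X i l).hom ▷ 𝟙_ C ≫ (ρ_ _).hom ≫ (consIso X i l).inv := by simp
    rw [h2]
    refine congrArg _ ?_
    rw [← Category.assoc]
    exact congrArg (· ≫ (consIso X i l).inv) (rightUnitor_tensor_hom ..).symm

open Classical in
lemma joinList_moveFront_right (i : ι) (l l' : List ι) (hi : i ∉ l) :
    joinList X (i :: l') l ≫ moveFront X i (l ++ i :: l') (l ++ l') (by simp)
        (by rw [List.erase_append_right _ hi, List.erase_cons_head]) =
      _ ◁ (consIso X i l').hom ≫ swapFront _ _ _ ≫ X i ◁ joinList X l' l := by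
  induction l with
  | nil =>
    have h := moveFront_head X i l' List.mem_cons_self (List.erase_cons_head ..)
    refine (congrArg (fun g => joinList X (i :: l') [] ≫ g) h).trans ?_
    rw [joinList_nil, joinList_nil]
    have h1 : swapFront (𝟙_ C) (X i) (listTensor X l') ≫ X i ◁ (λ_ _).hom = (λ_ _).hom := by
      simp [swapFront]
    refine Eq.trans ?_ (congrArg (fun g => (𝟙_ C) ◁ (consIso X i l').hom ≫ g) h1.symm)
    exact (leftUnitor_naturality _).symm
  | cons j l ih =>
    have hij : j ≠ i := fun h => hi (h ▸ List.mem_cons_self)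
    have hi' : i ∉ l := fun h => hi (List.mem_cons_of_mem _ h)
    have hm' : (l ++ i :: l').erase i = l ++ l' := by
      rw [List.erase_append_right _ hi', List.erase_cons_head]
    have h := moveFront_tail X hij (l ++ i :: l') (l ++ l') (by simp) hm'
        (by simp) (by rw [List.erase_cons_tail (by simpa using hij), hm'])
    refine (congrArg (fun g => joinList X (i :: l') (j :: l) ≫ g) h).trans ?_
    rw [joinList_cons, joinList_cons]
    simp only [Category.assoc, Iso.inv_hom_id_assoc]
    rw [← whiskerLeft_comp_assoc, ih hi']
    simp only [whiskerLeft_comp, Category.assoc]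
    rw [reassoc_of% swapFront_whiskerLeft]
    have h2 : swapFront (listTensor X (j :: l)) (X i) (listTensor X l') ≫
        X i ◁ (consIso X j l).hom ▷ listTensor X l' =
        (consIso X j l).hom ▷ _ ≫ swapFront _ _ _ := by
      have := swapFront_natural (consIso X j l).hom (𝟙 (X i)) (𝟙 (listTensor X l'))
      simpa using this.symm
    rw [reassoc_of% h2, whisker_exchange_assoc]
    have h3 : ∀ A B D E : C, (α_ A B (D ⊗ E)).hom ≫ A ◁ swapFront B D E ≫ swapFront A D (B ⊗ E) =
        swapFront (A ⊗ B) D E ≫ D ◁ (α_ A B E).hom := by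
      intro A B D E
      simp only [swapFront, braiding_tensor_left_hom]
      monoidal
    rw [← reassoc_of% h3]
    simp

/-- Disjointness is needed because `reorder` matches first occurrences: on a common entry it
does not exchange the two copies, while the symmetry does. -/
lemma joinList_comm (l l' : List ι) (hd : l.Disjoint l') :
    joinList X l l' ≫ reorder X _ _ List.perm_append_comm =
      (β_ _ _).hom ≫ joinList X l' l := by
  classical
  induction l with
  | nil =>
    have h1 : reorder X (l' ++ []) ([] ++ l') List.perm_append_comm = reorder X (l' ++ []) l' _ :=
      rfl
    rw [h1, joinList_nil_right, joinList_nil]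
    exact (braiding_leftUnitor ..).symm
  | cons i l ih =>
    have hi : i ∉ l' := fun h => hd List.mem_cons_self h
    have h1 := reorder_cons X i (l' ++ i :: l) (l ++ l') (l' ++ l) List.perm_append_comm
      (by rw [List.erase_append_right _ hi, List.erase_cons_head])
    refine (congrArg (fun g => joinList X (i :: l) l' ≫ g) h1).trans ?_
    rw [reassoc_of% (joinList_moveFront_right (X := X) i l' l hi), joinList_cons,
      ← whiskerLeft_comp_assoc,
      ih (fun a h h' => hd (List.mem_cons_of_mem _ h) h')]
    have h2 := BraidedCategory.braiding_naturality_right (listTensor X l') (consIso X i l).hom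
    rw [← reassoc_of% h2]
    simp [swapFront]

end ListJoin

/-! ### Maps out of products of tensor products over lists -/

section PairMaps

set_option linter.unusedSectionVars false

variable {C : Type u} [Category.{v} C] [MonoidalCategory C] [SymmetricCategory C]
variable {ι κ μ ν ξ : Type} {X : ι → C} {Y : κ → C} {W : ν → C} {Z : μ → C} {V : ξ → C}

lemma permMap_self (φ : ι → κ) (f : ∀ i, X i ⟶ Y (φ i)) (l : List ι) :
    permMap φ f l (l.map φ) (List.Perm.refl _) = listMap φ f l := by
  rw [permMap, reorder_self, Category.comp_id]

/-- The map from a product of two tensor products to a single one, induced by morphisms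
`X i ⟶ Z (φ i)` and `Y k ⟶ Z (ψ k)`. -/
noncomputable def pairMap (φ : ι → μ) (f : ∀ i, X i ⟶ Z (φ i)) (l : List ι) (ψ : κ → μ)
    (g : ∀ k, Y k ⟶ Z (ψ k)) (l' : List κ) (n : List μ) (h : (l.map φ ++ l'.map ψ).Perm n) :
    listTensor X l ⊗ listTensor Y l' ⟶ listTensor Z n :=
  (listMap φ f l ⊗ₘ listMap ψ g l') ≫ joinList Z _ _ ≫ reorder Z _ _ h

/-- The analogue of `pairMap` for three tensor products. -/
noncomputable def tripleMap (φ : ι → μ) (f : ∀ i, X i ⟶ Z (φ i)) (l : List ι) (ψ : κ → μ)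
    (g : ∀ k, Y k ⟶ Z (ψ k)) (l' : List κ) (χ : ν → μ) (k : ∀ i, W i ⟶ Z (χ i)) (l'' : List ν)
    (n : List μ) (h : (l.map φ ++ l'.map ψ ++ l''.map χ).Perm n) :
    (listTensor X l ⊗ listTensor Y l') ⊗ listTensor W l'' ⟶ listTensor Z n :=
  ((listMap φ f l ⊗ₘ listMap ψ g l') ⊗ₘ listMap χ k l'') ≫ joinList Z _ _ ▷ _ ≫
    joinList Z _ _ ≫ reorder Z _ _ h

lemma permMap_pairMap (φ : ι → μ) (hφ : Function.Injective φ) (f : ∀ i, X i ⟶ Z (φ i)) (m : List ι)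
    (ψ : κ → μ) (hψ : Function.Injective ψ) (g : ∀ k, Y k ⟶ Z (ψ k)) (m' : List κ) (n : List μ)
    (h : (m.map φ ++ m'.map ψ).Perm n) (ω : ν → ι) (a : ∀ i, W i ⟶ X (ω i)) (l : List ν)
    (h1 : (l.map ω).Perm m) (ω' : ξ → κ) (b : ∀ i, V i ⟶ Y (ω' i)) (l' : List ξ)
    (h2 : (l'.map ω').Perm m') :
    (permMap ω a l m h1 ⊗ₘ permMap ω' b l' m' h2) ≫ pairMap φ f m ψ g m' n h =
      pairMap (φ ∘ ω) (fun i => a i ≫ f (ω i)) l (ψ ∘ ω') (fun i => b i ≫ g (ω' i)) l' n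
        (by rw [← List.map_map, ← List.map_map]
            exact ((h1.map φ).append (h2.map ψ)).trans h) := by
  rw [pairMap, tensorHom_comp_tensorHom_assoc, ← permMap_self φ f, ← permMap_self ψ g,
    permMap_comp _ _ _ hφ, permMap_comp _ _ _ hψ, permMap, permMap,
    ← tensorHom_comp_tensorHom_assoc, reassoc_of% (joinList_reorder (X := Z)), reorder_trans,
    pairMap]

lemma pairMap_permMap (φ : ι → μ) (f : ∀ i, X i ⟶ Z (φ i)) (l : List ι)
    (ψ : κ → μ) (g : ∀ k, Y k ⟶ Z (ψ k)) (l' : List κ) (n : List μ)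
    (h : (l.map φ ++ l'.map ψ).Perm n) (χ : μ → ν) (hχ : Function.Injective χ)
    (k : ∀ i, Z i ⟶ W (χ i)) (n' : List ν) (h' : (n.map χ).Perm n') :
    pairMap φ f l ψ g l' n h ≫ permMap χ k n n' h' =
      pairMap (χ ∘ φ) (fun i => f i ≫ k (φ i)) l (χ ∘ ψ) (fun i => g i ≫ k (ψ i)) l' n'
        (by rw [← List.map_map, ← List.map_map, ← List.map_append]
            exact (h.map χ).trans h') := by
  rw [pairMap, Category.assoc, Category.assoc, reorder_permMap _ hχ, permMap,
    reassoc_of% (joinList_listMap χ k (l.map φ) (l'.map ψ) (by rw [List.map_append])),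
    reorder_trans, tensorHom_comp_tensorHom_assoc, listMap_comp φ f χ k l (by rw [List.map_map]),
    listMap_comp ψ g χ k l' (by rw [List.map_map]), ← tensorHom_comp_tensorHom_assoc,
    reassoc_of% (joinList_reorder (X := W)), reorder_trans, pairMap]

lemma tensorHom_comp_comp_left {A B D E K K' : C} (a : A ⟶ B) (j : B ⟶ D) (r : D ⟶ E)
    (k : K ⟶ K') : (a ≫ j ≫ r) ⊗ₘ k = (a ⊗ₘ k) ≫ j ▷ K' ≫ r ▷ K' := by
  simp [← tensorHom_id]

lemma tensorHom_comp_comp_right {A B D E K K' : C} (a : A ⟶ B) (j : B ⟶ D) (r : D ⟶ E)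
    (k : K ⟶ K') : k ⊗ₘ (a ≫ j ≫ r) = (k ⊗ₘ a) ≫ K' ◁ j ≫ K' ◁ r := by
  simp [← id_tensorHom]

lemma pairMap_whiskerRight (φ : ι → μ) (f : ∀ i, X i ⟶ Z (φ i)) (l : List ι)
    (ψ : κ → μ) (g : ∀ k, Y k ⟶ Z (ψ k)) (l' : List κ) (m : List μ)
    (h : (l.map φ ++ l'.map ψ).Perm m) (ω : μ → ξ) (hω : Function.Injective ω)
    (w : ∀ i, Z i ⟶ V (ω i)) (χ : ν → ξ) (k : ∀ i, W i ⟶ V (χ i)) (l'' : List ν) (n : List ξ)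
    (h' : (m.map ω ++ l''.map χ).Perm n) :
    pairMap φ f l ψ g l' m h ▷ listTensor W l'' ≫ pairMap ω w m χ k l'' n h' =
      tripleMap (ω ∘ φ) (fun i => f i ≫ w (φ i)) l (ω ∘ ψ) (fun i => g i ≫ w (ψ i)) l' χ k l'' n
        (by rw [← List.map_map, ← List.map_map, ← List.map_append]
            exact ((h.map ω).append_right _).trans h') := by
  rw [pairMap.eq_1 ω, ← permMap_self ω w, ← tensorHom_id, tensorHom_comp_tensorHom_assoc,
    pairMap_permMap _ _ _ _ _ _ _ _ _ hω, Category.id_comp, pairMap, tripleMap,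
    tensorHom_comp_comp_left, Category.assoc, Category.assoc,
    reassoc_of% (joinList_reorder_left (X := V)), reorder_trans]

lemma tripleMap_eq (φ : ι → μ) (f : ∀ i, X i ⟶ Z (φ i)) (l : List ι) (ψ : κ → μ)
    (g : ∀ k, Y k ⟶ Z (ψ k)) (l' : List κ) (χ : ν → μ) (k : ∀ i, W i ⟶ Z (χ i)) (l'' : List ν)
    (n : List μ) (h : (l.map φ ++ l'.map ψ ++ l''.map χ).Perm n) :
    tripleMap φ f l ψ g l' χ k l'' n h = (α_ _ _ _).hom ≫
      (listMap φ f l ⊗ₘ (listMap ψ g l' ⊗ₘ listMap χ k l'')) ≫ _ ◁ joinList Z _ _ ≫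
        joinList Z _ _ ≫ reorder Z _ _ (by rwa [← List.append_assoc]) := by
  have h1 : (l.map φ ++ l'.map ψ ++ l''.map χ).Perm (l.map φ ++ (l'.map ψ ++ l''.map χ)) := by
    rw [List.append_assoc]
  have h2 := joinList_assoc (X := Z) (l.map φ) (l'.map ψ) (l''.map χ) h1
  rw [← associator_naturality_assoc, ← reassoc_of% h2, reorder_trans, tripleMap]

lemma whiskerLeft_pairMap (ψ : κ → μ) (g : ∀ k, Y k ⟶ Z (ψ k)) (l' : List κ)
    (χ : ν → μ) (k : ∀ i, W i ⟶ Z (χ i)) (l'' : List ν) (m : List μ)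
    (h : (l'.map ψ ++ l''.map χ).Perm m) (ω : μ → ξ) (hω : Function.Injective ω)
    (w : ∀ i, Z i ⟶ V (ω i)) (φ : ι → ξ) (f : ∀ i, X i ⟶ V (φ i)) (l : List ι) (n : List ξ)
    (h' : (l.map φ ++ m.map ω).Perm n) :
    (α_ _ _ _).hom ≫ listTensor X l ◁ pairMap ψ g l' χ k l'' m h ≫ pairMap φ f l ω w m n h' =
      tripleMap φ f l (ω ∘ ψ) (fun i => g i ≫ w (ψ i)) l' (ω ∘ χ) (fun i => k i ≫ w (χ i)) l'' n
        (by rw [← List.map_map, ← List.map_map, List.append_assoc, ← List.map_append]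
            exact ((h.map ω).append_left _).trans h') := by
  rw [pairMap.eq_1 φ, ← permMap_self ω w, ← id_tensorHom, tensorHom_comp_tensorHom_assoc,
    pairMap_permMap _ _ _ _ _ _ _ _ _ hω, Category.id_comp, pairMap, tripleMap_eq,
    tensorHom_comp_comp_right, Category.assoc, Category.assoc,
    reassoc_of% (joinList_reorder_right (X := V)), reorder_trans]

lemma pairMap_comm (φ : ι → μ) (f : ∀ i, X i ⟶ Z (φ i)) (l : List ι) (ψ : κ → μ)
    (g : ∀ k, Y k ⟶ Z (ψ k)) (l' : List κ) (n : List μ) (h : (l.map φ ++ l'.map ψ).Perm n)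
    (hn : n.Nodup) :
    (β_ _ _).hom ≫ pairMap φ f l ψ g l' n h =
      pairMap ψ g l' φ f l n (List.perm_append_comm.trans h) := by
  have hd : (l.map φ).Disjoint (l'.map ψ) := List.disjoint_of_nodup_append (h.nodup_iff.2 hn)
  rw [pairMap, ← BraidedCategory.braiding_naturality_assoc,
    ← reassoc_of% (joinList_comm (X := Z) _ _ hd), reorder_trans, pairMap]

lemma tripleMap_comm (φ : ι → μ) (f : ∀ i, X i ⟶ Z (φ i)) (l : List ι) (ψ : κ → μ)
    (g : ∀ k, Y k ⟶ Z (ψ k)) (l' : List κ) (χ : ν → μ) (k : ∀ i, W i ⟶ Z (χ i)) (l'' : List ν)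
    (n : List μ) (h : (l.map φ ++ l'.map ψ ++ l''.map χ).Perm n) (hn : n.Nodup) :
    (α_ _ _ _).hom ≫ _ ◁ (β_ _ _).hom ≫ (α_ _ _ _).inv ≫ tripleMap φ f l ψ g l' χ k l'' n h =
      tripleMap φ f l χ k l'' ψ g l' n (by
        rw [List.append_assoc] at h ⊢
        exact (List.perm_append_comm.append_left _).trans h) := by
  have hd : (l'.map ψ).Disjoint (l''.map χ) := by
    rw [List.append_assoc] at h
    exact List.disjoint_of_nodup_append (List.Nodup.of_append_right (h.nodup_iff.2 hn))
  rw [tripleMap_eq, tripleMap_eq, Iso.inv_hom_id_assoc, ← id_tensorHom,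
    tensorHom_comp_tensorHom_assoc, ← BraidedCategory.braiding_naturality, Category.id_comp]
  have h1 : ∀ {A B D E K : C} (a : A ⟶ B) (b : D ⟶ E) (j : E ⟶ K), a ⊗ₘ (b ≫ j) =
      (a ⊗ₘ b) ≫ B ◁ j := fun a b j => by simp [← id_tensorHom]
  rw [h1, Category.assoc, ← whiskerLeft_comp_assoc, ← joinList_comm (X := Z) _ _ hd,
    whiskerLeft_comp_assoc, reassoc_of% (joinList_reorder_right (X := Z)), reorder_trans]

lemma pairMap_nil_left (φ : ι → μ) (f : ∀ i, X i ⟶ Z (φ i)) (ψ : κ → μ)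
    (g : ∀ k, Y k ⟶ Z (ψ k)) (l' : List κ) (n : List μ) (h : (l'.map ψ).Perm n) :
    pairMap φ f [] ψ g l' n h = (λ_ (listTensor Y l')).hom ≫ permMap ψ g l' n h := by
  rw [permMap, ← reassoc_of% (leftUnitor_naturality (listMap ψ g l'))]
  exact congrArg (fun q => q ≫ _) (id_tensorHom _ _)

lemma pairMap_nil_right (φ : ι → μ) (f : ∀ i, X i ⟶ Z (φ i)) (l : List ι) (ψ : κ → μ)
    (g : ∀ k, Y k ⟶ Z (ψ k)) (n : List μ) (h : (l.map φ).Perm n) :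
    pairMap φ f l ψ g [] n (by simpa using h) =
      (ρ_ (listTensor X l)).hom ≫ permMap φ f l n h := by
  have h1 : (l.map φ ++ []).Perm (l.map φ) := by simp
  have h2 := joinList_nil_right (X := Z) (l.map φ) h1
  have h3 := reorder_trans Z (l.map φ ++ []) (l.map φ) n h1 h
  rw [permMap, ← reassoc_of% (rightUnitor_naturality (listMap φ f l))]
  refine Eq.trans ?_ (congrArg (fun q => listMap φ f l ▷ 𝟙_ C ≫ q ≫ reorder Z _ n h) h2)
  refine (congrArg (fun q => (listMap φ f l ⊗ₘ listMap ψ g []) ≫ joinList Z [] (l.map φ) ≫ q)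
    h3.symm).trans ?_
  refine Eq.trans ?_ (congrArg (fun q => listMap φ f l ▷ 𝟙_ C ≫ q) (Category.assoc _ _ _).symm)
  exact congrArg (fun q => q ≫ _) (tensorHom_id _ _)

lemma isIso_pairMap (φ : ι → μ) (f : ∀ i, X i ⟶ Z (φ i)) [∀ i, IsIso (f i)] (l : List ι)
    (ψ : κ → μ) (g : ∀ k, Y k ⟶ Z (ψ k)) [∀ i, IsIso (g i)] (l' : List κ) (n : List μ)
    (h : (l.map φ ++ l'.map ψ).Perm n) : IsIso (pairMap φ f l ψ g l' n h) := by
  have := isIso_listMap φ f l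
  have := isIso_listMap ψ g l'
  rw [pairMap]
  infer_instance

/-! ### The given maps of unordered tensor products -/

lemma eqToHom_comp_listTensorMap_id (φ : ι → κ) (f : ∀ i, X i ⟶ Y (φ i)) (l : List ι)
    (h : listTensor X l = listTensor X (l.map id)) :
    eqToHom h ≫ listTensorMap (X := X) id φ f l = listMap φ f l := by
  have h' : ∀ (p : (l.map id).Perm l),
      listTensorMap (X := X) id φ f l = reorder X (l.map id) l p ≫ listMap φ f l := fun p => by
    induction l with
    | nil => exact (congrArg (· ≫ 𝟙 (𝟙_ C)) (reorder_self X [] p)).trans (Category.comp_id _)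
        |>.symm
    | cons i l ih =>
      have h1 := reorder_cons_cons X i _ _ p
      refine Eq.trans ?_ (congrArg (fun g => g ≫ listMap φ f (i :: l)) h1).symm
      rw [listMap_cons]
      simp only [Category.assoc, Iso.inv_hom_id_assoc]
      rw [← id_tensorHom, tensorHom_comp_tensorHom_assoc, ← ih (by rw [List.map_id]) (by simp)]
      rw [Category.id_comp]
      exact ((Category.id_comp _).trans (Category.comp_id _)).symm
  have h1 : eqToHom h = reorder X l (l.map id) (by simp) :=
    eqToHom_eq_reorder X (List.map_id l).symm
  rw [h1, h' (by simp), ← Category.assoc, reorder_trans, reorder_self, Category.id_comp]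

lemma listMap_comp_listTensorMap (φ : ι → κ) (f : ∀ i, X i ⟶ Y (φ i)) (ψ : ι → μ)
    (g : ∀ i, Y (φ i) ⟶ Z (ψ i)) (l : List ι) :
    listMap φ f l ≫ listTensorMap φ ψ g l = listMap ψ (fun i => f i ≫ g i) l := by
  induction l with
  | nil => exact Category.id_comp _
  | cons i l ih =>
    rw [listMap_cons, listMap_cons, ← ih]
    have : listTensorMap φ ψ g (i :: l) = (consIso Y (φ i) (l.map φ)).hom ≫
        (g i ⊗ₘ listTensorMap φ ψ g l) ≫ (consIso Z (ψ i) (l.map ψ)).inv :=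
      ((Category.id_comp _).trans (Category.comp_id _)).symm
    refine (congrArg (fun q => ((consIso X i l).hom ≫ (f i ⊗ₘ listMap φ f l) ≫
      (consIso Y (φ i) (l.map φ)).inv) ≫ q) this).trans ?_
    simp only [Category.assoc, Iso.inv_hom_id_assoc, tensorHom_comp_tensorHom_assoc]

end PairMaps

namespace LTree

/-! ### Identities between clusters -/

section Clusters

variable {A A' B B' D : NFin}

lemma map_symm_map (σ : A ≃ A') (c : Finset A) :
    (c.map σ.toEmbedding).map σ.symm.toEmbedding = c := by
  ext; simp

lemma map_injective (σ : A ≃ A') :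
    Function.Injective fun c : Finset A => c.map σ.toEmbedding := Finset.map_injective _

lemma lowerCluster_map_insCongr (σ : A ≃ A') (τ : B ≃ B') (a : A) (c : Finset A) :
    (lowerCluster a B c).map (NFin.insCongr σ τ a).toEmbedding =
      lowerCluster (σ a) B' (c.map σ.toEmbedding) := by
  ext x
  rw [Finset.mem_map_equiv]
  rcases x with x | x
  · rw [inl_mem_lowerCluster, Finset.mem_map_equiv]
    exact inl_mem_lowerCluster a c _
  · rw [inr_mem_lowerCluster, Finset.mem_map_equiv, Equiv.symm_apply_apply]
    exact inr_mem_lowerCluster a c _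

lemma upperCluster_map_insCongr (σ : A ≃ A') (τ : B ≃ B') (a : A) (d : Finset B) :
    (upperCluster a d).map (NFin.insCongr σ τ a).toEmbedding =
      upperCluster (σ a) (d.map τ.toEmbedding) := by
  ext x
  rw [Finset.mem_map_equiv]
  rcases x with x | x
  · rw [inl_mem_upperCluster]
    exact inl_mem_upperCluster a d _
  · rw [inr_mem_upperCluster, Finset.mem_map_equiv]
    exact inr_mem_upperCluster a d _

lemma lowerCluster_lowerCluster_map_insAssoc (a : A) (b : B) (c : Finset A) :
    (lowerCluster (A := NFin.ins A a B) (Sum.inr b) D (lowerCluster a B c)).map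
      (NFin.insAssoc A a B b D).toEmbedding = lowerCluster a (NFin.ins B b D) c := by
  ext x
  rw [Finset.mem_map_equiv]
  rcases x with x | x | x
  · rw [inl_mem_lowerCluster]
    refine Iff.trans (inl_mem_lowerCluster (A := NFin.ins A a B) _ _ ⟨Sum.inl x, _⟩) ?_
    exact inl_mem_lowerCluster a c x
  · rw [inr_mem_lowerCluster]
    refine Iff.trans (inl_mem_lowerCluster (A := NFin.ins A a B) _ _ ⟨Sum.inr x.1, _⟩) ?_
    exact inr_mem_lowerCluster a c x.1
  · rw [inr_mem_lowerCluster]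
    refine Iff.trans (inr_mem_lowerCluster (A := NFin.ins A a B) _ _ x) ?_
    exact inr_mem_lowerCluster a c b

lemma lowerCluster_upperCluster_map_insAssoc (a : A) (b : B) (d : Finset B) :
    (lowerCluster (A := NFin.ins A a B) (Sum.inr b) D (upperCluster a d)).map
      (NFin.insAssoc A a B b D).toEmbedding = upperCluster a (lowerCluster b D d) := by
  ext x
  rw [Finset.mem_map_equiv]
  rcases x with x | x | x
  · rw [inl_mem_upperCluster]
    refine Iff.trans (inl_mem_lowerCluster (A := NFin.ins A a B) _ _ ⟨Sum.inl x, _⟩) ?_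
    exact inl_mem_upperCluster a d x
  · rw [inr_mem_upperCluster, inl_mem_lowerCluster]
    refine Iff.trans (inl_mem_lowerCluster (A := NFin.ins A a B) _ _ ⟨Sum.inr x.1, _⟩) ?_
    exact inr_mem_upperCluster a d x.1
  · rw [inr_mem_upperCluster, inr_mem_lowerCluster]
    refine Iff.trans (inr_mem_lowerCluster (A := NFin.ins A a B) _ _ x) ?_
    exact inr_mem_upperCluster a d b

lemma upperCluster_map_insAssoc (a : A) (b : B) (e : Finset D) :
    (upperCluster (A := NFin.ins A a B) (Sum.inr b) e).map
      (NFin.insAssoc A a B b D).toEmbedding = upperCluster a (upperCluster b e) := by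
  ext x
  rw [Finset.mem_map_equiv]
  rcases x with x | x | x
  · rw [inl_mem_upperCluster]
    exact inl_mem_upperCluster (A := NFin.ins A a B) _ _ _
  · rw [inr_mem_upperCluster, inl_mem_upperCluster]
    exact inl_mem_upperCluster (A := NFin.ins A a B) _ _ _
  · rw [inr_mem_upperCluster, inr_mem_upperCluster]
    exact inr_mem_upperCluster (A := NFin.ins A a B) _ _ _

variable (a a' : A) (h : a ≠ a')

lemma lowerCluster_lowerCluster_map_insComm (c : Finset A) :
    (lowerCluster (A := NFin.ins A a B) (Sum.inl ⟨a', h.symm⟩) D (lowerCluster a B c)).map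
      (NFin.insComm A a a' h B D).toEmbedding =
    lowerCluster (A := NFin.ins A a' D) (Sum.inl ⟨a, h⟩) B (lowerCluster a' D c) := by
  ext x
  rw [Finset.mem_map_equiv]
  rcases x with ⟨x | x, hx⟩ | x
  · refine Iff.trans ?_ (inl_mem_lowerCluster (A := NFin.ins A a' D) _ _ ⟨Sum.inl x, hx⟩).symm
    refine Iff.trans ?_ (inl_mem_lowerCluster a' c x).symm
    refine Iff.trans (inl_mem_lowerCluster (A := NFin.ins A a B) _ _ ⟨Sum.inl _, _⟩) ?_
    exact inl_mem_lowerCluster a c _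
  · refine Iff.trans ?_ (inl_mem_lowerCluster (A := NFin.ins A a' D) _ _ ⟨Sum.inr x, hx⟩).symm
    refine Iff.trans ?_ (inr_mem_lowerCluster a' c x).symm
    refine Iff.trans (inr_mem_lowerCluster (A := NFin.ins A a B) _ _ x) ?_
    exact inl_mem_lowerCluster a c _
  · refine Iff.trans ?_ (inr_mem_lowerCluster (A := NFin.ins A a' D) _ _ x).symm
    refine Iff.trans ?_ (inl_mem_lowerCluster a' c _).symm
    refine Iff.trans (inl_mem_lowerCluster (A := NFin.ins A a B) _ _ ⟨Sum.inr x, _⟩) ?_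
    exact inr_mem_lowerCluster a c x

lemma lowerCluster_upperCluster_map_insComm (d : Finset B) :
    (lowerCluster (A := NFin.ins A a B) (Sum.inl ⟨a', h.symm⟩) D (upperCluster a d)).map
      (NFin.insComm A a a' h B D).toEmbedding =
    upperCluster (A := NFin.ins A a' D) (Sum.inl ⟨a, h⟩) d := by
  ext x
  rw [Finset.mem_map_equiv]
  rcases x with ⟨x | x, hx⟩ | x
  · refine Iff.trans ?_ (inl_mem_upperCluster (A := NFin.ins A a' D) _ _ ⟨Sum.inl x, hx⟩).symm
    refine Iff.trans (inl_mem_lowerCluster (A := NFin.ins A a B) _ _ ⟨Sum.inl _, _⟩) ?_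
    exact inl_mem_upperCluster a d _
  · refine Iff.trans ?_ (inl_mem_upperCluster (A := NFin.ins A a' D) _ _ ⟨Sum.inr x, hx⟩).symm
    refine Iff.trans (inr_mem_lowerCluster (A := NFin.ins A a B) _ _ x) ?_
    exact inl_mem_upperCluster a d _
  · refine Iff.trans ?_ (inr_mem_upperCluster (A := NFin.ins A a' D) _ _ x).symm
    refine Iff.trans (inl_mem_lowerCluster (A := NFin.ins A a B) _ _ ⟨Sum.inr x, _⟩) ?_
    exact inr_mem_upperCluster a d x

lemma upperCluster_map_insComm (e : Finset D) :
    (upperCluster (A := NFin.ins A a B) (Sum.inl ⟨a', h.symm⟩) e).map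
      (NFin.insComm A a a' h B D).toEmbedding =
    lowerCluster (A := NFin.ins A a' D) (Sum.inl ⟨a, h⟩) B (upperCluster a' e) := by
  ext x
  rw [Finset.mem_map_equiv]
  rcases x with ⟨x | x, hx⟩ | x
  · refine Iff.trans ?_ (inl_mem_lowerCluster (A := NFin.ins A a' D) _ _ ⟨Sum.inl x, hx⟩).symm
    refine Iff.trans ?_ (inl_mem_upperCluster a' e x).symm
    exact inl_mem_upperCluster (A := NFin.ins A a B) _ _ _
  · refine Iff.trans ?_ (inl_mem_lowerCluster (A := NFin.ins A a' D) _ _ ⟨Sum.inr x, hx⟩).symm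
    refine Iff.trans ?_ (inr_mem_upperCluster a' e x).symm
    exact inr_mem_upperCluster (A := NFin.ins A a B) _ _ _
  · refine Iff.trans ?_ (inr_mem_lowerCluster (A := NFin.ins A a' D) _ _ x).symm
    refine Iff.trans ?_ (inl_mem_upperCluster a' e _).symm
    exact inl_mem_upperCluster (A := NFin.ins A a B) _ _ _

lemma upperCluster_map_oneIns (d : Finset A) :
    (upperCluster (A := NFin.one) () d).map (NFin.oneIns A).toEmbedding = d := by
  ext x
  rw [Finset.mem_map_equiv]
  exact inr_mem_upperCluster (A := NFin.one) _ _ _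

lemma map_insOne (c : Finset A) :
    c.map (NFin.insOne A a).toEmbedding = lowerCluster a NFin.one c := by
  ext x
  rw [Finset.mem_map_equiv]
  rcases x with x | x
  · exact (inl_mem_lowerCluster a c x).symm
  · exact (inr_mem_lowerCluster a c x).symm

lemma lowerCluster_univ : lowerCluster a B Finset.univ = Finset.univ := by
  ext (x | x)
  · simpa using (inl_mem_lowerCluster a _ x).2 (Finset.mem_univ _)
  · simpa using (inr_mem_lowerCluster a _ x).2 (Finset.mem_univ _)

end Clusters

/-! ### Identities between trees -/

section Trees

variable {A A' A'' B B' D : NFin}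

lemma relabel_refl (T : LTree A) : T.relabel (Equiv.refl A) = T := by
  ext c
  simp [relabel]

lemma relabel_trans (T : LTree A) (σ : A ≃ A') (τ : A' ≃ A'') :
    (T.relabel σ).relabel τ = T.relabel (σ.trans τ) := by
  refine LTree.ext ?_
  simp only [relabel, Finset.image_image]
  refine Finset.image_congr fun c _ => ?_
  simp only [Function.comp, Finset.map_map]
  rfl

lemma relabel_injective (σ : A ≃ A') : Function.Injective (relabel σ : LTree A → LTree A') :=
  fun T T' h => by
    have := congrArg (relabel σ.symm) h
    rwa [relabel_trans, relabel_trans, Equiv.self_trans_symm, relabel_refl, relabel_refl] at this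

/-- Relabelling of an internal edge. -/
def relabelEdge (σ : A ≃ A') {T : LTree A} (e : T.InternalEdge) : (T.relabel σ).InternalEdge where
  lower := relabelVertex σ e.lower
  upper := relabelVertex σ e.upper
  mem := (children_image (T := T) (T' := T.relabel σ) (fun c => c.map σ.toEmbedding)
    (map_subset_iff σ) e.lower.1 (fun _ hc _ => Finset.mem_image_of_mem _ hc)
    (fun x hx hxv => by
      obtain ⟨c, hc, rfl⟩ := Finset.mem_image.1 hx
      exact ⟨c, hc, by simpa using hxv, subset_rfl⟩) _).2 ⟨_, e.mem, rfl⟩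

lemma relabel_contract (σ : A ≃ A') {T : LTree A} (e : T.InternalEdge) :
    (T.contract e).relabel σ = (T.relabel σ).contract (relabelEdge σ e) :=
  LTree.ext (Finset.image_erase (map_injective σ) _ _)

lemma graft_relabel (T : LTree A) (a : A) (U : LTree B) (σ : A ≃ A') (τ : B ≃ B') :
    (T.graft a U).relabel (NFin.insCongr σ τ a) = (T.relabel σ).graft (σ a) (U.relabel τ) := by
  refine LTree.ext ?_
  simp only [relabel, graft, Finset.image_union, Finset.image_image]
  exact congrArg₂ _ (Finset.image_congr fun c _ => lowerCluster_map_insCongr σ τ a c)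
    (Finset.image_congr fun c _ => upperCluster_map_insCongr σ τ a c)

lemma graft_assoc (T : LTree A) (a : A) (U : LTree B) (b : B) (W : LTree D) :
    ((T.graft a U).graft (Sum.inr b) W).relabel (NFin.insAssoc A a B b D) =
      T.graft a (U.graft b W) := by
  refine LTree.ext ?_
  simp only [relabel, graft, Finset.image_union, Finset.image_image, Finset.union_assoc]
  exact congrArg₂ _
    (Finset.image_congr fun c _ => lowerCluster_lowerCluster_map_insAssoc a b c) <| congrArg₂ _
    (Finset.image_congr fun c _ => lowerCluster_upperCluster_map_insAssoc a b c)
    (Finset.image_congr fun c _ => upperCluster_map_insAssoc a b c)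

lemma graft_comm (T : LTree A) (a a' : A) (h : a ≠ a') (U : LTree B) (W : LTree D) :
    ((T.graft a U).graft (Sum.inl ⟨a', h.symm⟩) W).relabel (NFin.insComm A a a' h B D) =
      (T.graft a' W).graft (Sum.inl ⟨a, h⟩) U := by
  refine LTree.ext ?_
  simp only [relabel, graft, Finset.image_union, Finset.image_image]
  rw [Finset.union_right_comm]
  exact congrArg₂ _ (congrArg₂ _
    (Finset.image_congr fun c _ => lowerCluster_lowerCluster_map_insComm a a' h c)
    (Finset.image_congr fun c _ => upperCluster_map_insComm a a' h c))
    (Finset.image_congr fun c _ => lowerCluster_upperCluster_map_insComm a a' h c)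

/-- The tree with one leaf. -/
def oneTree : LTree NFin.one where
  clusters := {Finset.univ}
  univ_mem := Finset.mem_singleton_self _
  singleton_mem _ := Finset.mem_singleton.2 rfl
  nonempty h := by
    rw [Finset.mem_singleton.1 h]
    exact Finset.univ_nonempty
  nested h h' := by
    rw [Finset.mem_singleton.1 h, Finset.mem_singleton.1 h']
    exact Or.inl subset_rfl

lemma eq_oneTree (T : LTree NFin.one) : T = oneTree := by
  refine LTree.ext (Finset.ext fun c => ?_)
  rw [oneTree, Finset.mem_singleton]
  exact ⟨T.eq_univ_of_one, fun h => h ▸ T.univ_mem⟩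

lemma oneTree_graft (U : LTree A) :
    (oneTree.graft () U).relabel (NFin.oneIns A) = U := by
  refine LTree.ext ?_
  simp only [relabel, graft, Finset.image_union, Finset.image_image]
  have h1 : U.clusters.image ((fun c => c.map (NFin.oneIns A).toEmbedding) ∘
      upperCluster (A := NFin.one) ()) = U.clusters :=
    (Finset.image_congr fun c _ => upperCluster_map_oneIns c).trans Finset.image_id
  refine (congrArg _ h1).trans (Finset.union_eq_right.2 fun c hc => ?_)
  obtain ⟨d, hd, rfl⟩ := Finset.mem_image.1 hc
  rw [oneTree.eq_univ_of_one hd, Function.comp, lowerCluster_univ, Finset.map_univ_equiv]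
  exact U.univ_mem

lemma graft_oneTree (T : LTree A) (a : A) :
    T.relabel (NFin.insOne A a) = T.graft a oneTree := by
  refine LTree.ext ?_
  simp only [relabel, graft]
  have h1 : T.clusters.image (fun c => c.map (NFin.insOne A a).toEmbedding) =
      T.clusters.image (lowerCluster a NFin.one) := Finset.image_congr fun c _ => map_insOne a c
  refine h1.trans (Finset.union_eq_left.2 fun c hc => ?_).symm
  obtain ⟨d, hd, rfl⟩ := Finset.mem_image.1 hc
  rw [oneTree.eq_univ_of_one hd, ← lowerCluster_singleton]
  exact Finset.mem_image_of_mem _ (T.singleton_mem a)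

end Trees

/-! ### Edges and vertices of graftings -/

section GraftEdges

variable {A B : NFin} {a : A} {T : LTree A} {U : LTree B}

/-- An internal edge of `T`, as an internal edge of `T ∪ₐ U`. -/
noncomputable def lowerEdge (a : A) (U : LTree B) (e : T.InternalEdge) :
    (T.graft a U).InternalEdge where
  lower := lowerVertex a U e.lower
  upper := lowerVertex a U e.upper
  mem := (lowerInc a U e.lower ⟨_, e.mem⟩).2

/-- An internal edge of `U`, as an internal edge of `T ∪ₐ U`. -/
noncomputable def upperEdge (a : A) (T : LTree A) (e : U.InternalEdge) :
    (T.graft a U).InternalEdge where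
  lower := upperVertex a T e.lower
  upper := upperVertex a T e.upper
  mem := (upperInc a T e.lower ⟨_, e.mem⟩).2

lemma Vertex.ne_singleton {T : LTree A} (v : T.Vertex) (x : A) : v.1 ≠ {x} := fun h => by
  have := v.card
  rw [h] at this
  simp at this

lemma lowerVertex_ne (v : T.Vertex) (d : Finset B) : lowerCluster a B v.1 ≠ upperCluster a d :=
  fun h => v.ne_singleton a (eq_singleton_of_lowerCluster_eq a (T.nonempty v.mem) h)

lemma graft_contract_lower (e : T.InternalEdge) :
    (T.contract e).graft a U = (T.graft a U).contract (lowerEdge a U e) := by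
  refine LTree.ext ?_
  simp only [graft, contract, lowerEdge, lowerVertex, Finset.erase_union_distrib]
  rw [Finset.image_erase (lowerCluster_injective a), Finset.erase_eq_of_notMem
    (s := U.clusters.image (upperCluster a))]
  intro h
  obtain ⟨d, -, h⟩ := Finset.mem_image.1 h
  exact lowerVertex_ne e.upper d h.symm

lemma InternalEdge.upper_ne_univ {T : LTree A} (e : T.InternalEdge) : e.upper.1 ≠ Finset.univ :=
  fun h => by
    have := e.upper_ssubset
    rw [h] at this
    exact this.2 (Finset.subset_univ _)

lemma graft_contract_upper (e : U.InternalEdge) :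
    T.graft a (U.contract e) = (T.graft a U).contract (upperEdge a T e) := by
  refine LTree.ext ?_
  simp only [graft, contract, upperEdge, upperVertex, Finset.erase_union_distrib]
  rw [Finset.image_erase (upperCluster_injective a), Finset.erase_eq_of_notMem
    (s := T.clusters.image (lowerCluster a B))]
  intro h
  obtain ⟨c, hc, h⟩ := Finset.mem_image.1 h
  rw [eq_singleton_of_lowerCluster_eq a (T.nonempty hc) h, lowerCluster_singleton] at h
  exact e.upper_ne_univ (upperCluster_injective a h).symm

lemma vertex_graft_cases (v : (T.graft a U).Vertex) :
    (∃ w, v = lowerVertex a U w) ∨ ∃ w, v = upperVertex a T w := by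
  have := (perm_graft T a U).mem_iff.1 (Finset.mem_toList.2 (Finset.mem_univ v))
  rw [List.mem_append, List.mem_map, List.mem_map] at this
  rcases this with ⟨w, -, h⟩ | ⟨w, -, h⟩
  · exact Or.inl ⟨w, h.symm⟩
  · exact Or.inr ⟨w, h.symm⟩

lemma InternalEdge.ext {e e' : T.InternalEdge} (h : e.lower = e'.lower)
    (h' : e.upper = e'.upper) : e = e' := by
  cases e
  cases e'
  cases h
  cases h'
  rfl

/-- An internal edge of `T ∪ₐ U` is an internal edge of `T`, an internal edge of `U`, or the edge
along which the trees were grafted. -/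
lemma edge_graft_cases (e : (T.graft a U).InternalEdge) :
    (∃ e', e = lowerEdge a U e') ∨ (∃ e', e = upperEdge a T e') ∨
      e.upper.1 = upperCluster a Finset.univ := by
  rcases vertex_graft_cases e.lower with ⟨v, hv⟩ | ⟨v, hv⟩ <;>
    rcases vertex_graft_cases e.upper with ⟨w, hw⟩ | ⟨w, hw⟩
  · left
    have hm := e.mem
    rw [hv, hw] at hm
    obtain ⟨⟨c, hc⟩, h⟩ := (lowerInc a U v).surjective ⟨_, hm⟩
    have h' : lowerCluster a B c = lowerCluster a B w.1 := congrArg Subtype.val h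
    refine ⟨⟨v, w, ?_⟩, InternalEdge.ext hv hw⟩
    rwa [lowerCluster_injective a h'] at hc
  · right; right
    obtain ⟨-, h1, h2⟩ := (T.graft a U).mem_children.1 e.mem
    rw [hv, hw] at h1 h2
    have h3 := w.card
    have h1' : upperCluster a w.1 ⊂ lowerCluster a B v.1 := h1
    rw [hw]
    by_contra hne
    refine h2 (upperCluster a Finset.univ) (upperCluster_mem U.univ_mem)
      (Finset.ssubset_iff_subset_ne.2 ⟨(upperCluster_subset a _ _).2 (Finset.subset_univ _),
        hne⟩) ?_
    obtain ⟨b, hb⟩ := U.nonempty w.mem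
    have ha : a ∈ v.1 := (inr_mem_lowerCluster a v.1 b).1
      (h1'.subset ((inr_mem_upperCluster a w.1 b).2 hb))
    rw [← lowerCluster_singleton]
    exact (lowerCluster_ssubset a _ _).2 (Finset.ssubset_iff_subset_ne.2
      ⟨Finset.singleton_subset_iff.2 ha, (v.ne_singleton a).symm⟩)
  · exfalso
    have h1 := e.upper_ssubset
    rw [hv, hw] at h1
    have h1' : lowerCluster a B w.1 ⊂ upperCluster a v.1 := h1
    obtain ⟨x, hx⟩ := T.nonempty w.mem
    have h2 : w.1 = {a} := by
      refine Finset.eq_singleton_iff_nonempty_unique_mem.2 ⟨⟨x, hx⟩, fun y hy => ?_⟩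
      by_contra hya
      exact (inl_mem_upperCluster a v.1 ⟨y, hya⟩).1
        (h1'.subset ((inl_mem_lowerCluster a w.1 ⟨y, hya⟩).2 hy))
    exact w.ne_singleton a h2
  · right; left
    have hm := e.mem
    rw [hv, hw] at hm
    obtain ⟨⟨c, hc⟩, h⟩ := (upperInc a T v).surjective ⟨_, hm⟩
    have h' : upperCluster a c = upperCluster a w.1 := congrArg Subtype.val h
    refine ⟨⟨v, w, ?_⟩, InternalEdge.ext hv hw⟩
    rwa [upperCluster_injective a h'] at hc

lemma mem_graft_lower (c : Finset A) :
    lowerCluster a B c ∈ (T.graft a U).clusters ↔ c ∈ T.clusters := by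
  refine ⟨fun h => ?_, lowerCluster_mem⟩
  rcases Finset.mem_union.1 h with h | h
  · obtain ⟨d, hd, h⟩ := Finset.mem_image.1 h
    rwa [← lowerCluster_injective a h]
  · obtain ⟨d, hd, h⟩ := Finset.mem_image.1 h
    by_cases hc : c.Nonempty
    · rw [eq_singleton_of_lowerCluster_eq a hc h.symm]
      exact T.singleton_mem a
    · rw [Finset.not_nonempty_iff_eq_empty] at hc
      obtain ⟨b, hb⟩ := U.nonempty hd
      have := (inr_mem_upperCluster a d b).2 hb
      rw [h, inr_mem_lowerCluster, hc] at this
      simp at this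

lemma mem_graft_upper (d : Finset B) :
    upperCluster a d ∈ (T.graft a U).clusters ↔ d ∈ U.clusters := by
  refine ⟨fun h => ?_, upperCluster_mem⟩
  rcases Finset.mem_union.1 h with h | h
  · obtain ⟨c, hc, h⟩ := Finset.mem_image.1 h
    rw [eq_singleton_of_lowerCluster_eq a (T.nonempty hc) h, lowerCluster_singleton] at h
    rw [← upperCluster_injective a h]
    exact U.univ_mem
  · obtain ⟨c, hc, h⟩ := Finset.mem_image.1 h
    rwa [← upperCluster_injective a h]

lemma graft_injective {T T' : LTree A} {U U' : LTree B} (h : T.graft a U = T'.graft a U') :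
    T = T' ∧ U = U' := by
  constructor
  · ext c
    rw [← mem_graft_lower (a := a) (U := U), h, mem_graft_lower]
  · ext c
    rw [← mem_graft_upper (a := a) (T := T), h, mem_graft_upper]

/-- A tree labelled by `A ∪ₐ B` is a grafting if and only if `B` is one of its clusters. -/
lemma exists_eq_graft_iff (V : LTree (NFin.ins A a B)) :
    (∃ (T : LTree A) (U : LTree B), V = T.graft a U) ↔
      upperCluster a Finset.univ ∈ V.clusters := by
  classical
  constructor
  · rintro ⟨T, U, rfl⟩
    exact upperCluster_mem U.univ_mem
  · intro hV
    let T : LTree A :=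
      { clusters := Finset.univ.filter fun c => lowerCluster a B c ∈ V.clusters
        univ_mem := by
          rw [Finset.mem_filter, lowerCluster_univ]
          exact ⟨Finset.mem_univ _, V.univ_mem⟩
        singleton_mem := fun x => by
          rw [Finset.mem_filter]
          refine ⟨Finset.mem_univ _, ?_⟩
          by_cases hx : x = a
          · rwa [hx, lowerCluster_singleton]
          · have h1 : lowerCluster a B {x} = {Sum.inl ⟨x, hx⟩} := by
              ext (y | y)
              · rw [inl_mem_lowerCluster, Finset.mem_singleton, Finset.mem_singleton,
                  Sum.inl.injEq, Subtype.ext_iff]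
              · rw [inr_mem_lowerCluster, Finset.mem_singleton, Finset.mem_singleton]
                simpa using fun h => hx h.symm
            rw [h1]
            exact V.singleton_mem _
        nonempty := fun {c} h => by
          obtain ⟨x | x, hx⟩ := V.nonempty (Finset.mem_filter.1 h).2
          · exact ⟨_, (inl_mem_lowerCluster a c x).1 hx⟩
          · exact ⟨_, (inr_mem_lowerCluster a c x).1 hx⟩
        nested := fun {c d} h h' => by
          rcases V.nested (Finset.mem_filter.1 h).2 (Finset.mem_filter.1 h').2 with h | h | h
          · exact Or.inl ((lowerCluster_subset a _ _).1 h)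
          · exact Or.inr (Or.inl ((lowerCluster_subset a _ _).1 h))
          · refine Or.inr (Or.inr (Finset.disjoint_left.2 fun x hx hx' => ?_))
            by_cases hxa : x = a
            · subst hxa
              obtain ⟨b⟩ := B.nonempty
              exact Finset.disjoint_left.1 h ((inr_mem_lowerCluster x c b).2 hx)
                ((inr_mem_lowerCluster x d b).2 hx')
            · exact Finset.disjoint_left.1 h ((inl_mem_lowerCluster a c ⟨x, hxa⟩).2 hx)
                ((inl_mem_lowerCluster a d ⟨x, hxa⟩).2 hx') }
    let U : LTree B :=
      { clusters := Finset.univ.filter fun c => upperCluster a c ∈ V.clusters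
        univ_mem := Finset.mem_filter.2 ⟨Finset.mem_univ _, hV⟩
        singleton_mem := fun x => by
          rw [Finset.mem_filter]
          refine ⟨Finset.mem_univ _, ?_⟩
          have h1 : upperCluster a {x} = {Sum.inr x} := by simp [upperCluster]
          rw [h1]
          exact V.singleton_mem _
        nonempty := fun {c} h => by
          obtain ⟨x | x, hx⟩ := V.nonempty (Finset.mem_filter.1 h).2
          · exact ((inl_mem_upperCluster a c x).1 hx).elim
          · exact ⟨_, (inr_mem_upperCluster a c x).1 hx⟩
        nested := fun {c d} h h' => by
          rcases V.nested (Finset.mem_filter.1 h).2 (Finset.mem_filter.1 h').2 with h | h | h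
          · exact Or.inl ((upperCluster_subset a _ _).1 h)
          · exact Or.inr (Or.inl ((upperCluster_subset a _ _).1 h))
          · exact Or.inr (Or.inr ((Finset.disjoint_map _).1 h)) }
    refine ⟨T, U, LTree.ext (Finset.ext fun x => ?_)⟩
    rw [graft, Finset.mem_union, Finset.mem_image, Finset.mem_image]
    constructor
    · intro hx
      -- a cluster that meets `B` without lying inside it contains all of `B`
      by_cases hxB : x ⊆ upperCluster a Finset.univ
      · refine Or.inr ⟨Finset.univ.filter fun b => Sum.inr b ∈ x, ?_⟩
        have h1 : upperCluster a (Finset.univ.filter fun b : B => Sum.inr b ∈ x) = x := by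
          ext (y | y)
          · rw [inl_mem_upperCluster, false_iff]
            exact fun hy => (inl_mem_upperCluster a _ y).1 (hxB hy)
          · rw [inr_mem_upperCluster, Finset.mem_filter]
            exact and_iff_right (Finset.mem_univ _)
        exact ⟨Finset.mem_filter.2 ⟨Finset.mem_univ _, by rwa [h1]⟩, h1⟩
      · have hB : ∀ b b' : B, Sum.inr b ∈ x → Sum.inr b' ∈ x := fun b b' hb => by
          rcases V.nested hx hV with h | h | h
          · exact absurd h hxB
          · exact h ((inr_mem_upperCluster a _ b').2 (Finset.mem_univ _))
          · exact absurd ((inr_mem_upperCluster a _ b).2 (Finset.mem_univ _))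
              (Finset.disjoint_left.1 h hb)
        refine Or.inl ⟨Finset.univ.filter fun y =>
          if h : y = a then ∃ b : B, Sum.inr b ∈ x else Sum.inl ⟨y, h⟩ ∈ x, ?_⟩
        have h1 : lowerCluster a B (Finset.univ.filter fun y =>
            if h : y = a then ∃ b : B, Sum.inr b ∈ x else Sum.inl ⟨y, h⟩ ∈ x) = x := by
          ext (y | y)
          · rw [inl_mem_lowerCluster, Finset.mem_filter, dif_neg y.2]
            exact and_iff_right (Finset.mem_univ _)
          · rw [inr_mem_lowerCluster, Finset.mem_filter, dif_pos rfl]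
            exact ⟨fun ⟨_, b, hb⟩ => hB b y hb, fun h => ⟨Finset.mem_univ _, y, h⟩⟩
        exact ⟨Finset.mem_filter.2 ⟨Finset.mem_univ _, by rwa [h1]⟩, h1⟩
    · rintro (⟨c, hc, rfl⟩ | ⟨c, hc, rfl⟩)
      · exact (Finset.mem_filter.1 hc).2
      · exact (Finset.mem_filter.1 hc).2

end GraftEdges

end LTree

/-! ### Maps of clusters that preserve vertices and incoming edges -/

namespace LTree

variable {A A' B B' D : NFin}

/-- A map of sets of labels that sends the vertices of `T` injectively to vertices of `V`, and the
incoming edges of each vertex bijectively to the incoming edges of its image. -/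
structure IsEmb (f : Finset A → Finset A') (T : LTree A) (V : LTree A') : Prop where
  vertex (v : T.Vertex) : f v.1 ∈ V.vertices
  inj (v w : T.Vertex) : f v.1 = f w.1 → v = w
  bijOn (v : T.Vertex) : Set.BijOn f (T.children v.1) (V.children (f v.1))

/-- An embedding that is bijective on vertices. -/
structure IsEmbIso (f : Finset A → Finset A') (T : LTree A) (V : LTree A') : Prop
    extends IsEmb f T V where
  cov (v : V.Vertex) : ∃ w : T.Vertex, f w.1 = v.1

/-- Embeddings of two trees whose images form a partition of the set of vertices. -/
structure IsEmbPair (f : Finset A → Finset D) (g : Finset B → Finset D) (T : LTree A) (U : LTree B)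
    (V : LTree D) : Prop where
  left : IsEmb f T V
  right : IsEmb g U V
  disj (v : T.Vertex) (w : U.Vertex) : f v.1 ≠ g w.1
  cov (v : V.Vertex) : (∃ w : T.Vertex, f w.1 = v.1) ∨ ∃ w : U.Vertex, g w.1 = v.1

section Emb

variable {f : Finset A → Finset A'} {T : LTree A} {V : LTree A'}

/-- The image of a vertex under an embedding. -/
def IsEmb.vert (h : IsEmb f T V) (v : T.Vertex) : V.Vertex := ⟨f v.1, h.vertex v⟩

lemma IsEmb.vert_injective (h : IsEmb f T V) : Function.Injective h.vert := fun v w e =>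
  h.inj v w (congrArg Subtype.val e)

/-- The bijection of incoming edges induced by an embedding. -/
noncomputable def IsEmb.inc (h : IsEmb f T V) (v : T.Vertex) : T.inc v ≃ V.inc (h.vert v) :=
  Equiv.ofBijective (fun c => ⟨f c.1, (h.bijOn v).mapsTo c.2⟩)
    ⟨fun c d e => Subtype.ext ((h.bijOn v).injOn c.2 d.2 (congrArg Subtype.val e)), fun x => by
      obtain ⟨c, hc, e⟩ := (h.bijOn v).surjOn x.2
      exact ⟨⟨c, hc⟩, Subtype.ext e⟩⟩

lemma IsEmbIso.perm (h : IsEmbIso f T V) :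
    ((Finset.univ : Finset T.Vertex).toList.map h.vert).Perm Finset.univ.toList := by
  refine (perm_univ ((Finset.nodup_toList _).map h.vert_injective) fun v => ?_).symm
  obtain ⟨w, hw⟩ := h.cov v
  exact List.mem_map.2 ⟨w, by simp, Subtype.ext hw⟩

lemma IsEmbPair.perm {f : Finset A → Finset D} {g : Finset B → Finset D} {T : LTree A}
    {U : LTree B} {V : LTree D} (h : IsEmbPair f g T U V) :
    ((Finset.univ : Finset T.Vertex).toList.map h.left.vert ++
      (Finset.univ : Finset U.Vertex).toList.map h.right.vert).Perm Finset.univ.toList := by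
  refine (perm_univ (List.nodup_append.2 ⟨(Finset.nodup_toList _).map h.left.vert_injective,
    (Finset.nodup_toList _).map h.right.vert_injective, ?_⟩) fun v => ?_).symm
  · intro x hx y hy e
    obtain ⟨v, -, rfl⟩ := List.mem_map.1 hx
    obtain ⟨w, -, rfl⟩ := List.mem_map.1 hy
    exact h.disj v w (congrArg Subtype.val e)
  · rw [List.mem_append, List.mem_map, List.mem_map]
    rcases h.cov v with ⟨w, hw⟩ | ⟨w, hw⟩
    · exact Or.inl ⟨w, by simp, Subtype.ext hw⟩
    · exact Or.inr ⟨w, by simp, Subtype.ext hw⟩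

lemma IsEmbPair.symm {f : Finset A → Finset D} {g : Finset B → Finset D} {T : LTree A}
    {U : LTree B} {V : LTree D} (h : IsEmbPair f g T U V) : IsEmbPair g f U T V :=
  ⟨h.right, h.left, fun v w e => h.disj w v e.symm, fun v => (h.cov v).symm⟩

lemma IsEmb.comp {f' : Finset A' → Finset D} {W : LTree D} (h : IsEmb f T V) (h' : IsEmb f' V W) :
    IsEmb (f' ∘ f) T W where
  vertex v := h'.vertex (h.vert v)
  inj v w e := h.vert_injective (h'.inj (h.vert v) (h.vert w) e)
  bijOn v := (h'.bijOn (h.vert v)).comp (h.bijOn v)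

lemma IsEmbPair.comp {f : Finset A → Finset D} {g : Finset B → Finset D} {T : LTree A}
    {U : LTree B} {V : LTree D} (h : IsEmbPair f g T U V) {k : Finset D → Finset B'}
    {W : LTree B'} (hk : IsEmbIso k V W) : IsEmbPair (k ∘ f) (k ∘ g) T U W where
  left := h.left.comp hk.toIsEmb
  right := h.right.comp hk.toIsEmb
  disj v w e := h.disj v w (congrArg Subtype.val (hk.inj (h.left.vert v) (h.right.vert w) e))
  cov x := by
    obtain ⟨v, hv⟩ := hk.cov x
    rcases h.cov v with ⟨w, hw⟩ | ⟨w, hw⟩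
    · exact Or.inl ⟨w, (congrArg k hw).trans hv⟩
    · exact Or.inr ⟨w, (congrArg k hw).trans hv⟩

lemma isEmb_of_inc (f : Finset A → Finset A') (φ : T.Vertex → V.Vertex)
    (hφ : ∀ v, (φ v).1 = f v.1) (hf : ∀ v w : T.Vertex, f v.1 = f w.1 → v = w)
    (i : ∀ v, T.inc v ≃ V.inc (φ v)) (hi : ∀ v c, (i v c).1 = f c.1) : IsEmb f T V where
  vertex v := hφ v ▸ (φ v).2
  inj := hf
  bijOn v := by
    rw [← hφ v]
    refine ⟨fun c hc => hi v ⟨c, hc⟩ ▸ (i v ⟨c, hc⟩).2, fun c hc d hd e => ?_, fun x hx => ?_⟩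
    · exact congrArg Subtype.val ((i v).injective (Subtype.ext ((hi v ⟨c, hc⟩).trans
        (e.trans (hi v ⟨d, hd⟩).symm))))
    · refine ⟨((i v).symm ⟨x, hx⟩).1, ((i v).symm ⟨x, hx⟩).2, ?_⟩
      exact (hi v _).symm.trans (congrArg Subtype.val
          ((i v).apply_symm_apply (show V.inc (φ v) from ⟨x, hx⟩)))

lemma isEmbIso_relabel (σ : A ≃ A') (h : T.relabel σ = V) :
    IsEmbIso (fun c => c.map σ.toEmbedding) T V := by
  subst h
  refine ⟨isEmb_of_inc _ (relabelVertex σ) (fun _ => rfl)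
    (fun v w e => Subtype.ext (Finset.map_injective _ e)) (relabelInc σ) fun _ _ => rfl,
    fun v => ?_⟩
  obtain ⟨w, -, hw⟩ := List.mem_map.1 ((perm_relabel σ T).mem_iff.1 (Finset.mem_toList.2
    (Finset.mem_univ v)))
  exact ⟨w, congrArg Subtype.val hw⟩

lemma isEmbPair_graft {U : LTree B} {a : A} {V : LTree (NFin.ins A a B)} (h : V = T.graft a U) :
    IsEmbPair (lowerCluster a B) (upperCluster a) T U V := by
  subst h
  refine ⟨isEmb_of_inc _ (lowerVertex a U) (fun _ => rfl)
      (fun v w e => Subtype.ext (lowerCluster_injective a e)) (lowerInc a U) fun _ _ => rfl,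
    isEmb_of_inc _ (upperVertex a T) (fun _ => rfl)
      (fun v w e => Subtype.ext (upperCluster_injective a e)) (upperInc a T) fun _ _ => rfl,
    fun v w => lowerVertex_ne v w.1, fun v => ?_⟩
  rcases vertex_graft_cases v with ⟨w, rfl⟩ | ⟨w, rfl⟩
  · exact Or.inl ⟨w, rfl⟩
  · exact Or.inr ⟨w, rfl⟩

lemma isEmb_of_isEmpty [IsEmpty T.Vertex] (f : Finset A → Finset A') : IsEmb f T V :=
  ⟨fun v => isEmptyElim v, fun v => isEmptyElim v, fun v => isEmptyElim v⟩

end Emb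

end LTree

section EmbMaps

open LTree

variable {C : Type u} [Category.{v} C] [MonoidalCategory C] [SymmetricCategory C] (P : Operad C)
variable {A A' B B' D E : NFin}

instance isIso_operadMap (σ : A ≃ A') : IsIso (P.map σ) :=
  ⟨P.map σ.symm, by rw [← P.map_trans, Equiv.self_trans_symm, P.map_refl],
    by rw [← P.map_trans, Equiv.symm_trans_self, P.map_refl]⟩

section
variable {T : LTree A} {U : LTree B} {V : LTree D} {f : Finset A → Finset D}
  {g : Finset B → Finset D}

/-- The map `P_A(T) ⟶ P_D(V)` induced by an embedding that is bijective on vertices. -/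
noncomputable def embMap (h : IsEmbIso f T V) : PA P T ⟶ PA P V :=
  permMap (X := fun v : T.Vertex => P.obj (T.inc v)) (Y := fun v : V.Vertex => P.obj (V.inc v))
    h.vert (fun v => P.map (h.inc v)) Finset.univ.toList Finset.univ.toList h.perm

/-- The map `P_A(T) ⊗ P_B(U) ⟶ P_D(V)` induced by embeddings that partition the vertices. -/
noncomputable def pairEmbMap (h : IsEmbPair f g T U V) : PA P T ⊗ PA P U ⟶ PA P V :=
  pairMap (X := fun v : T.Vertex => P.obj (T.inc v)) (Y := fun v : U.Vertex => P.obj (U.inc v))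
    (Z := fun v : V.Vertex => P.obj (V.inc v)) h.left.vert (fun v => P.map (h.left.inc v))
    Finset.univ.toList h.right.vert (fun v => P.map (h.right.inc v)) Finset.univ.toList
    Finset.univ.toList h.perm

instance (h : IsEmbPair f g T U V) : IsIso (pairEmbMap P h) := isIso_pairMap _ _ _ _ _ _ _ _

end

section Ext

variable {ι κ ν : Type} {V : LTree D} (N : ι → NFin) (M : κ → NFin) (K : ν → NFin)

/-- The operad maps in a permuted tensor product over the vertices may be compared on underlying
clusters, although the types of the incoming edges depend on the vertices. -/
lemma permMap_ext {φ φ' : ι → V.Vertex} {f : ∀ i, N i ≃ V.inc (φ i)} {f' : ∀ i, N i ≃ V.inc (φ' i)}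
    (hφ : ∀ i, (φ i).1 = (φ' i).1) (hf : ∀ i x, (f i x).1 = (f' i x).1) (l : List ι)
    (n : List V.Vertex) (h : (l.map φ).Perm n) :
    permMap (X := fun i => P.obj (N i)) (Y := fun v : V.Vertex => P.obj (V.inc v)) φ
        (fun i => P.map (f i)) l n h =
      permMap φ' (fun i => P.map (f' i)) l n
        ((funext fun i => Subtype.ext (hφ i) : φ = φ') ▸ h) := by
  obtain rfl : φ = φ' := funext fun i => Subtype.ext (hφ i)
  obtain rfl : f = f' := funext fun i => Equiv.ext fun x => Subtype.ext (hf i x)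
  rfl

lemma pairMap_ext {φ φ' : ι → V.Vertex} {f : ∀ i, N i ≃ V.inc (φ i)} {f' : ∀ i, N i ≃ V.inc (φ' i)}
    (hφ : ∀ i, (φ i).1 = (φ' i).1) (hf : ∀ i x, (f i x).1 = (f' i x).1) (l : List ι)
    {ψ ψ' : κ → V.Vertex} {g : ∀ i, M i ≃ V.inc (ψ i)} {g' : ∀ i, M i ≃ V.inc (ψ' i)}
    (hψ : ∀ i, (ψ i).1 = (ψ' i).1) (hg : ∀ i x, (g i x).1 = (g' i x).1) (l' : List κ)
    (n : List V.Vertex) (h : (l.map φ ++ l'.map ψ).Perm n) :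
    pairMap (X := fun i => P.obj (N i)) (Y := fun i => P.obj (M i))
        (Z := fun v : V.Vertex => P.obj (V.inc v)) φ
        (fun i => P.map (f i)) l ψ (fun i => P.map (g i)) l' n h =
      pairMap φ' (fun i => P.map (f' i)) l ψ' (fun i => P.map (g' i)) l' n
        ((funext fun i => Subtype.ext (hφ i) : φ = φ') ▸
          (funext fun i => Subtype.ext (hψ i) : ψ = ψ') ▸ h) := by
  obtain rfl : φ = φ' := funext fun i => Subtype.ext (hφ i)
  obtain rfl : f = f' := funext fun i => Equiv.ext fun x => Subtype.ext (hf i x)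
  obtain rfl : ψ = ψ' := funext fun i => Subtype.ext (hψ i)
  obtain rfl : g = g' := funext fun i => Equiv.ext fun x => Subtype.ext (hg i x)
  rfl

lemma tripleMap_ext {φ φ' : ι → V.Vertex} {f : ∀ i, N i ≃ V.inc (φ i)}
    {f' : ∀ i, N i ≃ V.inc (φ' i)}
    (hφ : ∀ i, (φ i).1 = (φ' i).1) (hf : ∀ i x, (f i x).1 = (f' i x).1) (l : List ι)
    {ψ ψ' : κ → V.Vertex} {g : ∀ i, M i ≃ V.inc (ψ i)} {g' : ∀ i, M i ≃ V.inc (ψ' i)}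
    (hψ : ∀ i, (ψ i).1 = (ψ' i).1) (hg : ∀ i x, (g i x).1 = (g' i x).1) (l' : List κ)
    {χ χ' : ν → V.Vertex} {k : ∀ i, K i ≃ V.inc (χ i)} {k' : ∀ i, K i ≃ V.inc (χ' i)}
    (hχ : ∀ i, (χ i).1 = (χ' i).1) (hk : ∀ i x, (k i x).1 = (k' i x).1) (l'' : List ν)
    (n : List V.Vertex) (h : (l.map φ ++ l'.map ψ ++ l''.map χ).Perm n) :
    tripleMap (X := fun i => P.obj (N i)) (Y := fun i => P.obj (M i)) (W := fun i => P.obj (K i))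
        (Z := fun v : V.Vertex => P.obj (V.inc v)) φ
        (fun i => P.map (f i)) l ψ (fun i => P.map (g i)) l' χ (fun i => P.map (k i)) l'' n h =
      tripleMap φ' (fun i => P.map (f' i)) l ψ' (fun i => P.map (g' i)) l' χ'
        (fun i => P.map (k' i)) l'' n ((funext fun i => Subtype.ext (hφ i) : φ = φ') ▸
          (funext fun i => Subtype.ext (hψ i) : ψ = ψ') ▸
          (funext fun i => Subtype.ext (hχ i) : χ = χ') ▸ h) := by
  obtain rfl : φ = φ' := funext fun i => Subtype.ext (hφ i)
  obtain rfl : f = f' := funext fun i => Equiv.ext fun x => Subtype.ext (hf i x)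
  obtain rfl : ψ = ψ' := funext fun i => Subtype.ext (hψ i)
  obtain rfl : g = g' := funext fun i => Equiv.ext fun x => Subtype.ext (hg i x)
  obtain rfl : χ = χ' := funext fun i => Subtype.ext (hχ i)
  obtain rfl : k = k' := funext fun i => Equiv.ext fun x => Subtype.ext (hk i x)
  rfl

end Ext

section Comp

variable {T : LTree A} {U : LTree B} {V : LTree D} {W : LTree E}

lemma embMap_comp {f : Finset A → Finset D} {g : Finset D → Finset E} {k : Finset A → Finset E}
    (hf : IsEmbIso f T V) (hg : IsEmbIso g V W) (hk : IsEmbIso k T W) (h : ∀ c, g (f c) = k c) :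
    embMap P hf ≫ embMap P hg = embMap P hk := by
  refine (permMap_comp _ _ _ hg.vert_injective _ _ _ _ _ _).trans ?_
  simp only [← P.map_trans]
  exact permMap_ext P T.inc (fun v => h v.1) (fun v c => h c.1) _ _ _

lemma embMap_eq_id {f : Finset A → Finset A} (hf : IsEmbIso f T T) (h : ∀ c, f c = c) :
    embMap P hf = 𝟙 _ := by
  have h1 : embMap P hf = permMap id (fun v => P.map (Equiv.refl (T.inc v))) _ _
      (List.map_id _ ▸ List.Perm.refl _) :=
    permMap_ext P T.inc (fun v => h v.1) (fun v c => h c.1) _ _ _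
  rw [h1]
  simp only [P.map_refl]
  exact (permMap_id _ _ _).trans (reorder_self _ _ _)

lemma pairEmbMap_embMap {f : Finset A → Finset D} {g : Finset B → Finset D}
    {k : Finset D → Finset E} {f' : Finset A → Finset E} {g' : Finset B → Finset E}
    (h : IsEmbPair f g T U V) (hk : IsEmbIso k V W) (h' : IsEmbPair f' g' T U W)
    (hf : ∀ c, k (f c) = f' c) (hg : ∀ c, k (g c) = g' c) :
    pairEmbMap P h ≫ embMap P hk = pairEmbMap P h' := by
  refine (pairMap_permMap _ _ _ _ _ _ _ _ _ hk.vert_injective _ _ _).trans ?_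
  simp only [← P.map_trans]
  exact pairMap_ext P T.inc U.inc (fun v => hf v.1) (fun v c => hf c.1) _ (fun v => hg v.1)
    (fun v c => hg c.1) _ _ _

lemma embMap_pairEmbMap {T' : LTree A'} {U' : LTree B'} {a : Finset A → Finset A'}
    {b : Finset B → Finset B'} {f : Finset A' → Finset D} {g : Finset B' → Finset D}
    {f' : Finset A → Finset D} {g' : Finset B → Finset D} (ha : IsEmbIso a T T')
    (hb : IsEmbIso b U U') (h : IsEmbPair f g T' U' V) (h' : IsEmbPair f' g' T U V)
    (hf : ∀ c, f (a c) = f' c) (hg : ∀ c, g (b c) = g' c) :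
    (embMap P ha ⊗ₘ embMap P hb) ≫ pairEmbMap P h = pairEmbMap P h' := by
  refine (permMap_pairMap _ h.left.vert_injective _ _ _ h.right.vert_injective _ _ _ _ _ _ _ _ _
    _ _ _).trans ?_
  simp only [← P.map_trans]
  exact pairMap_ext P T.inc U.inc (fun v => hf v.1) (fun v c => hf c.1) _ (fun v => hg v.1)
    (fun v c => hg c.1) _ _ _

lemma pairEmbMap_symm {f : Finset A → Finset D} {g : Finset B → Finset D}
    (h : IsEmbPair f g T U V) :
    (β_ _ _).hom ≫ pairEmbMap P h = pairEmbMap P h.symm :=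
  pairMap_comm _ _ _ _ _ _ _ _ (Finset.nodup_toList _)

lemma pairEmbMap_of_isEmpty_left [IsEmpty T.Vertex] {f : Finset A → Finset D}
    {g : Finset B → Finset D} (h : IsEmbPair f g T U V) (hg : IsEmbIso g U V) (i : PA P T ⟶ 𝟙_ C)
    (hi : i = eqToHom (by rw [PA, bigTensor, Finset.univ_eq_empty, Finset.toList_empty]; rfl)) :
    pairEmbMap P h = i ▷ _ ≫ (λ_ _).hom ≫ embMap P hg := by
  have key : ∀ (l : List T.Vertex) (hl : l = []) (h1) (h2), pairMap
      (X := fun v : T.Vertex => P.obj (T.inc v)) (Y := fun v : U.Vertex => P.obj (U.inc v))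
    (Z := fun v : V.Vertex => P.obj (V.inc v)) h.left.vert (fun v => P.map (h.left.inc v))
    l h.right.vert (fun v => P.map (h.right.inc v)) Finset.univ.toList
    Finset.univ.toList h1 = eqToHom h2 ▷ _ ≫ (λ_ _).hom ≫ embMap P hg := by
    rintro l rfl h1 h2
    have e : 𝟙 (𝟙_ C) ▷ PA P U ≫ (λ_ _).hom ≫ embMap P hg = (λ_ _).hom ≫ embMap P hg := by simp
    exact (pairMap_nil_left _ _ _ _ _ _ hg.perm).trans e.symm
  subst hi
  exact key _ (by rw [Finset.univ_eq_empty, Finset.toList_empty]) _ _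

lemma pairEmbMap_of_isEmpty_right [IsEmpty U.Vertex] {f : Finset A → Finset D}
    {g : Finset B → Finset D} (h : IsEmbPair f g T U V) (hf : IsEmbIso f T V) (i : PA P U ⟶ 𝟙_ C)
    (hi : i = eqToHom (by rw [PA, bigTensor, Finset.univ_eq_empty, Finset.toList_empty]; rfl)) :
    pairEmbMap P h = _ ◁ i ≫ (ρ_ _).hom ≫ embMap P hf := by
  have key : ∀ (l : List U.Vertex) (hl : l = []) (h1) (h2), pairMap
      (X := fun v : T.Vertex => P.obj (T.inc v)) (Y := fun v : U.Vertex => P.obj (U.inc v))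
    (Z := fun v : V.Vertex => P.obj (V.inc v)) h.left.vert (fun v => P.map (h.left.inc v))
    Finset.univ.toList h.right.vert (fun v => P.map (h.right.inc v)) l
    Finset.univ.toList h1 = _ ◁ eqToHom h2 ≫ (ρ_ _).hom ≫ embMap P hf := by
    rintro l rfl h1 h2
    have e : PA P T ◁ 𝟙 (𝟙_ C) ≫ (ρ_ _).hom ≫ embMap P hf = (ρ_ _).hom ≫ embMap P hf := by simp
    exact (pairMap_nil_right _ _ _ _ _ _ hf.perm).trans e.symm
  subst hi
  exact key _ (by rw [Finset.univ_eq_empty, Finset.toList_empty]) _ _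

variable {Q : LTree B'} {V₁ : LTree A'} {V₂ : LTree E}

/-- Both ways of combining three trees amount to the same map. -/
lemma pairEmbMap_assoc {W : LTree D} {f : Finset A → Finset A'} {g : Finset B → Finset A'}
    {w : Finset A' → Finset D}
    {k : Finset B' → Finset D} {g' : Finset B → Finset E} {k' : Finset B' → Finset E}
    {f' : Finset A → Finset D} {w' : Finset E → Finset D}
    (h₁ : IsEmbPair f g T U V₁) (h₂ : IsEmbPair w k V₁ Q W) (h₃ : IsEmbPair g' k' U Q V₂)
    (h₄ : IsEmbPair f' w' T V₂ W) (hf : ∀ c, w (f c) = f' c) (hg : ∀ c, w (g c) = w' (g' c))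
    (hk : ∀ c, k c = w' (k' c)) :
    pairEmbMap P h₁ ▷ _ ≫ pairEmbMap P h₂ =
      (α_ _ _ _).hom ≫ _ ◁ pairEmbMap P h₃ ≫ pairEmbMap P h₄ := by
  refine (pairMap_whiskerRight _ _ _ _ _ _ _ _ _ h₂.left.vert_injective _ _ _ _ _ _).trans
    (Eq.trans ?_ (whiskerLeft_pairMap _ _ _ _ _ _ _ _ _ h₄.right.vert_injective _ _ _ _ _ _).symm)
  simp only [← P.map_trans]
  exact tripleMap_ext P T.inc U.inc Q.inc (fun v => hf v.1) (fun v c => hf c.1) _ (fun v => hg v.1)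
    (fun v c => hg c.1) _ (fun v => hk v.1) (fun v c => hk c.1) _ _ _

lemma pairEmbMap_right_comm {W : LTree D} {f : Finset A → Finset A'} {g : Finset B → Finset A'}
    {w : Finset A' → Finset D}
    {k : Finset B' → Finset D} {f' : Finset A → Finset E} {k' : Finset B' → Finset E}
    {w' : Finset E → Finset D} {g' : Finset B → Finset D}
    (h₁ : IsEmbPair f g T U V₁) (h₂ : IsEmbPair w k V₁ Q W) (h₃ : IsEmbPair f' k' T Q V₂)
    (h₄ : IsEmbPair w' g' V₂ U W) (hf : ∀ c, w (f c) = w' (f' c)) (hg : ∀ c, w (g c) = g' c)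
    (hk : ∀ c, k c = w' (k' c)) :
    pairEmbMap P h₁ ▷ _ ≫ pairEmbMap P h₂ =
      (α_ _ _ _).hom ≫ _ ◁ (β_ _ _).hom ≫ (α_ _ _ _).inv ≫
        pairEmbMap P h₃ ▷ _ ≫ pairEmbMap P h₄ := by
  have h1 := pairMap_whiskerRight (X := fun v : T.Vertex => P.obj (T.inc v))
    (Y := fun v : Q.Vertex => P.obj (Q.inc v)) (Z := fun v : V₂.Vertex => P.obj (V₂.inc v))
    (W := fun v : U.Vertex => P.obj (U.inc v)) (V := fun v : W.Vertex => P.obj (W.inc v))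
        h₃.left.vert (fun v => P.map (h₃.left.inc v))
    Finset.univ.toList h₃.right.vert (fun v => P.map (h₃.right.inc v)) Finset.univ.toList
    Finset.univ.toList h₃.perm _ h₄.left.vert_injective (fun v => P.map (h₄.left.inc v))
    h₄.right.vert (fun v => P.map (h₄.right.inc v)) Finset.univ.toList _ h₄.perm
  refine (pairMap_whiskerRight _ _ _ _ _ _ _ _ _ h₂.left.vert_injective _ _ _ _ _ _).trans
    (Eq.trans ?_ (congrArg (fun x => (α_ _ _ _).hom ≫ _ ◁ (β_ _ _).hom ≫ (α_ _ _ _).inv ≫ x)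
      h1).symm)
  refine Eq.trans ?_ (tripleMap_comm _ _ _ _ _ _ _ _ _ _ _ (Finset.nodup_toList _)).symm
  simp only [← P.map_trans]
  exact tripleMap_ext P T.inc U.inc Q.inc (fun v => hf v.1) (fun v c => hf c.1) _ (fun v => hg v.1)
    (fun v c => hg c.1) _ (fun v => hk v.1) (fun v c => hk c.1) _ _ _

end Comp

end EmbMaps

/-! ### Edge collapse and embeddings -/

section ContractMaps

set_option linter.unusedSectionVars false

variable {C : Type u} [Category.{v} C] [MonoidalCategory C] [SymmetricCategory C]

section Generic

variable {ι κ ω : Type} {X : ι → C} {Y : κ → C}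

/-- The tensor product over a one-element list. -/
def singleIso (X : ι → C) (i : ι) : listTensor X [i] ≅ X i := ρ_ (X i)

/-- A binary operation on two of the factors, as a map of tensor products over lists. -/
def mergeFactors {i j : ι} {k : κ} (q : X i ⊗ X j ⟶ Y k) :
    listTensor X [i, j] ⟶ listTensor Y [k] :=
  (consIso X i [j]).hom ≫ X i ◁ (singleIso X j).hom ≫ q ≫ (singleIso Y k).inv

lemma listMap_id_comp (φ : ω → ι) (l : List ω) (χ : ω → κ) (g : ∀ x, X (φ x) ⟶ Y (χ x)) :
    listMap (X := fun x => X (φ x)) φ (fun x => 𝟙 (X (φ x))) l ≫ listTensorMap φ χ g l =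
      listMap (X := fun x => X (φ x)) χ g l :=
  (listMap_comp_listTensorMap _ _ _ _ _).trans (by simp only [Category.id_comp])

lemma pairMap_id_left (X : ι → C) (l : List ι) (φ : ω → ι) {W : ω → C} (g : ∀ x, W x ⟶ X (φ x))
    (O : List ω) (m : List ι) (h : (l ++ O.map φ).Perm m) :
    pairMap (Z := X) id (fun i => 𝟙 (X i)) l φ g O m ((List.map_id l).symm ▸ h) =
      listTensor X l ◁ listMap φ g O ≫ joinList X (O.map φ) l ≫ reorder X _ _ h := by
  have e : permMap (X := X) id (fun i => 𝟙 (X i)) l l ((List.map_id l).symm ▸ List.Perm.refl l) =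
      𝟙 _ := (permMap_id _ _ _).trans (reorder_self _ _ _)
  have e' : ∀ (l' : List ι) (hl : l = l') (b : listTensor X l ⟶ listTensor X l')
      (_ : b ≫ reorder X l' l (hl ▸ List.Perm.refl l) = 𝟙 _) (h' : (l' ++ O.map φ).Perm m),
      (b ⊗ₘ listMap φ g O) ≫ joinList X (O.map φ) l' ≫ reorder X _ _ h' =
        listTensor X l ◁ listMap φ g O ≫ joinList X (O.map φ) l ≫ reorder X _ _ h := by
    rintro l' rfl b hb h'
    rw [reorder_self, Category.comp_id] at hb
    rw [hb, id_tensorHom]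
  exact e' _ (List.map_id l).symm _ e _

lemma joinList_singleton (i : ι) (l : List ι) :
    joinList X l [i] = (singleIso X i).hom ▷ listTensor X l ≫ (consIso X i l).inv := by
  have h : (ρ_ (X i)).hom ▷ listTensor X l = (α_ _ _ _).hom ≫ X i ◁ (λ_ _).hom := by simp
  have h' : (𝟙 (X i ⊗ 𝟙_ C)) ▷ listTensor X l ≫ (α_ _ _ _).hom ≫ X i ◁ (λ_ _).hom ≫
      (consIso X i l).inv = (ρ_ (X i)).hom ▷ listTensor X l ≫ (consIso X i l).inv := by
    rw [h]
    simp
  exact h'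

lemma joinList_pair (i j : ι) (l : List ι) :
    joinList X l [i, j] ≫ (consIso X i (j :: l)).hom ≫ X i ◁ (consIso X j l).hom ≫
        (α_ _ _ _).inv =
      ((consIso X i [j]).hom ≫ X i ◁ (singleIso X j).hom) ▷ listTensor X l := by
  have h : joinList X l [i, j] = (consIso X i [j]).hom ▷ _ ≫ (α_ _ _ _).hom ≫
      X i ◁ joinList X l [j] ≫ (consIso X i (j :: l)).inv := rfl
  rw [h, joinList_singleton]
  simp

lemma pairMap_mergeFactors {i j : ι} {k : κ} (q : X i ⊗ X j ⟶ Y k) (φ : ω → ι) (χ : ω → κ)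
    (g : ∀ x, X (φ x) ⟶ Y (χ x)) (O : List ω) (l : List ι) (h : l.Perm (i :: j :: O.map φ))
    (m : List κ) (h' : (k :: O.map χ).Perm m) :
    pairMap (Z := X) id (fun i => 𝟙 (X i)) [i, j] φ (fun x => 𝟙 (X (φ x))) O l h.symm ≫
        reorder X _ _ h ≫ (consIso X i (j :: O.map φ)).hom ≫ X i ◁ (consIso X j (O.map φ)).hom ≫
        (α_ _ _ _).inv ≫ (q ⊗ₘ listTensorMap φ χ g O) ≫ (consIso Y k (O.map χ)).inv ≫
        reorder Y _ _ h' =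
      (mergeFactors q ⊗ₘ 𝟙 _) ≫ pairMap (Z := Y) id (fun i => 𝟙 (Y i)) [k] χ g O m h' := by
  have e0 : ∀ h1, pairMap (Z := X) id (fun i => 𝟙 (X i)) [i, j] φ (fun x => 𝟙 (X (φ x))) O l h1 =
      _ := fun h1 => pairMap_id_left X [i, j] φ (fun x => 𝟙 (X (φ x))) O l h1
  have e0' : ∀ h1, pairMap (Z := Y) id (fun i => 𝟙 (Y i)) [k] χ g O m h1 =
      _ := fun h1 => pairMap_id_left Y [k] χ g O m h1
  rw [e0, e0', ← listMap_id_comp φ O χ g]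
  have e1 : ∀ h1, reorder X ([i, j] ++ O.map φ) l h1 ≫ reorder X _ _ h = 𝟙 _ :=
    fun h1 => (reorder_trans _ _ _ _ _ _).trans (reorder_self _ _ _)
  have e1' : ∀ h1, reorder Y ([k] ++ O.map χ) m h1 = reorder Y (k :: O.map χ) m h' := fun _ => rfl
  have e2 := joinList_pair (X := X) i j (O.map φ)
  simp only [Category.assoc]
  rw [e1', joinList_singleton, reassoc_of% e1]
  have e3 : joinList X (O.map φ) [i, j] ≫ (consIso X i (j :: O.map φ)).hom ≫
      X i ◁ (consIso X j (O.map φ)).hom ≫ (α_ _ _ _).inv ≫ (q ⊗ₘ listTensorMap φ χ g O) ≫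
        (consIso Y k (O.map χ)).inv ≫ reorder Y _ _ h' =
      ((consIso X i [j]).hom ≫ X i ◁ (singleIso X j).hom) ▷ _ ≫ (q ⊗ₘ listTensorMap φ χ g O) ≫
        (consIso Y k (O.map χ)).inv ≫ reorder Y _ _ h' := by
    rw [← e2]
    simp only [Category.assoc]
  refine (congrArg (fun z => listTensor X [i, j] ◁ listMap φ (fun x => 𝟙 (X (φ x))) O ≫ z)
    e3).trans ?_
  simp only [mergeFactors, MonoidalCategory.tensorHom_def, comp_whiskerRight, Category.assoc,
    whiskerLeft_comp, whiskerLeft_id, Category.id_comp]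
  simp only [whisker_exchange_assoc, inv_hom_whiskerRight_assoc]

end Generic

open LTree

variable (P : Operad C) {A A' B D : NFin}

lemma mergeFactors_listMap {ι κ ι' κ' : Type} {X : ι → C} {Y : κ → C} {X' : ι' → C} {Y' : κ' → C}
    {i j : ι} {k : κ} (q : X i ⊗ X j ⟶ Y k) (φ : ι → ι') (f : ∀ i, X i ⟶ X' (φ i)) (ψ : κ → κ')
    (g : ∀ i, Y i ⟶ Y' (ψ i)) (q' : X' (φ i) ⊗ X' (φ j) ⟶ Y' (ψ k))
    (h : (f i ⊗ₘ f j) ≫ q' = q ≫ g k) :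
    listMap φ f [i, j] ≫ mergeFactors q' = mergeFactors q ≫ listMap ψ g [k] := by
  have h1 : ∀ {ι κ : Type} {X : ι → C} {Y : κ → C} (φ : ι → κ) (f : ∀ i, X i ⟶ Y (φ i)) (i : ι),
      listMap φ f [i] = (singleIso X i).hom ≫ f i ≫ (singleIso Y (φ i)).inv := by
    intro ι κ X Y φ f i
    have h2 : 𝟙 (X i ⊗ 𝟙_ C) ≫ (f i ⊗ₘ 𝟙 _) ≫ 𝟙 (Y (φ i) ⊗ 𝟙_ C) =
        (ρ_ _).hom ≫ f i ≫ (ρ_ _).inv := by simp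
    exact h2
  rw [h1]
  have h3 : listMap φ f [i, j] = (consIso X i [j]).hom ≫ (f i ⊗ₘ listMap φ f [j]) ≫
    (consIso X' (φ i) [φ j]).inv := rfl
  have h4 : mergeFactors q' = (consIso X' (φ i) [φ j]).hom ≫ X' (φ i) ◁ (singleIso X' (φ j)).hom ≫
    q' ≫ (singleIso Y' (ψ k)).inv := rfl
  refine (congrArg₂ (fun x y => x ≫ y) h3 h4).trans ?_
  simp only [mergeFactors, h1, Category.assoc, Iso.inv_hom_id_assoc]
  rw [← reassoc_of% h]
  simp only [MonoidalCategory.tensorHom_def, Category.assoc, whiskerLeft_comp,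
    whiskerLeft_inv_hom_assoc, whisker_exchange_assoc]

lemma tripleMap_ext_of {ι κ ν : Type} {V : LTree D} (N : ι → NFin) (M : κ → NFin) (K : ν → NFin)
    {φ φ' : ι → V.Vertex} {f : ∀ i, P.obj (N i) ⟶ P.obj (V.inc (φ i))}
    {f' : ∀ i, P.obj (N i) ⟶ P.obj (V.inc (φ' i))} (hφ : ∀ i, (φ i).1 = (φ' i).1)
    (hf : ∀ i, ∃ (e : N i ≃ V.inc (φ i)) (e' : N i ≃ V.inc (φ' i)), f i = P.map e ∧
      f' i = P.map e' ∧ ∀ x, (e x).1 = (e' x).1) (l : List ι)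
    {ψ ψ' : κ → V.Vertex} {g : ∀ i, P.obj (M i) ⟶ P.obj (V.inc (ψ i))}
    {g' : ∀ i, P.obj (M i) ⟶ P.obj (V.inc (ψ' i))} (hψ : ∀ i, (ψ i).1 = (ψ' i).1)
    (hg : ∀ i, ∃ (e : M i ≃ V.inc (ψ i)) (e' : M i ≃ V.inc (ψ' i)), g i = P.map e ∧
      g' i = P.map e' ∧ ∀ x, (e x).1 = (e' x).1) (l' : List κ)
    {χ χ' : ν → V.Vertex} {k : ∀ i, P.obj (K i) ⟶ P.obj (V.inc (χ i))}
    {k' : ∀ i, P.obj (K i) ⟶ P.obj (V.inc (χ' i))} (hχ : ∀ i, (χ i).1 = (χ' i).1)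
    (hk : ∀ i, ∃ (e : K i ≃ V.inc (χ i)) (e' : K i ≃ V.inc (χ' i)), k i = P.map e ∧
      k' i = P.map e' ∧ ∀ x, (e x).1 = (e' x).1) (l'' : List ν)
    (n : List V.Vertex) (h : (l.map φ ++ l'.map ψ ++ l''.map χ).Perm n)
    (h' : (l.map φ' ++ l'.map ψ' ++ l''.map χ').Perm n) :
    tripleMap (X := fun i => P.obj (N i)) (Y := fun i => P.obj (M i)) (W := fun i => P.obj (K i))
        (Z := fun v : V.Vertex => P.obj (V.inc v)) φ f l ψ g l' χ k l'' n h =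
      tripleMap φ' f' l ψ' g' l' χ' k' l'' n h' := by
  choose e e' h1 h2 h3 using hf
  choose r r' h4 h5 h6 using hg
  choose s s' h7 h8 h9 using hk
  obtain rfl := funext h1
  obtain rfl := funext h2
  obtain rfl := funext h4
  obtain rfl := funext h5
  obtain rfl := funext h7
  obtain rfl := funext h8
  exact tripleMap_ext P N M K hφ h3 l hψ h6 l' hχ h9 l'' n h

lemma listMap_pairMap {ι κ μ ν : Type} {X : ι → C} {Y : κ → C} {Z : μ → C} {W : ν → C}
    (φ : ι → μ) (hφ : Function.Injective φ) (f : ∀ i, X i ⟶ Z (φ i)) (ψ : κ → μ)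
    (hψ : Function.Injective ψ) (g : ∀ k, Y k ⟶ Z (ψ k)) (m : List κ) (n : List μ)
    (ω : ν → ι) (a : ∀ i, W i ⟶ X (ω i)) (l : List ν)
    (h : ((l.map ω).map φ ++ m.map ψ).Perm n) :
    listMap ω a l ▷ _ ≫ pairMap φ f (l.map ω) ψ g m n h =
      pairMap (φ ∘ ω) (fun i => a i ≫ f (ω i)) l ψ g m n (by rwa [← List.map_map]) := by
  have h1 := permMap_pairMap φ hφ f (l.map ω) ψ hψ g m n h ω a l (List.Perm.refl _) id
    (fun i => 𝟙 (Y i)) m (by simp)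
  rw [permMap_id, reorder_self, permMap_self, tensorHom_id] at h1
  refine h1.trans ?_
  simp only [Category.id_comp]
  rfl

section

variable {T : LTree A} (e : T.InternalEdge)

/-- The product of the objects at the vertices of `T / e` other than the merged one. -/
noncomputable abbrev otherTensor : C :=
  listTensor (fun w : {w : (T.contract e).Vertex // w ≠ merged e} =>
    P.obj (T.inc (contractVertex e w.1))) (otherVertices e)

/-- The partial composition at the edge `e`. -/
noncomputable def edgeCirc : P.obj (T.inc e.lower) ⊗ P.obj (T.inc e.upper) ⟶
    P.obj ((T.contract e).inc (merged e)) :=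
  P.circ (T.inc e.lower) ⟨e.upper.1, e.mem⟩ (T.inc e.upper) ≫ P.map (mergedInc e)

/-- The decomposition of `P(T)` into the factors at the endpoints of an edge and the others. -/
noncomputable def splitEdge :
    listTensor (fun v : T.Vertex => P.obj (T.inc v)) [e.lower, e.upper] ⊗ otherTensor P e ⟶
      PA P T :=
  pairMap (Z := fun v : T.Vertex => P.obj (T.inc v)) id (fun v => 𝟙 (P.obj (T.inc v)))
    [e.lower, e.upper] (fun w : {w : (T.contract e).Vertex // w ≠ merged e} =>
      contractVertex e w.1) (fun w => 𝟙 (P.obj (T.inc (contractVertex e w.1))))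
    (otherVertices e) Finset.univ.toList (perm_contract e).symm

/-- The decomposition of `P(T / e)` into the factor at the merged vertex and the others. -/
noncomputable def splitMerged :
    listTensor (fun v : (T.contract e).Vertex => P.obj ((T.contract e).inc v)) [merged e] ⊗
      otherTensor P e ⟶ PA P (T.contract e) :=
  pairMap (Z := fun v => P.obj ((T.contract e).inc v)) id
    (fun v => 𝟙 (P.obj ((T.contract e).inc v))) [merged e] Subtype.val
    (fun w => P.map (contractInc e w.1 w.2)) (otherVertices e) Finset.univ.toList
    (perm_merged e).symm

instance isIso_splitEdge : IsIso (splitEdge P e) := isIso_pairMap _ _ _ _ _ _ _ _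

/-- In terms of these decompositions, collapsing `e` is the partial composition at `e`. -/
lemma splitEdge_PAContract :
    splitEdge P e ≫ PAContract P e =
      mergeFactors (Y := fun v => P.obj ((T.contract e).inc v)) (edgeCirc P e) ▷ _ ≫
        splitMerged P e := by
  have h := pairMap_mergeFactors (X := fun v : T.Vertex => P.obj (T.inc v))
    (Y := fun v => P.obj ((T.contract e).inc v)) (edgeCirc P e)
    (fun w : {w : (T.contract e).Vertex // w ≠ merged e} => contractVertex e w.1) Subtype.val
    (fun w => P.map (contractInc e w.1 w.2)) (otherVertices e) _ (perm_contract e) _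
    (perm_merged e).symm
  rw [tensorHom_id] at h
  refine Eq.trans ?_ h
  unfold PAContract splitEdge
  rw [reorder_eq, reorder_eq]
  have hl : ∀ {X Y L K Z : C} (x : (X ⊗ Y) ⊗ L ⟶ K) (y : K ⟶ Z),
      (α_ X Y L).inv ≫ x ≫ y = 𝟙 _ ≫ X ◁ 𝟙 _ ≫ (α_ X Y L).inv ≫ x ≫ 𝟙 K ≫ y :=
    fun x y => by simp
  congr 2
  exact hl _ _

variable {e} {U : LTree B} {V : LTree D} {f : Finset A → Finset D} {g : Finset B → Finset D}

/-- The image of an internal edge under an embedding. -/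
def LTree.IsEmb.edge (h : IsEmb f T V) (e : T.InternalEdge) : V.InternalEdge :=
  ⟨h.vert e.lower, h.vert e.upper, (h.bijOn e.lower).mapsTo e.mem⟩

lemma edgeCirc_naturality (h : IsEmb f T V) (h' : IsEmb f (T.contract e) (V.contract (h.edge e))) :
    (P.map (h.inc e.lower) ⊗ₘ P.map (h.inc e.upper)) ≫ edgeCirc P (h.edge e) =
      edgeCirc P e ≫ P.map (h'.inc (merged e)) := by
  have h1 := P.circ_natural (h.inc e.lower) (h.inc e.upper) ⟨e.upper.1, e.mem⟩
  unfold edgeCirc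
  refine (Category.assoc _ _ _).symm.trans ?_
  refine (congrArg (fun x => x ≫ P.map (mergedInc (h.edge e))) h1.symm).trans ?_
  refine (Category.assoc _ _ _).trans (Eq.trans ?_ (Category.assoc _ _ _).symm)
  refine congrArg (fun x => P.circ (T.inc e.lower) ⟨e.upper.1, e.mem⟩ (T.inc e.upper) ≫ x) ?_
  refine (P.map_trans _ _).symm.trans (Eq.trans ?_ (P.map_trans _ _))
  congr 1
  ext x
  rcases x with x | x <;> rfl

lemma contractVertex_injective :
    Function.Injective (contractVertex e) := fun _ _ h =>
  Subtype.ext (congrArg (fun x : T.Vertex => x.1) h)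

lemma contractInc_val (e : T.InternalEdge) (w : (T.contract e).Vertex) (hw : w ≠ merged e)
    (c : T.inc (contractVertex e w)) : (contractInc e w hw c).1 = c.1 :=
  congrArg (fun x : T.inc (contractVertex e w) => x.1) ((contractInc e w hw).symm_apply_apply c)

variable (h : IsEmbPair f g T U V) (h' : IsEmbPair f g (T.contract e) U
    (V.contract (h.left.edge e)))

/-- The left embedding of an edge collapse, on the vertices other than the merged one. -/
def otherVertLeft (w : {w : (T.contract e).Vertex // w ≠ merged e}) :
    {w : (V.contract (h.left.edge e)).Vertex // w ≠ merged (h.left.edge e)} :=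
  ⟨h'.left.vert w.1, fun hw => w.2 (h'.left.vert_injective hw)⟩

/-- The right embedding: its vertices are never the merged one, which lies in the left part. -/
def otherVertRight (u : U.Vertex) :
    {w : (V.contract (h.left.edge e)).Vertex // w ≠ merged (h.left.edge e)} :=
  ⟨h'.right.vert u, fun hw => h'.disj (merged e) u (congrArg Subtype.val hw).symm⟩

lemma perm_others :
    ((otherVertices e).map (otherVertLeft h h') ++
      (Finset.univ : Finset U.Vertex).toList.map (otherVertRight h h')).Perm
        (otherVertices (h.left.edge e)) := by
  refine (perm_univ (List.nodup_append.2 ⟨(Finset.nodup_toList _).map fun v w e => ?_,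
    (Finset.nodup_toList _).map fun v w e => ?_, ?_⟩) fun v => ?_).symm
  · exact Subtype.ext (h'.left.vert_injective (congrArg Subtype.val e))
  · exact h'.right.vert_injective (congrArg Subtype.val e)
  · intro x hx y hy e
    obtain ⟨v, -, rfl⟩ := List.mem_map.1 hx
    obtain ⟨w, -, rfl⟩ := List.mem_map.1 hy
    exact h'.disj v.1 w (congrArg (fun x => x.1.1) e)
  · rw [List.mem_append, List.mem_map, List.mem_map]
    rcases h'.cov v.1 with ⟨w, hw⟩ | ⟨w, hw⟩
    · refine Or.inl ⟨⟨w, ?_⟩, by simp, Subtype.ext (Subtype.ext hw)⟩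
      rintro rfl
      exact v.2 (Subtype.ext hw.symm)
    · exact Or.inr ⟨w, by simp, Subtype.ext (Subtype.ext hw)⟩

/-- The map of the remaining factors induced by embeddings. -/
noncomputable def otherMap : otherTensor P e ⊗ PA P U ⟶ otherTensor P (h.left.edge e) :=
  pairMap (Z := fun w : {w : (V.contract (h.left.edge e)).Vertex // w ≠ merged (h.left.edge e)} =>
      P.obj (V.inc (contractVertex (h.left.edge e) w.1)))
    (otherVertLeft h h') (fun w => P.map (h.left.inc (contractVertex e w.1))) (otherVertices e)
    (otherVertRight h h') (fun u => P.map (h.right.inc u)) Finset.univ.toList _ (perm_others h h')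

/-- The map of the factors at the endpoints of an edge induced by an embedding. -/
noncomputable def edgeMap (h : IsEmb f T V) (e : T.InternalEdge) :
    listTensor (fun v : T.Vertex => P.obj (T.inc v)) [e.lower, e.upper] ⟶
      listTensor (fun v : V.Vertex => P.obj (V.inc v)) [(h.edge e).lower, (h.edge e).upper] :=
  listMap (Y := fun v : V.Vertex => P.obj (V.inc v)) h.vert (fun v => P.map (h.inc v))
    [e.lower, e.upper]

/-- The map of the factors at the merged vertex induced by an embedding. -/
noncomputable def mergedMap (h : IsEmb f T V)
    (h' : IsEmb f (T.contract e) (V.contract (h.edge e))) :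
    listTensor (fun v : (T.contract e).Vertex => P.obj ((T.contract e).inc v)) [merged e] ⟶
      listTensor (fun v : (V.contract (h.edge e)).Vertex => P.obj ((V.contract (h.edge e)).inc v))
        [merged (h.edge e)] :=
  listMap (Y := fun v : (V.contract (h.edge e)).Vertex => P.obj ((V.contract (h.edge e)).inc v))
    h'.vert (fun v => P.map (h'.inc v)) [merged e]

lemma edgeMap_mergeFactors (h : IsEmb f T V)
    (h' : IsEmb f (T.contract e) (V.contract (h.edge e))) :
    edgeMap P h e ≫ mergeFactors (X := fun v : V.Vertex => P.obj (V.inc v))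
        (Y := fun v => P.obj ((V.contract (h.edge e)).inc v)) (edgeCirc P (h.edge e)) =
      mergeFactors (X := fun v : T.Vertex => P.obj (T.inc v))
        (Y := fun v => P.obj ((T.contract e).inc v)) (edgeCirc P e) ≫ mergedMap P h h' :=
  mergeFactors_listMap (X := fun v : T.Vertex => P.obj (T.inc v))
    (Y := fun v => P.obj ((T.contract e).inc v)) (X' := fun v : V.Vertex => P.obj (V.inc v))
    (Y' := fun v : (V.contract (h.edge e)).Vertex => P.obj ((V.contract (h.edge e)).inc v))
    (edgeCirc P e) h.vert (fun v => P.map (h.inc v)) h'.vert (fun v => P.map (h'.inc v))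
    (edgeCirc P (h.edge e)) (edgeCirc_naturality P h h')

lemma splitEdge_naturality :
    splitEdge P e ▷ _ ≫ pairEmbMap P h = (α_ _ _ _).hom ≫ _ ◁ otherMap P h h' ≫
      edgeMap P h.left e ▷ _ ≫ splitEdge P (h.left.edge e) := by
  have h1 : edgeMap P h.left e ▷ _ ≫ splitEdge P (h.left.edge e) = _ :=
    listMap_pairMap (Z := fun v : V.Vertex => P.obj (V.inc v)) id Function.injective_id
        (fun v => 𝟙 (P.obj (V.inc v)))
      (fun w : {w : (V.contract (h.left.edge e)).Vertex // w ≠ merged (h.left.edge e)} =>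
          contractVertex (h.left.edge e) w.1)
      (contractVertex_injective.comp Subtype.val_injective)
      (fun w => 𝟙 (P.obj (V.inc (contractVertex (h.left.edge e) w.1)))) _ _ h.left.vert
      (fun v => P.map (h.left.inc v)) [e.lower, e.upper] (perm_contract (h.left.edge e)).symm
  rw [h1]
  refine (pairMap_whiskerRight _ _ _ _ _ _ _ _ _ h.left.vert_injective _ _ _ _ _ _).trans
    (Eq.trans ?_ (whiskerLeft_pairMap _ _ _ _ _ _ _ _ _ (contractVertex_injective.comp
      Subtype.val_injective) _ _ _ _ _ _).symm)
  simp only [Category.id_comp, Category.comp_id]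
  rfl

lemma splitMerged_naturality :
    splitMerged P e ▷ _ ≫ pairEmbMap P h' = (α_ _ _ _).hom ≫ _ ◁ otherMap P h h' ≫
      mergedMap P h.left h'.left ▷ _ ≫ splitMerged P (h.left.edge e) := by
  have h1 : mergedMap P h.left h'.left ▷ _ ≫ splitMerged P (h.left.edge e) = _ :=
    listMap_pairMap (Z := fun v : (V.contract (h.left.edge e)).Vertex => P.obj ((V.contract
        (h.left.edge e)).inc v)) id Function.injective_id
        (fun v => 𝟙 (P.obj ((V.contract (h.left.edge e)).inc v)))
      (fun w : {w : (V.contract (h.left.edge e)).Vertex // w ≠ merged (h.left.edge e)} => w.1)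
      Subtype.val_injective
      (fun w => P.map (contractInc (h.left.edge e) w.1 w.2)) _ _ h'.left.vert
      (fun v => P.map (h'.left.inc v)) [merged e] (perm_merged (h.left.edge e)).symm
  rw [h1]
  refine (pairMap_whiskerRight _ _ _ _ _ _ _ _ _ h'.left.vert_injective _ _ _ _ _ _).trans
    (Eq.trans ?_ (whiskerLeft_pairMap _ _ _ _ _ _ _ _ _ Subtype.val_injective _ _ _ _ _ _).symm)
  have h2 : ∀ w : {w : (T.contract e).Vertex // w ≠ merged e},
      P.map (contractInc e w.1 w.2) ≫ P.map (h'.left.inc w.1) =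
        P.map ((contractInc e w.1 w.2).trans (h'.left.inc w.1)) := fun w => (P.map_trans _ _).symm
  let c3 : ∀ w : {w : (T.contract e).Vertex // w ≠ merged e}, T.inc (contractVertex e w.1) ≃
      (V.contract (h.left.edge e)).inc (otherVertLeft h h' w).1 :=
    fun w => (h.left.inc (contractVertex e w.1)).trans (contractInc (h.left.edge e)
          (otherVertLeft h h' w).1 (otherVertLeft h h' w).2)
  have h3 : ∀ w : {w : (T.contract e).Vertex // w ≠ merged e},
      P.map (h.left.inc (contractVertex e w.1)) ≫ P.map (contractInc (h.left.edge e)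
          (otherVertLeft h h' w).1 (otherVertLeft h h' w).2) = P.map (c3 w) :=
    fun w => (P.map_trans _ _).symm
  let c4 : ∀ w : U.Vertex, U.inc w ≃
      (V.contract (h.left.edge e)).inc (otherVertRight h h' w).1 :=
    fun w => (h.right.inc w).trans (contractInc (h.left.edge e)
          (otherVertRight h h' w).1 (otherVertRight h h' w).2)
  have h4 : ∀ w : U.Vertex,
      P.map (h.right.inc w) ≫ P.map (contractInc (h.left.edge e)
          (otherVertRight h h' w).1 (otherVertRight h h' w).2) =
        P.map (c4 w) := fun w => (P.map_trans _ _).symm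
  have key := @tripleMap_ext_of C _ _ _ P D _ _ _ (V.contract (h.left.edge e)) (T.contract e).inc
    (fun w : {w : (T.contract e).Vertex // w ≠ merged e} => T.inc (contractVertex e w.1)) U.inc
    (h'.left.vert ∘ id) (id ∘ h'.left.vert)
    (fun v => 𝟙 _ ≫ P.map (h'.left.inc v)) (fun v => P.map (h'.left.inc v) ≫ 𝟙 _) (fun _ => rfl)
    (fun v => ⟨h'.left.inc v, h'.left.inc v, Category.id_comp (P.map (h'.left.inc v)),
      Category.comp_id (P.map (h'.left.inc v)), fun _ => rfl⟩) [merged e]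
    (h'.left.vert ∘ Subtype.val) (Subtype.val ∘ otherVertLeft h h')
    (fun w => P.map (contractInc e w.1 w.2) ≫ P.map (h'.left.inc w.1))
    (fun w => P.map (h.left.inc (contractVertex e w.1)) ≫ P.map (contractInc (h.left.edge e)
          (otherVertLeft h h' w).1 (otherVertLeft h h' w).2)) (fun _ => rfl)
    (fun w => ⟨(contractInc e w.1 w.2).trans (h'.left.inc w.1), c3 w, h2 w, h3 w, fun c =>
      (congrArg f (contractInc_val e w.1 w.2 c)).trans
        (contractInc_val (h.left.edge e) (otherVertLeft h h' w).1 (otherVertLeft h h' w).2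
          (h.left.inc (contractVertex e w.1) c)).symm⟩)
    (otherVertices e) h'.right.vert (Subtype.val ∘ otherVertRight h h')
    (fun u => P.map (h'.right.inc u)) (fun w => P.map (h.right.inc w) ≫
        P.map (contractInc (h.left.edge e)
          (otherVertRight h h' w).1 (otherVertRight h h' w).2)) (fun _ => rfl)
    (fun w => ⟨h'.right.inc w, c4 w, rfl, h4 w, fun c =>
      (contractInc_val (h.left.edge e) (otherVertRight h h' w).1
        (otherVertRight h h' w).2 (h.right.inc w c)).symm⟩) Finset.univ.toList Finset.univ.toList
  exact key _ _

/-- Collapsing an edge of one of two trees. -/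
lemma pairEmbMap_PAContract :
    pairEmbMap P h ≫ PAContract P (h.left.edge e) = PAContract P e ▷ _ ≫ pairEmbMap P h' := by
  have hm := congrArg (fun x => x ▷ otherTensor P (h.left.edge e))
      (edgeMap_mergeFactors P h.left h'.left)
  simp only [comp_whiskerRight] at hm
  rw [← cancel_epi (splitEdge P e ▷ PA P U), ← Category.assoc, splitEdge_naturality P h h',
    ← Category.assoc (splitEdge P e ▷ PA P U), ← comp_whiskerRight, splitEdge_PAContract,
    comp_whiskerRight, Category.assoc (_ ▷ PA P U), splitMerged_naturality P h h']
  simp only [Category.assoc]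
  rw [splitEdge_PAContract, reassoc_of% hm, whisker_exchange_assoc]
  simp

end

end ContractMaps

/-! ### The maps of `P(T)` given by relabelling, grafting and edge collapse -/

section OperadTrees

set_option linter.unusedSectionVars false

open LTree

variable {C : Type u} [Category.{v} C] [MonoidalCategory C] [SymmetricCategory C]
variable (P : Operad C) {A A' A'' B B' D : NFin}

/-- The map `P(T) ⟶ P(T')` for a tree `T'` that is a relabelling of `T`. -/
noncomputable def relabelPA {σ : A ≃ A'} {T : LTree A} {T' : LTree A'} (h : T.relabel σ = T') :
    PA P T ⟶ PA P T' := embMap P (isEmbIso_relabel σ h)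

/-- The isomorphism `P(T) ⊗ P(U) ⟶ P(V)` for a grafting `V` of `U` onto `T`. -/
noncomputable def graftPA {T : LTree A} {a : A} {U : LTree B} {V : LTree (NFin.ins A a B)}
    (h : V = T.graft a U) : PA P T ⊗ PA P U ⟶ PA P V := pairEmbMap P (isEmbPair_graft h)

instance {T : LTree A} {a : A} {U : LTree B} {V : LTree (NFin.ins A a B)}
    (h : V = T.graft a U) : IsIso (graftPA P h) := inferInstanceAs (IsIso (pairEmbMap P _))

lemma PARelabel_eq (σ : A ≃ A') (T : LTree A) : PARelabel P σ T = relabelPA P (σ := σ) rfl := by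
  unfold PARelabel
  rw [reorder_eq]
  exact (Category.assoc _ _ _).symm.trans
    (congrArg (fun x => x ≫ reorder _ _ _ _) (eqToHom_comp_listTensorMap_id _ _ _ _))

lemma pairEmbMap_comp {T : LTree A} {U : LTree B} {V : LTree D} {W : LTree A'}
    {f : Finset A → Finset D} {g : Finset B → Finset D} {k : Finset D → Finset A'}
    (h : IsEmbPair f g T U V) (hk : IsEmbIso k V W) :
    pairEmbMap P h ≫ embMap P hk = pairEmbMap P (h.comp hk) :=
  pairEmbMap_embMap P h hk _ (fun _ => rfl) fun _ => rfl

lemma LTree.IsEmbPair.isEmbIso_right {T : LTree A} [IsEmpty T.Vertex] {U : LTree B} {V : LTree D}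
    {f : Finset A → Finset D} {g : Finset B → Finset D} (h : IsEmbPair f g T U V) :
    IsEmbIso g U V where
  toIsEmb := h.right
  cov v := (h.cov v).resolve_left fun ⟨w, _⟩ => isEmptyElim w

lemma LTree.IsEmbIso.pair_oneTree {T : LTree A} {V : LTree D} {f : Finset A → Finset D}
    (h : IsEmbIso f T V) : IsEmbPair f (fun _ => ∅) T oneTree V where
  left := h.toIsEmb
  right := isEmb_of_isEmpty _
  disj _ w := isEmptyElim w
  cov v := Or.inl (h.cov v)

lemma listMap_comp_listTensorMap_inv {ι κ : Type} {X : ι → C} {Y : κ → C} (φ : ι → κ)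
    (f : ∀ i, X i ⟶ Y (φ i)) (g : ∀ i, Y (φ i) ⟶ X i) (hfg : ∀ i, f i ≫ g i = 𝟙 _) (l : List ι)
    (h : listTensor X (l.map id) = listTensor X l) :
    listMap φ f l ≫ listTensorMap (Y := X) φ id g l ≫ eqToHom h = 𝟙 _ := by
  have h1 : listMap φ f l ≫ listTensorMap (Y := X) φ id g l = listMap id (fun i => 𝟙 (X i)) l := by
    rw [listMap_comp_listTensorMap]
    exact congrArg (fun f => listMap id f l) (funext hfg)
  rw [← Category.assoc, h1, ← permMap_self, permMap_id,
    eqToHom_eq_reorder (X := X) (List.map_id l), reorder_trans, reorder_self]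

lemma pairMap_comp_inv {ι κ μ : Type} {X : ι → C} {Y : κ → C} {Z : μ → C} (φ : ι → μ)
    (f : ∀ i, X i ⟶ Z (φ i)) (f' : ∀ i, Z (φ i) ⟶ X i) (hf : ∀ i, f i ≫ f' i = 𝟙 _) (l : List ι)
    (ψ : κ → μ) (g : ∀ k, Y k ⟶ Z (ψ k)) (g' : ∀ k, Z (ψ k) ⟶ Y k) (hg : ∀ i, g i ≫ g' i = 𝟙 _)
    (l' : List κ) (n : List μ) (h : n.Perm (l.map φ ++ l'.map ψ))
    (hl : listTensor X (l.map id) = listTensor X l)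
    (hl' : listTensor Y (l'.map id) = listTensor Y l') :
    pairMap φ f l ψ g l' n h.symm ≫ reorder Z _ _ h ≫ listTensorSplit Z _ _ ≫
      ((listTensorMap (Y := X) φ id f' l ≫ eqToHom hl) ⊗ₘ
        (listTensorMap (Y := Y) ψ id g' l' ≫ eqToHom hl')) = 𝟙 _ := by
  unfold pairMap
  simp only [Category.assoc]
  have h1 : reorder Z _ _ h.symm ≫ reorder Z _ _ h = 𝟙 _ :=
    (reorder_trans _ _ _ _ _ _).trans (reorder_self _ _ _)
  have h2 := joinList_listTensorSplit (X := Z) (l.map φ) (l'.map ψ)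
  rw [reassoc_of% h1, reassoc_of% h2, tensorHom_comp_tensorHom,
    listMap_comp_listTensorMap_inv φ f f' hf, listMap_comp_listTensorMap_inv ψ g g' hg,
        id_tensorHom_id]

lemma graftPA_PAUngraft (T : LTree A) (a : A) (U : LTree B) :
    graftPA P (rfl : T.graft a U = _) ≫ PAUngraft P T a U = 𝟙 _ := by
  unfold PAUngraft
  rw [reorder_eq]
  refine pairMap_comp_inv (Z := fun v => P.obj ((T.graft a U).inc v)) (lowerVertex a U)
    (fun v => P.map (lowerInc a U v)) (fun v => P.map (lowerInc a U v).symm) (fun v => ?_) _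
    (upperVertex a T) (fun v => P.map (upperInc a T v)) (fun v => P.map (upperInc a T v).symm)
    (fun v => ?_) _ _ _ _ _
  · rw [← P.map_trans, Equiv.self_trans_symm, P.map_refl]
  · rw [← P.map_trans, Equiv.self_trans_symm, P.map_refl]

lemma PAUngraft_eq (T : LTree A) (a : A) (U : LTree B) :
    PAUngraft P T a U = inv (graftPA P (rfl : T.graft a U = _)) :=
  IsIso.eq_inv_of_hom_inv_id (graftPA_PAUngraft P T a U)

/-! #### Identities -/

lemma relabelPA_refl (T : LTree A) : relabelPA P (relabel_refl T) = 𝟙 _ :=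
  embMap_eq_id P _ fun c => by simp

lemma relabelPA_trans {σ : A ≃ A'} {τ : A' ≃ A''} {T : LTree A} {T' : LTree A'} {T'' : LTree A''}
    (h : T.relabel σ = T') (h' : T'.relabel τ = T'') (h'' : T.relabel (σ.trans τ) = T'') :
    relabelPA P h ≫ relabelPA P h' = relabelPA P h'' :=
  embMap_comp P _ _ _ fun c => by
    rw [Finset.map_map]
    rfl

lemma graftPA_natural {σ : A ≃ A'} {τ : B ≃ B'} {a : A} {T : LTree A} {T' : LTree A'}
    {U : LTree B} {U' : LTree B'} {V : LTree (NFin.ins A a B)} {V' : LTree (NFin.ins A' (σ a) B')}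
    (hT : T.relabel σ = T') (hU : U.relabel τ = U') (hV : V = T.graft a U)
    (hV' : V' = T'.graft (σ a) U') (h : V.relabel (NFin.insCongr σ τ a) = V') :
    graftPA P hV ≫ relabelPA P h = (relabelPA P hT ⊗ₘ relabelPA P hU) ≫ graftPA P hV' := by
  refine (pairEmbMap_comp P _ _).trans (embMap_pairEmbMap P _ _ _ _ (fun c => ?_) fun c => ?_).symm
  · exact (lowerCluster_map_insCongr σ τ a c).symm
  · exact (upperCluster_map_insCongr σ τ a c).symm

lemma graftPA_assoc {a : A} {b : B} {T : LTree A} {U : LTree B} {W : LTree D}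
    {V₁ : LTree (NFin.ins A a B)} {V₂ : LTree (NFin.ins (NFin.ins A a B) (Sum.inr b) D)}
    {V₃ : LTree (NFin.ins B b D)} {V₄ : LTree (NFin.ins A a (NFin.ins B b D))}
    (h₁ : V₁ = T.graft a U) (h₂ : V₂ = V₁.graft (Sum.inr b) W) (h₃ : V₃ = U.graft b W)
    (h₄ : V₄ = T.graft a V₃) (h : V₂.relabel (NFin.insAssoc A a B b D) = V₄) :
    graftPA P h₁ ▷ _ ≫ graftPA P h₂ ≫ relabelPA P h =
      (α_ _ _ _).hom ≫ _ ◁ graftPA P h₃ ≫ graftPA P h₄ := by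
  refine (congrArg (fun x => graftPA P h₁ ▷ _ ≫ x) (pairEmbMap_comp P _ _)).trans ?_
  refine pairEmbMap_assoc P _ _ _ _ (fun c => ?_) (fun c => ?_) fun c => ?_
  · exact lowerCluster_lowerCluster_map_insAssoc a b c
  · exact lowerCluster_upperCluster_map_insAssoc a b c
  · exact upperCluster_map_insAssoc a b c

lemma graftPA_comm {a a' : A} (haa : a ≠ a') {T : LTree A} {U : LTree B} {W : LTree D}
    {V₁ : LTree (NFin.ins A a B)} {V₂ : LTree
        (NFin.ins (NFin.ins A a B) (Sum.inl ⟨a', haa.symm⟩) D)}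
    {V₃ : LTree (NFin.ins A a' D)} {V₄ : LTree (NFin.ins (NFin.ins A a' D) (Sum.inl ⟨a, haa⟩) B)}
    (h₁ : V₁ = T.graft a U) (h₂ : V₂ = V₁.graft (Sum.inl ⟨a', haa.symm⟩) W)
    (h₃ : V₃ = T.graft a' W) (h₄ : V₄ = V₃.graft (Sum.inl ⟨a, haa⟩) U)
    (h : V₂.relabel (NFin.insComm A a a' haa B D) = V₄) :
    graftPA P h₁ ▷ _ ≫ graftPA P h₂ ≫ relabelPA P h =
      (α_ _ _ _).hom ≫ _ ◁ (β_ _ _).hom ≫ (α_ _ _ _).inv ≫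
        graftPA P h₃ ▷ _ ≫ graftPA P h₄ := by
  refine (congrArg (fun x => graftPA P h₁ ▷ _ ≫ x) (pairEmbMap_comp P _ _)).trans ?_
  refine pairEmbMap_right_comm P _ _ _ _ (fun c => ?_) (fun c => ?_) fun c => ?_
  · exact lowerCluster_lowerCluster_map_insComm a a' haa c
  · exact lowerCluster_upperCluster_map_insComm a a' haa c
  · exact upperCluster_map_insComm a a' haa c

instance (T : LTree NFin.one) : IsIso (PAOne P T) := by unfold PAOne; infer_instance

lemma graftPA_one_left {T : LTree NFin.one} {U : LTree A} {W : LTree (NFin.ins NFin.one () A)}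
    (h : W = T.graft () U) (h' : W.relabel (NFin.oneIns A) = U) :
    PAOne P T ▷ _ ≫ graftPA P h ≫ relabelPA P h' = (λ_ _).hom := by
  have hp := (isEmbPair_graft h).comp (isEmbIso_relabel _ h')
  refine (congrArg (fun x => PAOne P T ▷ _ ≫ x) ((pairEmbMap_comp P _ _).trans
    (pairEmbMap_of_isEmpty_left P hp hp.isEmbIso_right (inv (PAOne P T)) ?_))).trans ?_
  · exact inv_eqToHom _
  · rw [embMap_eq_id P _ fun c => upperCluster_map_oneIns c]
    simp

lemma graftPA_one_right {T : LTree A} {a : A} {U : LTree NFin.one}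
    {V : LTree (NFin.ins A a NFin.one)}
    (h : V = T.graft a U) (h' : T.relabel (NFin.insOne A a) = V) :
    _ ◁ PAOne P U ≫ graftPA P h = (ρ_ _).hom ≫ relabelPA P h' := by
  have hp := isEmbPair_graft h
  refine (congrArg (fun x => _ ◁ PAOne P U ≫ x)
    (pairEmbMap_of_isEmpty_right P hp hp.symm.isEmbIso_right (inv (PAOne P U)) ?_)).trans ?_
  · exact inv_eqToHom _
  · have h1 : embMap P hp.symm.isEmbIso_right = relabelPA P h' := by
      refine (Category.id_comp _).symm.trans ?_
      rw [← embMap_eq_id P (isEmbIso_relabel (Equiv.refl A) (relabel_refl T)) fun c => by simp]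
      refine embMap_comp P _ _ _ fun c => ?_
      rw [map_insOne]
      simp
    rw [h1]
    simp

/-! #### Edge collapse -/

lemma relabelPA_PAContract {σ : A ≃ A'} {T : LTree A} {T' : LTree A'} (h : T.relabel σ = T')
    (e : T.InternalEdge) (h' : (T.contract e).relabel σ =
      T'.contract ((isEmbIso_relabel σ h).toIsEmb.edge e)) :
    relabelPA P h ≫ PAContract P ((isEmbIso_relabel σ h).toIsEmb.edge e) =
      PAContract P e ≫ relabelPA P h' := by
  have h1 := (isEmbIso_relabel σ h).pair_oneTree
  have h2 := (isEmbIso_relabel σ h').pair_oneTree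
  have key := pairEmbMap_PAContract P h1 h2
  rw [pairEmbMap_of_isEmpty_right P h1 (isEmbIso_relabel σ h) (inv (PAOne P oneTree))
    (inv_eqToHom _), pairEmbMap_of_isEmpty_right P h2 (isEmbIso_relabel σ h')
    (inv (PAOne P oneTree)) (inv_eqToHom _), ← whisker_exchange_assoc] at key
  simp only [Category.assoc, cancel_epi] at key
  rw [rightUnitor_naturality_assoc, cancel_epi] at key
  exact key

lemma graftPA_PAContract_lower {T : LTree A} {a : A} {U : LTree B} {V : LTree (NFin.ins A a B)}
    (h : V = T.graft a U) (e : T.InternalEdge)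
    (h' : V.contract ((isEmbPair_graft h).left.edge e) = (T.contract e).graft a U) :
    graftPA P h ≫ PAContract P ((isEmbPair_graft h).left.edge e) =
      PAContract P e ▷ _ ≫ graftPA P h' :=
  pairEmbMap_PAContract P _ _

lemma graftPA_PAContract_upper {T : LTree A} {a : A} {U : LTree B} {V : LTree (NFin.ins A a B)}
    (h : V = T.graft a U) (e : U.InternalEdge)
    (h' : V.contract ((isEmbPair_graft h).right.edge e) = T.graft a (U.contract e)) :
    graftPA P h ≫ PAContract P ((isEmbPair_graft h).right.edge e) =
      _ ◁ PAContract P e ≫ graftPA P h' := by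
  have key := pairEmbMap_PAContract P (isEmbPair_graft h).symm (isEmbPair_graft h').symm
  rw [← pairEmbMap_symm P (isEmbPair_graft h), ← pairEmbMap_symm P (isEmbPair_graft h'),
      Category.assoc, braiding_naturality_left_assoc,
    cancel_epi] at key
  exact key

end OperadTrees

/-! ### The maps of spaces of weightings -/

namespace LTree

variable {A A' A'' B B' D : NFin}

lemma wbar_hom_ext {T : LTree A} {Z : TopStar} {f g : T.wbar ⟶ Z}
    (h : ∀ l : T.Weighting, f (wpt l) = g (wpt l)) : f = g := by
  ext x
  refine Quotient.inductionOn x ?_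
  rintro (l | ⟨⟩)
  · exact h l
  · exact f.map_pt.trans g.map_pt.symm

/-- The constant maps to the basepoints are the zero maps of based spaces. -/
instance : HasZeroMorphisms TopStar where
  zero _ Y := ⟨⟨fun _ => Y.pt, continuous_const, rfl⟩⟩
  comp_zero _ _ := rfl
  zero_comp _ _ _ f := TopStar.hom_ext fun _ => f.map_pt

lemma _root_.BarCooperad.TopStar.zero_apply {X Y : TopStar} (x : X) : (0 : X ⟶ Y) x = Y.pt := rfl

@[simp] lemma wbarContract_wpt {T : LTree A} (e : T.InternalEdge) (l : (T.contract e).Weighting) :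
    wbarContract e (wpt l) = wpt (contractWeighting e l) := rfl

/-- Relabelling of a weighting. -/
def relabelW {σ : A ≃ A'} {T : LTree A} {T' : LTree A'} (h : T.relabel σ = T') (l : T.Weighting) :
    T'.Weighting :=
  ⟨fun c => l.len (c.map σ.symm.toEmbedding), by subst h; exact (relabelWeighting σ l).2⟩

@[simp] lemma relabelW_len {σ : A ≃ A'} {T : LTree A} {T' : LTree A'} (h : T.relabel σ = T')
    (l : T.Weighting) (c : Finset A') : (relabelW h l).len c = l.len (c.map σ.symm.toEmbedding) :=
  rfl

lemma relabelW_len_map {σ : A ≃ A'} {T : LTree A} {T' : LTree A'} (h : T.relabel σ = T')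
    (l : T.Weighting) (c : Finset A) : (relabelW h l).len (c.map σ.toEmbedding) = l.len c := by
  rw [relabelW_len, map_symm_map]

/-- The map `w̄(T) ⟶ w̄(T')` for a tree `T'` that is a relabelling of `T`. -/
def relabelWbar {σ : A ≃ A'} {T : LTree A} {T' : LTree A'} (h : T.relabel σ = T') :
    T.wbar ⟶ T'.wbar := T.wbarRelabel σ ≫ eqToHom (congrArg wbar h)

@[simp] lemma relabelWbar_wpt {σ : A ≃ A'} {T : LTree A} {T' : LTree A'} (h : T.relabel σ = T')
    (l : T.Weighting) : relabelWbar h (wpt l) = wpt (relabelW h l) := by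
  subst h
  rfl

lemma relabelWbar_rfl (T : LTree A) (σ : A ≃ A') :
    T.wbarRelabel σ = relabelWbar (σ := σ) (rfl : T.relabel σ = _) := (Category.comp_id _).symm

/-- The ungrafting map `w̄(V) ⟶ w̄(T) ∧ w̄(U)` for a grafting `V` of `U` onto `T`. -/
noncomputable def ungraftWbar {T : LTree A} {a : A} {U : LTree B} {V : LTree (NFin.ins A a B)}
    (h : V = T.graft a U) : V.wbar ⟶ T.wbar ⊗ U.wbar :=
  eqToHom (congrArg wbar h) ≫ wbarUngraft T a U

lemma ungraftWbar_rfl (T : LTree A) (a : A) (U : LTree B) :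
    T.wbarUngraft a U = ungraftWbar (rfl : T.graft a U = _) := (Category.id_comp _).symm

/-- The weighting `l` of the grafting of `U` onto `T` restricts to `t`, and to `m` up to scaling. -/
def Restricts {T : LTree A} {a : A} {U : LTree B} {V : LTree (NFin.ins A a B)} (l : V.Weighting)
    (t : T.Weighting) (m : U.Weighting) : Prop :=
  (∀ c ∈ T.clusters, c ≠ {a} → t.len c = l.len (lowerCluster a B c)) ∧
    ∀ d ∈ U.clusters, l.len (upperCluster a d) = t.len {a} * m.len d

section

variable {T : LTree A} {a : A} {U : LTree B} {V : LTree (NFin.ins A a B)}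

lemma ungraftWbar_wpt (h : V = T.graft a U) {l : V.Weighting} {t : T.Weighting} {m : U.Weighting}
    (hl : Restricts l t m) : ungraftWbar h (wpt l) = TopStar.smk (wpt t) (wpt m) := by
  subst h
  exact keyPoint_of_compatible (p := (l, t, m)) hl

lemma exists_restricts (h : V = T.graft a U) (l : V.Weighting) :
    ∃ (t : T.Weighting) (m : U.Weighting), Restricts l t m := by
  subst h
  exact ⟨_, _, compatible_self l⟩

end

lemma Weighting.eq_of_mul {T : LTree A} {r r' : ℝ} {l l' : T.Weighting}
    (h : ∀ c ∈ T.clusters, r * l.len c = r' * l'.len c) : r = r' ∧ (r ≠ 0 → l = l') := by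
  obtain ⟨x⟩ := A.nonempty
  have hr : r = r' := by
    have h1 := Finset.sum_congr (s₁ := T.clusters.filter (x ∈ ·)) rfl fun c hc =>
      h c (Finset.mem_filter.1 hc).1
    rwa [← Finset.mul_sum, ← Finset.mul_sum, l.sum_eq, l'.sum_eq, mul_one, mul_one] at h1
  exact ⟨hr, fun h0 => Weighting.ext fun c hc => mul_left_cancel₀ h0 (by rw [h c hc, hr])⟩

/-- The lengths of the leaf edges are determined by the other lengths. -/
lemma Weighting.ext_of_ne_singleton {T : LTree A} {l l' : T.Weighting}
    (h : ∀ c ∈ T.clusters, (∀ x, c ≠ {x}) → l.len c = l'.len c) : l = l' := by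
  refine Weighting.ext fun c hc => ?_
  by_cases hcs : ∃ x, c = {x}
  · obtain ⟨x, rfl⟩ := hcs
    have hm : {x} ∈ T.clusters.filter (x ∈ ·) := Finset.mem_filter.2 ⟨hc, by simp⟩
    have h1 := (Finset.add_sum_erase _ l.len hm).trans (l.sum_eq x)
    have h2 := (Finset.add_sum_erase _ l'.len hm).trans (l'.sum_eq x)
    have h3 : ∑ d ∈ (T.clusters.filter (x ∈ ·)).erase {x}, l.len d =
        ∑ d ∈ (T.clusters.filter (x ∈ ·)).erase {x}, l'.len d := by
      refine Finset.sum_congr rfl fun d hd => ?_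
      obtain ⟨hd1, hd2⟩ := Finset.mem_erase.1 hd
      obtain ⟨hd2, hd3⟩ := Finset.mem_filter.1 hd2
      refine h d hd2 fun y hy => hd1 ?_
      subst hy
      rw [Finset.mem_singleton.1 hd3]
    linarith
  · exact h c hc fun x hx => hcs ⟨x, hx⟩

lemma upperCluster_singleton {a : A} (b : B) :
    upperCluster a {b} = ({Sum.inr b} : Finset (NFin.ins A a B)) := by simp [upperCluster]

lemma lowerCluster_singleton_ne {a : A} (x : A) (hx : x ≠ a) :
    lowerCluster a B {x} = ({Sum.inl ⟨x, hx⟩} : Finset (NFin.ins A a B)) := by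
  ext (y | y)
  · rw [inl_mem_lowerCluster, Finset.mem_singleton, Finset.mem_singleton, Sum.inl.injEq,
      Subtype.ext_iff]
  · rw [inr_mem_lowerCluster, Finset.mem_singleton, Finset.mem_singleton]
    simpa using hx.symm

lemma lowerCluster_ne_upperCluster (a : A) (x : {x : A // x ≠ a}) (d : Finset B) :
    lowerCluster a B {x.1} ≠ upperCluster a d := fun h => by
  have h1 : (Sum.inl x : NFin.ins A a B) ∈ lowerCluster a B {x.1} :=
    (inl_mem_lowerCluster _ _ _).2 (Finset.mem_singleton_self _)
  rw [h] at h1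
  exact (inl_mem_upperCluster _ _ _).1 h1

/-! #### Identities -/

lemma relabelWbar_refl (T : LTree A) : relabelWbar (relabel_refl T) = 𝟙 _ :=
  wbar_hom_ext fun l => (relabelWbar_wpt _ _).trans
    (congrArg wpt (Weighting.ext fun c _ => congrArg l.len (by simp)))

lemma relabelWbar_trans {σ : A ≃ A'} {τ : A' ≃ A''} {T : LTree A} {T' : LTree A'} {T'' : LTree A''}
    (h : T.relabel σ = T') (h' : T'.relabel τ = T'') (h'' : T.relabel (σ.trans τ) = T'') :
    relabelWbar h ≫ relabelWbar h' = relabelWbar h'' :=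
  wbar_hom_ext fun l => by
    rw [TopStar.comp_apply, relabelWbar_wpt, relabelWbar_wpt, relabelWbar_wpt]
    refine congrArg wpt (Weighting.ext fun c _ => ?_)
    rw [relabelW_len, relabelW_len, relabelW_len, Finset.map_map]
    rfl

lemma ungraftWbar_natural {σ : A ≃ A'} {τ : B ≃ B'} {a : A} {T : LTree A} {T' : LTree A'}
    {U : LTree B} {U' : LTree B'} {V : LTree (NFin.ins A a B)} {V' : LTree (NFin.ins A' (σ a) B')}
    (hT : T.relabel σ = T') (hU : U.relabel τ = U') (hV : V = T.graft a U)
    (hV' : V' = T'.graft (σ a) U') (h : V.relabel (NFin.insCongr σ τ a) = V') :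
    relabelWbar h ≫ ungraftWbar hV' = ungraftWbar hV ≫ (relabelWbar hT ⊗ₘ relabelWbar hU) := by
  refine wbar_hom_ext fun l => ?_
  obtain ⟨t, m, hl⟩ := exists_restricts hV l
  have hl' : Restricts (relabelW h l) (relabelW hT t) (relabelW hU m) := by
    subst hT hU
    constructor
    · intro c hc hca
      obtain ⟨c, hcT, rfl⟩ := Finset.mem_image.1 hc
      rw [relabelW_len_map, ← lowerCluster_map_insCongr, relabelW_len_map]
      refine hl.1 c hcT ?_
      rintro rfl
      exact hca (by simp)
    · intro d hd
      obtain ⟨d, hdU, rfl⟩ := Finset.mem_image.1 hd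
      rw [relabelW_len_map, ← upperCluster_map_insCongr, relabelW_len_map,
        ← Equiv.coe_toEmbedding, ← Finset.map_singleton, relabelW_len_map]
      exact hl.2 d hdU
  rw [TopStar.comp_apply, relabelWbar_wpt, ungraftWbar_wpt hV' hl', TopStar.comp_apply,
    ungraftWbar_wpt hV hl]
  refine Eq.symm ((TopStar.smashMap_mk _ _ _ _).trans ?_)
  rw [relabelWbar_wpt, relabelWbar_wpt]

lemma wpt_eq_pt_of_leaf {T : LTree A} {l : T.Weighting} {a : A} (h : l.len {a} = 0) :
    wpt l = T.wbar.pt := wpt_eq_pt (Or.inr ⟨a, h⟩)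

lemma ungraftWbar_assoc {a : A} {b : B} {T : LTree A} {U : LTree B} {W : LTree D}
    {V₁ : LTree (NFin.ins A a B)} {V₂ : LTree (NFin.ins (NFin.ins A a B) (Sum.inr b) D)}
    {V₃ : LTree (NFin.ins B b D)} {V₄ : LTree (NFin.ins A a (NFin.ins B b D))}
    (h₁ : V₁ = T.graft a U) (h₂ : V₂ = V₁.graft (Sum.inr b) W) (h₃ : V₃ = U.graft b W)
    (h₄ : V₄ = T.graft a V₃) (h : V₂.relabel (NFin.insAssoc A a B b D) = V₄) :
    ungraftWbar h₂ ≫ ungraftWbar h₁ ▷ _ ≫ (α_ _ _ _).hom =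
      relabelWbar h ≫ ungraftWbar h₄ ≫ _ ◁ ungraftWbar h₃ := by
  refine wbar_hom_ext fun l => ?_
  obtain ⟨k, w, hl⟩ := exists_restricts h₂ l
  obtain ⟨t, m, hk⟩ := exists_restricts h₁ k
  obtain ⟨t', n, hl'⟩ := exists_restricts h₄ (relabelW h l)
  have e1 : (ungraftWbar h₂ ≫ ungraftWbar h₁ ▷ _ ≫ (α_ _ _ _).hom) (wpt l) =
      TopStar.smk (wpt t) (TopStar.smk (wpt m) (wpt w)) := by
    rw [TopStar.comp_apply, ungraftWbar_wpt h₂ hl]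
    change TopStar.assocHom _ _ _ (TopStar.smk (ungraftWbar h₁ (wpt k)) (wpt w)) = _
    rw [ungraftWbar_wpt h₁ hk]
    rfl
  have e2 : (relabelWbar h ≫ ungraftWbar h₄ ≫ _ ◁ ungraftWbar h₃) (wpt l) =
      TopStar.smk (wpt t') (ungraftWbar h₃ (wpt n)) := by
    rw [TopStar.comp_apply, relabelWbar_wpt, TopStar.comp_apply, ungraftWbar_wpt h₄ hl']
    rfl
  rw [e1, e2]
  have ht : t = t' := Weighting.ext_of_ne_singleton fun c hc hcs => by
    rw [hk.1 c hc (hcs a), hl.1 _ (by subst h₁; exact lowerCluster_mem hc) fun h' => hcs a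
      (eq_singleton_of_lowerCluster_eq a (T.nonempty hc)
          (h'.trans (upperCluster_singleton b).symm)),
      hl'.1 c hc (hcs a), ← lowerCluster_lowerCluster_map_insAssoc, relabelW_len_map]
  subst ht
  by_cases h0 : t.len {a} = 0
  · rw [wpt_eq_pt_of_leaf h0]
    exact (TopStar.smk_pt_left _).trans (TopStar.smk_pt_left _).symm
  rw [ungraftWbar_wpt h₃ (t := m) (m := w)]
  constructor
  · intro c hc hcb
    refine mul_left_cancel₀ h0 ?_
    rw [← hk.2 c hc, ← hl'.2 _ (by subst h₃; exact lowerCluster_mem hc),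
      hl.1 _ (by subst h₁; exact upperCluster_mem hc),
      ← lowerCluster_upperCluster_map_insAssoc, relabelW_len_map]
    rintro h'
    exact hcb (upperCluster_injective a (h'.trans (upperCluster_singleton b).symm))
  · intro d hd
    refine mul_left_cancel₀ h0 ?_
    rw [← hl'.2 _ (by subst h₃; exact upperCluster_mem hd), ← upperCluster_map_insAssoc,
      relabelW_len_map, hl.2 d hd, ← mul_assoc, ← hk.2 _ (U.singleton_mem b),
      upperCluster_singleton]

lemma ungraftWbar_comm {a a' : A} (haa : a ≠ a') {T : LTree A} {U : LTree B} {W : LTree D}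
    {V₁ : LTree (NFin.ins A a B)} {V₂ : LTree
        (NFin.ins (NFin.ins A a B) (Sum.inl ⟨a', haa.symm⟩) D)}
    {V₃ : LTree (NFin.ins A a' D)} {V₄ : LTree (NFin.ins (NFin.ins A a' D) (Sum.inl ⟨a, haa⟩) B)}
    (h₁ : V₁ = T.graft a U) (h₂ : V₂ = V₁.graft (Sum.inl ⟨a', haa.symm⟩) W)
    (h₃ : V₃ = T.graft a' W) (h₄ : V₄ = V₃.graft (Sum.inl ⟨a, haa⟩) U)
    (h : V₂.relabel (NFin.insComm A a a' haa B D) = V₄) :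
    ungraftWbar h₂ ≫ ungraftWbar h₁ ▷ _ =
      relabelWbar h ≫ ungraftWbar h₄ ≫ ungraftWbar h₃ ▷ _ ≫ (α_ _ _ _).hom ≫
        _ ◁ (β_ _ _).hom ≫ (α_ _ _ _).inv := by
  refine wbar_hom_ext fun l => ?_
  obtain ⟨k, w, hl⟩ := exists_restricts h₂ l
  obtain ⟨t, m, hk⟩ := exists_restricts h₁ k
  obtain ⟨k', m', hl'⟩ := exists_restricts h₄ (relabelW h l)
  obtain ⟨t', w', hk'⟩ := exists_restricts h₃ k'
  have e1 : (ungraftWbar h₂ ≫ ungraftWbar h₁ ▷ _) (wpt l) =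
      TopStar.smk (TopStar.smk (wpt t) (wpt m)) (wpt w) := by
    rw [TopStar.comp_apply, ungraftWbar_wpt h₂ hl]
    exact congrArg (TopStar.smk · (wpt w)) (ungraftWbar_wpt h₁ hk)
  have e2 : (relabelWbar h ≫ ungraftWbar h₄ ≫ ungraftWbar h₃ ▷ _ ≫ (α_ _ _ _).hom ≫
        _ ◁ (β_ _ _).hom ≫ (α_ _ _ _).inv) (wpt l) =
      TopStar.smk (TopStar.smk (wpt t') (wpt m')) (wpt w') := by
    rw [TopStar.comp_apply, relabelWbar_wpt, TopStar.comp_apply, ungraftWbar_wpt h₄ hl']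
    have e3 : (ungraftWbar h₃ ▷ _) (TopStar.smk (wpt k') (wpt m')) =
      TopStar.smk (TopStar.smk (wpt t') (wpt w')) (wpt m') :=
        congrArg (TopStar.smk · (wpt m')) (ungraftWbar_wpt h₃ hk')
    rw [TopStar.comp_apply, e3]
    rfl
  rw [e1, e2]
  have ht : t = t' := Weighting.ext_of_ne_singleton fun c hc hcs => by
    rw [hk.1 c hc (hcs a), hl.1 _ (by subst h₁; exact lowerCluster_mem hc),
      hk'.1 c hc (hcs a'), hl'.1 _ (by subst h₃; exact lowerCluster_mem hc),
      ← lowerCluster_lowerCluster_map_insComm a a' haa, relabelW_len_map]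
    · exact fun h' => hcs a (lowerCluster_injective a'
        (h'.trans (lowerCluster_singleton_ne _ _).symm))
    · exact fun h' => hcs a' (lowerCluster_injective a
        (h'.trans (lowerCluster_singleton_ne _ _).symm))
  subst ht
  have hw : ∀ e ∈ W.clusters, t.len {a'} * w.len e = t.len {a'} * w'.len e := fun e he => by
    rw [← hk'.2 e he, hk.1 _ (T.singleton_mem a') fun h' => haa.symm (Finset.singleton_inj.1 h'),
      lowerCluster_singleton_ne a' haa.symm, ← hl.2 e he,
      hl'.1 _ (by subst h₃; exact upperCluster_mem he), ← upperCluster_map_insComm a a' haa,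
      relabelW_len_map]
    exact fun h' => lowerCluster_ne_upperCluster a' ⟨a, haa⟩ e
      (((lowerCluster_singleton_ne a haa).trans h'.symm))
  have hm : ∀ d ∈ U.clusters, t.len {a} * m.len d = t.len {a} * m'.len d := fun d hd => by
    rw [← hk.2 d hd, hk'.1 _ (T.singleton_mem a) fun h' => haa (Finset.singleton_inj.1 h'),
      lowerCluster_singleton_ne a haa, ← hl'.2 d hd,
      hl.1 _ (by subst h₁; exact upperCluster_mem hd),
        ← lowerCluster_upperCluster_map_insComm a a' haa,
      relabelW_len_map]
    exact fun h' => lowerCluster_ne_upperCluster a ⟨a', haa.symm⟩ d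
      (((lowerCluster_singleton_ne a' haa.symm).trans h'.symm))
  by_cases h0 : t.len {a} = 0
  · rw [wpt_eq_pt_of_leaf h0]
    simp
  by_cases h0' : t.len {a'} = 0
  · rw [wpt_eq_pt_of_leaf h0']
    simp
  rw [(Weighting.eq_of_mul hw).2 h0', (Weighting.eq_of_mul hm).2 h0]

/-! #### Edge collapse -/

lemma relabelWbar_wbarContract {σ : A ≃ A'} {T : LTree A} {T' : LTree A'} (h : T.relabel σ = T')
    (e : T.InternalEdge) (h' : (T.contract e).relabel σ =
      T'.contract ((isEmbIso_relabel σ h).toIsEmb.edge e)) :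
    relabelWbar h' ≫ wbarContract ((isEmbIso_relabel σ h).toIsEmb.edge e) =
      wbarContract e ≫ relabelWbar h :=
  wbar_hom_ext fun l => by
    rw [TopStar.comp_apply, TopStar.comp_apply, relabelWbar_wpt, wbarContract_wpt,
      wbarContract_wpt, relabelWbar_wpt]
    rfl

section

variable {T : LTree A} {a : A} {U : LTree B} {V : LTree (NFin.ins A a B)}

lemma wbarContract_ungraftWbar_lower (h : V = T.graft a U) (e : T.InternalEdge)
    (h' : V.contract ((isEmbPair_graft h).left.edge e) = (T.contract e).graft a U) :
    wbarContract ((isEmbPair_graft h).left.edge e) ≫ ungraftWbar h =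
      ungraftWbar h' ≫ wbarContract e ▷ _ := by
  refine wbar_hom_ext fun l => ?_
  obtain ⟨t, m, hl⟩ := exists_restricts h' l
  rw [TopStar.comp_apply, TopStar.comp_apply, wbarContract_wpt, ungraftWbar_wpt h' hl,
    ungraftWbar_wpt (t := contractWeighting e t) (m := m) h ⟨fun c hc hca => ?_, hl.2⟩]
  · rfl
  · by_cases hce : c = e.upper.1
    · subst hce
      exact (t.eq_zero (Finset.notMem_erase _ _)).trans (l.eq_zero (Finset.notMem_erase _ _)).symm
    · exact hl.1 c (Finset.mem_erase.2 ⟨hce, hc⟩) hca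

lemma wbarContract_ungraftWbar_upper (h : V = T.graft a U) (e : U.InternalEdge)
    (h' : V.contract ((isEmbPair_graft h).right.edge e) = T.graft a (U.contract e)) :
    wbarContract ((isEmbPair_graft h).right.edge e) ≫ ungraftWbar h =
      ungraftWbar h' ≫ _ ◁ wbarContract e := by
  refine wbar_hom_ext fun l => ?_
  obtain ⟨t, m, hl⟩ := exists_restricts h' l
  rw [TopStar.comp_apply, TopStar.comp_apply, wbarContract_wpt, ungraftWbar_wpt h' hl,
    ungraftWbar_wpt (t := t) (m := contractWeighting e m) h ⟨hl.1, fun d hd => ?_⟩]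
  · rfl
  · by_cases hde : d = e.upper.1
    · subst hde
      refine (l.eq_zero (Finset.notMem_erase _ _)).trans ?_
      exact (mul_eq_zero_of_right _ (m.eq_zero (Finset.notMem_erase _ _))).symm
    · exact hl.2 d (Finset.mem_erase.2 ⟨hde, hd⟩)

/-- If the edge of grafting has length zero, then the upper part has length zero, or its root edge
does. -/
lemma wbarContract_ungraftWbar_eq_zero (h : V = T.graft a U) (e : V.InternalEdge)
    (he : e.upper.1 = upperCluster a Finset.univ) : wbarContract e ≫ ungraftWbar h = 0 := by
  refine wbar_hom_ext fun l => ?_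
  obtain ⟨t, m, hl⟩ := exists_restricts h (contractWeighting e l)
  rw [TopStar.comp_apply, wbarContract_wpt, ungraftWbar_wpt h hl, TopStar.zero_apply]
  have h0 : t.len {a} * m.len Finset.univ = 0 :=
    (hl.2 _ U.univ_mem).symm.trans (he ▸ l.eq_zero (Finset.notMem_erase _ _))
  refine TopStar.smk_eq_pt ?_
  rcases mul_eq_zero.1 h0 with h0 | h0
  · exact Or.inl (wpt_eq_pt_of_leaf h0)
  · exact Or.inr (wpt_eq_pt (Or.inl h0))

end

/-! #### The tree with one leaf -/

lemma oneWeighting_len (T : LTree NFin.one) : T.oneWeighting.len Finset.univ = 1 :=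
  if_pos T.univ_mem

lemma eq_oneWeighting {T : LTree NFin.one} (l : T.Weighting) : l = T.oneWeighting := by
  refine Weighting.ext fun c hc => ?_
  have h : T.clusters.filter (() ∈ ·) = {Finset.univ} := by
    ext c
    rw [Finset.mem_filter, Finset.mem_singleton]
    refine ⟨fun h => T.eq_univ_of_one h.1, ?_⟩
    rintro rfl
    exact ⟨T.univ_mem, Finset.mem_univ _⟩
  have h1 := l.sum_eq ()
  rw [h, Finset.sum_singleton] at h1
  rw [T.eq_univ_of_one hc, h1, oneWeighting_len]

lemma ungraftWbar_one_left {T : LTree NFin.one} {U : LTree A}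
    {W : LTree (NFin.ins NFin.one () A)} (h : W = T.graft () U)
    (h' : W.relabel (NFin.oneIns A) = U) :
    ungraftWbar h = relabelWbar h' ≫ (λ_ _).inv ≫ wbarOne T ▷ _ := by
  refine wbar_hom_ext fun l => ?_
  rw [ungraftWbar_wpt (t := T.oneWeighting) (m := relabelW h' l) h
      ⟨fun c hc hca => ?_, fun d hd => ?_⟩,
    TopStar.comp_apply, relabelWbar_wpt]
  · rfl
  · exact (hca (T.eq_univ_of_one hc)).elim
  · rw [← relabelW_len_map h', upperCluster_map_oneIns]
    exact ((congrArg (· * _) T.oneWeighting_len).trans (one_mul _)).symm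

lemma relabelWbar_ungraftWbar_one_right {T : LTree A} {a : A} {U : LTree NFin.one}
    {V : LTree (NFin.ins A a NFin.one)} (h : V = T.graft a U)
    (h' : T.relabel (NFin.insOne A a) = V) :
    relabelWbar h' ≫ ungraftWbar h = (ρ_ _).inv ≫ _ ◁ wbarOne U := by
  refine wbar_hom_ext fun l => ?_
  rw [TopStar.comp_apply, relabelWbar_wpt,
    ungraftWbar_wpt (t := l) (m := U.oneWeighting) h ⟨fun c hc hca => ?_, fun d hd => ?_⟩]
  · rfl
  · rw [← relabelW_len_map h', map_insOne]
  · rw [U.eq_univ_of_one hd, oneWeighting_len, mul_one, ← lowerCluster_singleton, ← map_insOne,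
      relabelW_len_map]

instance (T : LTree NFin.one) : IsIso (wbarOne T) := by
  have hd : ∀ l : T.Weighting, ¬ l.IsDegenerate := fun l h => by
    rw [eq_oneWeighting l] at h
    have h1 := T.oneWeighting_len
    rcases h with h | ⟨x, h⟩
    · exact zero_ne_one (h.symm.trans h1)
    · exact zero_ne_one (h.symm.trans h1)
  refine ⟨wbarDesc (Z := 𝟙_ TopStar) (fun _ => show Bool from true) continuous_const
    (fun l h => (hd l h).elim), ?_, wbar_hom_ext fun l => ?_⟩
  · refine TopStar.hom_ext fun x => ?_
    change Bool at x
    cases x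
    · rfl
    · rfl
  · rw [eq_oneWeighting l]
    rfl

end LTree

/-! ### Zero maps and tensors -/

section SmashZero

variable {X X' Y Z : TopStar}

lemma TopStar.zero_tensorHom (g : Y ⟶ Z) : (0 : X ⟶ X') ⊗ₘ g = 0 :=
  TopStar.hom_ext fun x => by
    induction x using TopStar.ind
    exact TopStar.smk_pt_left _

lemma TopStar.tensorHom_zero (g : Y ⟶ Z) : g ⊗ₘ (0 : X ⟶ X') = 0 :=
  TopStar.hom_ext fun x => by
    induction x using TopStar.ind
    exact TopStar.smk_pt_right _

lemma TopStar.pre_zero_app : (MonoidalClosed.pre (0 : X ⟶ X')).app Y = 0 := by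
  apply MonoidalClosed.uncurry_injective
  rw [MonoidalClosed.uncurry_pre, MonoidalClosed.uncurry_eq, ← tensorHom_id, ← id_tensorHom,
    TopStar.zero_tensorHom, TopStar.tensorHom_zero, zero_comp, zero_comp]

end SmashZero

section Tensors

variable {V : Type*} [Category* V] [MonoidalCategory V] {C : Type u} [Category.{v} C]

lemma eHomEquiv_comp_whiskerLeft [EnrichedOrdinaryCategory V C] {c D D' : C} (f : c ⟶ D)
    (g : D ⟶ D') : eHomEquiv V (f ≫ g) = eHomEquiv V f ≫ eHomWhiskerLeft V c g := by
  rw [eHomEquiv_comp, eHomWhiskerLeft, MonoidalCategory.tensorHom_def,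
      rightUnitor_inv_naturality_assoc,
    unitors_inv_equal, Category.assoc]

lemma eHomEquiv_comp_whiskerRight [EnrichedOrdinaryCategory V C] {c D D' : C} (f : c ⟶ D)
    (g : D ⟶ D') : eHomEquiv V (f ≫ g) = eHomEquiv V g ≫ eHomWhiskerRight V f D' := by
  rw [eHomEquiv_comp, eHomWhiskerRight, MonoidalCategory.tensorHom_def',
      leftUnitor_inv_naturality_assoc,
    Category.assoc]

variable [MonoidalClosed V] [EnrichedOrdinaryCategory V C] [Tensoring V C]

/-- Functoriality of the tensor in both variables, as a definition of its own: unlike `tensMap`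
it is not reducible, so that rewriting with associativity does not take it apart. -/
def tensHom {X X' : V} {c c' : C} (f : X ⟶ X') (g : c ⟶ c') : tens X c ⟶ tens X' c' := tensMap f g

lemma tensHom_comp {X X' X'' : V} {c c' c'' : C} (f : X ⟶ X') (g : c ⟶ c') (f' : X' ⟶ X'')
    (g' : c' ⟶ c'') : tensHom f g ≫ tensHom f' g' = tensHom (f ≫ f') (g ≫ g') := by
  simp [tensHom, tensMap]

lemma tensHom_comp_assoc {X X' X'' : V} {c c' c'' D : C} (f : X ⟶ X') (g : c ⟶ c') (f' : X' ⟶ X'')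
    (g' : c' ⟶ c'') (h : tens X'' c'' ⟶ D) :
    tensHom f g ≫ tensHom f' g' ≫ h = tensHom (f ≫ f') (g ≫ g') ≫ h := by
  rw [← Category.assoc, tensHom_comp]

lemma tensHom_id (X : V) (c : C) : tensHom (𝟙 X) (𝟙 c) = 𝟙 (tens X c) := by
  simp [tensHom, tensMap]

instance {X X' : V} {c c' : C} (f : X ⟶ X') (g : c ⟶ c') [IsIso f] [IsIso g] :
    IsIso (tensHom f g) := by
  unfold tensHom
  infer_instance

/-- Precomposition with `c ⟶ I ⊙ c` is the adjunction bijection for the tensor. -/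
lemma eHomEquiv_tensUnit_comp {c D : C} (h : tens (𝟙_ V) c ⟶ D) :
    eHomEquiv V (tensUnit V c ≫ h) =
      (ρ_ _).inv ≫ MonoidalClosed.uncurry (eHomEquiv V h ≫ (Tensoring.iso (𝟙_ V) c D).hom) := by
  have h1 : eHomEquiv V h = eId V (tens (𝟙_ V) c) ≫ eHomWhiskerLeft V _ h := by
    rw [← eHomEquiv_id, ← eHomEquiv_comp_whiskerLeft, Category.id_comp]
  rw [eHomEquiv_comp_whiskerLeft, tensUnit, Equiv.apply_symm_apply, tensCoev, h1, Category.assoc,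
    Category.assoc, Tensoring.natural_right, ← MonoidalClosed.uncurry_natural_right,
    Category.assoc]

lemma bijective_tensUnit_comp (c D : C) :
    Function.Bijective fun h : tens (𝟙_ V) c ⟶ D => tensUnit V c ≫ h := by
  constructor
  · intro h h' e
    have e' := congrArg (eHomEquiv V) e
    dsimp only at e'
    rw [eHomEquiv_tensUnit_comp, eHomEquiv_tensUnit_comp, cancel_epi] at e'
    exact (eHomEquiv V).injective ((cancel_mono _).1 (MonoidalClosed.uncurry_injective e'))
  · intro k
    refine ⟨(eHomEquiv V).symm (MonoidalClosed.curry ((ρ_ _).hom ≫ eHomEquiv V k) ≫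
      (Tensoring.iso (𝟙_ V) c D).inv), (eHomEquiv V).injective ?_⟩
    dsimp only
    rw [eHomEquiv_tensUnit_comp, Equiv.apply_symm_apply, Category.assoc, Iso.inv_hom_id,
      Category.comp_id, MonoidalClosed.uncurry_curry, Iso.inv_hom_id_assoc]

instance (c : C) : IsIso (tensUnit V c) := by
  obtain ⟨g, hg⟩ := (bijective_tensUnit_comp (V := V) c c).2 (𝟙 c)
  refine ⟨g, hg, (bijective_tensUnit_comp (V := V) c _).1 ?_⟩
  dsimp only at hg ⊢
  rw [← Category.assoc, hg, Category.id_comp, Category.comp_id]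

end Tensors

section Isos

variable {C : Type u} [Category.{v} C]

lemma inv_comp_inv_comp_eq {X₁ X₂ X₃ X₄ Y₁ Y₂ : C} {a : X₁ ⟶ X₂} {b : X₂ ⟶ X₃} {r : X₃ ⟶ X₄}
    {s : X₁ ⟶ Y₁} {c : Y₁ ⟶ Y₂} {e : Y₂ ⟶ X₄} [IsIso a] [IsIso b] [IsIso c] [IsIso e]
    (h : a ≫ b ≫ r = s ≫ c ≫ e) : inv b ≫ inv a ≫ s = r ≫ inv e ≫ inv c := by
  rw [← cancel_mono (c ≫ e)]
  simp [← h]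

variable [MonoidalCategory C] [SymmetricCategory C]

/-- The symmetry isomorphism `(X ⊗ Y) ⊗ Z ⟶ (X ⊗ Z) ⊗ Y`. -/
def rightComm (X Y Z : C) :
    (X ⊗ Y) ⊗ Z ⟶ (X ⊗ Z) ⊗ Y := (α_ X Y Z).hom ≫ X ◁ (β_ Y Z).hom ≫ (α_ X Z Y).inv

lemma rightComm_naturality {X X' Y Y' Z Z' : C} (f : X ⟶ X') (g : Y ⟶ Y') (h : Z ⟶ Z') :
    ((f ⊗ₘ g) ⊗ₘ h) ≫ rightComm X' Y' Z' = rightComm X Y Z ≫ ((f ⊗ₘ h) ⊗ₘ g) := by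
  rw [rightComm, rightComm, associator_naturality_assoc, ← id_tensorHom,
    tensorHom_comp_tensorHom_assoc, Category.comp_id, braiding_naturality, Category.assoc,
    Category.assoc, ← associator_inv_naturality, ← id_tensorHom, tensorHom_comp_tensorHom_assoc,
    Category.id_comp]

lemma rightComm_rightComm (X Y Z : C) : rightComm X Y Z ≫ rightComm X Z Y = 𝟙 _ := by
  simp [rightComm, ← whiskerLeft_comp_assoc]

end Isos

section Zero

variable {C : Type u} [Category.{v} C] [EnrichedOrdinaryCategory TopStar C]

/-- The zero maps of a category enriched in based spaces: the basepoints of the mapping spaces. -/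
instance : HasZeroMorphisms C where
  zero c D := ⟨(eHomEquiv TopStar).symm 0⟩
  comp_zero {c D} f D' := (eHomEquiv TopStar).injective (by
    change eHomEquiv TopStar (f ≫ (eHomEquiv TopStar).symm 0) =
      eHomEquiv TopStar ((eHomEquiv TopStar).symm 0)
    rw [eHomEquiv_comp, Equiv.apply_symm_apply, Equiv.apply_symm_apply, TopStar.tensorHom_zero,
      zero_comp, comp_zero])
  zero_comp c {D D'} f := (eHomEquiv TopStar).injective (by
    change eHomEquiv TopStar ((eHomEquiv TopStar).symm 0 ≫ f) =
      eHomEquiv TopStar ((eHomEquiv TopStar).symm 0)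
    rw [eHomEquiv_comp, Equiv.apply_symm_apply, Equiv.apply_symm_apply, TopStar.zero_tensorHom,
      zero_comp, comp_zero])

lemma eHomEquiv_eq_zero_iff {c D : C} (f : c ⟶ D) : eHomEquiv TopStar f = 0 ↔ f = 0 :=
  (Equiv.eq_symm_apply _).symm

lemma exists_isZero [HasColimitsOfSize.{0, 0} C] : ∃ Z : C, IsZero Z := by
  have : HasInitial C := hasColimitsOfShape_of_equivalence emptyEquivalence.{0}
  exact ⟨⊥_ C, (IsZero.iff_id_eq_zero _).2 (initialIsInitial.hom_ext _ _)⟩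

variable [Tensoring TopStar C]

lemma tensHom_zero_left {X X' : TopStar} {c c' : C} (g : c ⟶ c') :
    tensHom (0 : X ⟶ X') g = 0 := by
  have h : (Tensoring.functor.map (0 : X ⟶ X')).app c = 0 := by
    rw [← eHomEquiv_eq_zero_iff, ← cancel_mono (Tensoring.iso X c _).hom, zero_comp]
    have h1 := eHomEquiv_comp_whiskerRight (V := TopStar)
      ((Tensoring.functor.map (0 : X ⟶ X')).app c) (𝟙 _)
    rw [Category.comp_id] at h1
    rw [h1, Category.assoc, Tensoring.natural_left, TopStar.pre_zero_app, comp_zero, comp_zero]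
  rw [tensHom, tensMap, h, zero_comp]

end Zero

section D

variable {C : Type u} [Category.{v} C] [MonoidalCategory C] [SymmetricCategory C]
  [EnrichedOrdinaryCategory TopStar C] [Tensoring TopStar C] [Cotensoring TopStar C]
  [SymmetricMonoidalVCategory TopStar C]

open SymmetricMonoidalVCategory (d)

lemma d_natural {X X' Y Y' : TopStar} {c c' e e' : C} (f : X ⟶ X') (g : Y ⟶ Y') (h : c ⟶ c')
    (k : e ⟶ e') :
    tensHom (f ⊗ₘ g) (h ⊗ₘ k) ≫ d X' Y' c' e' = d X Y c e ≫ (tensHom f h ⊗ₘ tensHom g k) :=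
  SymmetricMonoidalVCategory.natural f g h k

lemma d_assoc (X Y Z : TopStar) (c c' c'' : C) :
    d (X ⊗ Y) Z (c ⊗ c') c'' ≫ d X Y c c' ▷ tens Z c'' ≫ (α_ _ _ _).hom =
      tensHom (α_ X Y Z).hom (α_ c c' c'').hom ≫ d X (Y ⊗ Z) c (c' ⊗ c'') ≫
        tens X c ◁ d Y Z c' c'' :=
  SymmetricMonoidalVCategory.assoc X Y Z c c' c''

lemma d_unit_right (X : TopStar) (c : C) :
    tensHom (ρ_ X).inv (ρ_ c).inv ≫ d X (𝟙_ TopStar) c (𝟙_ C) =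
      (ρ_ (tens X c)).inv ≫ tens X c ◁ tensUnit TopStar (𝟙_ C) :=
  SymmetricMonoidalVCategory.unit X c

lemma d_symm (X Y : TopStar) (c c' : C) :
    d X Y c c' ≫ (β_ (tens X c) (tens Y c')).hom =
      tensHom (β_ X Y).hom (β_ c c').hom ≫ d Y X c' c :=
  SymmetricMonoidalVCategory.symm X Y c c'

lemma d_zero_left {X Y : TopStar} {c c' D D' : C} (g : tens Y c' ⟶ D') :
    d X Y c c' ≫ ((0 : tens X c ⟶ D) ⊗ₘ g) = 0 := by
  have h : (0 : tens X c ⟶ D) ⊗ₘ g = (tensHom (0 : X ⟶ X) (𝟙 c) ⊗ₘ tensHom (𝟙 Y) (𝟙 c')) ≫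
      ((0 : tens X c ⟶ D) ⊗ₘ g) := by
    rw [tensorHom_comp_tensorHom, comp_zero, tensHom_id, Category.id_comp]
  rw [h, ← reassoc_of% d_natural, TopStar.zero_tensorHom, tensHom_zero_left,
    zero_comp]

lemma d_zero_right {X Y : TopStar} {c c' D D' : C} (g : tens X c ⟶ D) :
    d X Y c c' ≫ (g ⊗ₘ (0 : tens Y c' ⟶ D')) = 0 := by
  have h : g ⊗ₘ (0 : tens Y c' ⟶ D') = (tensHom (𝟙 X) (𝟙 c) ⊗ₘ tensHom (0 : Y ⟶ Y) (𝟙 c')) ≫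
      (g ⊗ₘ (0 : tens Y c' ⟶ D')) := by
    rw [tensorHom_comp_tensorHom, comp_zero, tensHom_id, Category.id_comp]
  rw [h, ← reassoc_of% d_natural, TopStar.tensorHom_zero, tensHom_zero_left,
    zero_comp]

lemma d_unit_left (X : TopStar) (c : C) :
    tensHom (λ_ X).inv (λ_ c).inv ≫ d (𝟙_ TopStar) X (𝟙_ C) c =
      (λ_ (tens X c)).inv ≫ tensUnit TopStar (𝟙_ C) ▷ tens X c := by
  have h1 : tensHom (λ_ X).inv (λ_ c).inv =
      tensHom (ρ_ X).inv (ρ_ c).inv ≫ tensHom (β_ X (𝟙_ _)).hom (β_ c (𝟙_ _)).hom := by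
    rw [tensHom_comp, rightUnitor_inv_braiding, rightUnitor_inv_braiding]
  rw [h1, Category.assoc, ← d_symm, reassoc_of% d_unit_right, braiding_naturality_right,
    ← Category.assoc, rightUnitor_inv_braiding]

lemma d_rightComm (X Y Z : TopStar) (c c' c'' : C) :
    d (X ⊗ Y) Z (c ⊗ c') c'' ≫ d X Y c c' ▷ tens Z c'' ≫ rightComm _ _ _ =
      tensHom (rightComm X Y Z) (rightComm c c' c'') ≫ d (X ⊗ Z) Y (c ⊗ c'') c' ≫
        d X Z c c'' ▷ tens Y c' := by
  unfold rightComm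
  have h2 : d X (Z ⊗ Y) c (c'' ⊗ c') ≫ tens X c ◁ d Z Y c'' c' =
      tensHom (α_ X Z Y).inv (α_ c c'' c').inv ≫ d (X ⊗ Z) Y (c ⊗ c'') c' ≫
        d X Z c c'' ▷ tens Y c' ≫ (α_ _ _ _).hom := by
    rw [d_assoc, ← Category.assoc, tensHom_comp, Iso.inv_hom_id, Iso.inv_hom_id, tensHom_id,
      Category.id_comp]
  have h3 := d_natural (𝟙 X) (β_ Y Z).hom (𝟙 c) (β_ c' c'').hom
  rw [tensHom_id, id_tensorHom, id_tensorHom, id_tensorHom] at h3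
  rw [reassoc_of% d_assoc, ← whiskerLeft_comp_assoc, d_symm, whiskerLeft_comp_assoc,
    ← reassoc_of% h3, reassoc_of% h2, Iso.hom_inv_id, Category.comp_id, ← Category.assoc,
    ← Category.assoc, tensHom_comp, tensHom_comp]
  simp only [Category.assoc]

end D

/-! ### The structure maps of the bar construction -/

section BarCooperad

open SymmetricMonoidalVCategory (d)
open LTree

variable {C : Type u} [Category.{v} C] [MonoidalCategory C] [SymmetricCategory C]
  [EnrichedOrdinaryCategory TopStar C] [Tensoring TopStar C]
  (P : Operad C) [HasColimitsOfSize.{0, 0} C] {A A' A'' B B' D : NFin}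

lemma barι_contract {T : LTree A} (e : T.InternalEdge) :
    tensHom (𝟙 _) (PAContract P e) ≫ barι P (T.contract e) =
      tensHom (wbarContract e) (𝟙 _) ≫ barι P T :=
  Multicoequalizer.condition (barDiagram P A) ⟨T, e⟩

lemma barObj_hom_ext {Z : C} {f g : barObj P A ⟶ Z}
    (h : ∀ T : LTree A, barι P T ≫ f = barι P T ≫ g) : f = g :=
  Multicoequalizer.hom_ext (barDiagram P A) f g h

/-- The map out of the bar construction given by a family of maps that is compatible with edge
collapse. -/
noncomputable def barDesc {Z : C} (k : ∀ T : LTree A, tens T.wbar (PA P T) ⟶ Z)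
    (hk : ∀ (T : LTree A) (e : T.InternalEdge), tensHom (𝟙 _) (PAContract P e) ≫ k (T.contract e) =
      tensHom (wbarContract e) (𝟙 _) ≫ k T) : barObj P A ⟶ Z :=
  Multicoequalizer.desc (barDiagram P A) Z k fun x => hk x.1 x.2

lemma barι_barDesc {Z : C} (k : ∀ T : LTree A, tens T.wbar (PA P T) ⟶ Z) (hk) (T : LTree A) :
    barι P T ≫ barDesc P k hk = k T := Multicoequalizer.π_desc (barDiagram P A) Z k _ T

lemma tensHom_barι_contract {T : LTree A} (e : T.InternalEdge) {X : TopStar} {c : C}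
    (f : X ⟶ (T.contract e).wbar) (g : c ⟶ PA P T) :
    tensHom f (g ≫ PAContract P e) ≫ barι P (T.contract e) =
      tensHom (f ≫ wbarContract e) g ≫ barι P T := by
  have h := congrArg (fun x => tensHom f g ≫ x) (barι_contract P e)
  rwa [tensHom_comp_assoc, tensHom_comp_assoc, Category.comp_id, Category.comp_id] at h

lemma relabel_barι_congr {σ : A ≃ A'} {T : LTree A} {T' : LTree A'} (h : T.relabel σ = T') :
    tensHom (relabelWbar (σ := σ) rfl) (relabelPA P (σ := σ) rfl) ≫ barι P (T.relabel σ) =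
      tensHom (relabelWbar h) (relabelPA P h) ≫ barι P T' := by
  subst h
  rfl

/-- Relabelling on the bar construction. -/
noncomputable def barMap (σ : A ≃ A') : barObj P A ⟶ barObj P A' :=
  barDesc P (fun T => tensHom (relabelWbar (σ := σ) rfl) (relabelPA P (σ := σ) rfl) ≫
    barι P (T.relabel σ)) fun T e => by
      have h' : (T.contract e).relabel σ =
        (T.relabel σ).contract ((isEmbIso_relabel σ rfl).toIsEmb.edge e) := relabel_contract σ e
      rw [relabel_barι_congr P h', tensHom_comp_assoc, tensHom_comp_assoc, Category.id_comp,
        Category.id_comp, ← relabelPA_PAContract P (σ := σ) rfl e h', tensHom_barι_contract,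
        relabelWbar_wbarContract (σ := σ) rfl e h']

lemma barι_barMap {σ : A ≃ A'} {T : LTree A} {T' : LTree A'} (h : T.relabel σ = T') :
    barι P T ≫ barMap P σ = tensHom (relabelWbar h) (relabelPA P h) ≫ barι P T' := by
  subst h
  exact barι_barDesc P _ _ T

lemma barι_barMap_assoc {σ : A ≃ A'} {T : LTree A} {T' : LTree A'} (h : T.relabel σ = T') {Z : C}
    (x : barObj P A' ⟶ Z) :
    barι P T ≫ barMap P σ ≫ x = tensHom (relabelWbar h) (relabelPA P h) ≫ barι P T' ≫ x := by
  rw [← Category.assoc, barι_barMap P h, Category.assoc]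

lemma relabel_surjective (σ : A ≃ A') (T' : LTree A') : ∃ T : LTree A, T.relabel σ = T' :=
  ⟨T'.relabel σ.symm, by rw [relabel_trans, Equiv.symm_trans_self, relabel_refl]⟩

instance (T : LTree NFin.one) : IsEmpty T.InternalEdge := ⟨fun e => isEmptyElim e.lower⟩

/-- The isomorphism of the unit object with the summand of a tree with one leaf. -/
noncomputable def oneMap (T : LTree NFin.one) : 𝟙_ C ⟶ tens T.wbar (PA P T) :=
  tensUnit TopStar (𝟙_ C) ≫ tensHom T.wbarOne (PAOne P T)

instance (T : LTree NFin.one) : IsIso (oneMap P T) := by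
  unfold oneMap
  infer_instance

/-- The counit of the bar construction. -/
noncomputable def barCounit : barObj P NFin.one ⟶ 𝟙_ C :=
  barDesc P (fun T => inv (oneMap P T)) fun _ e => isEmptyElim e

lemma barι_barCounit (T : LTree NFin.one) : barι P T ≫ barCounit P = inv (oneMap P T) :=
  barι_barDesc P _ _ T

lemma oneMap_barι_barCounit (T : LTree NFin.one) :
    (oneMap P T ≫ barι P T) ≫ barCounit P = 𝟙 _ := by
  rw [Category.assoc, barι_barCounit, IsIso.hom_inv_id]

lemma barCounit_oneMap_barι (T : LTree NFin.one) :
    barCounit P ≫ oneMap P T ≫ barι P T = 𝟙 _ := by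
  refine barObj_hom_ext P fun T' => ?_
  obtain rfl : T = T' := (eq_oneTree T).trans (eq_oneTree T').symm
  rw [← Category.assoc, barι_barCounit, IsIso.inv_hom_id_assoc, Category.comp_id]

instance : IsIso (barCounit P) :=
  ⟨oneMap P oneTree ≫ barι P oneTree, barCounit_oneMap_barι P _, oneMap_barι_barCounit P _⟩

variable [Cotensoring TopStar C] [SymmetricMonoidalVCategory TopStar C]

/-- The cocomposition on the summand of a grafting `V` of `U` onto `T`. -/
noncomputable def barUngraft {T : LTree A} {a : A} {U : LTree B} {V : LTree (NFin.ins A a B)}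
    (h : V = T.graft a U) : tens V.wbar (PA P V) ⟶ barObj P A ⊗ barObj P B :=
  tensHom (ungraftWbar h) (inv (graftPA P h)) ≫ d _ _ _ _ ≫ (barι P T ⊗ₘ barι P U)

open Classical in
/-- The cocomposition on the summand of a tree `V`: it is zero unless `V` is a grafting. -/
noncomputable def treeCocomp (a : A) (V : LTree (NFin.ins A a B)) :
    tens V.wbar (PA P V) ⟶ barObj P A ⊗ barObj P B :=
  if h : ∃ p : LTree A × LTree B, V = p.1.graft a p.2 then barUngraft P h.choose_spec else 0

variable {a : A}

lemma treeCocomp_graft {T : LTree A} {U : LTree B} {V : LTree (NFin.ins A a B)}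
    (h : V = T.graft a U) : treeCocomp P a V = barUngraft P h := by
  have h' : ∃ p : LTree A × LTree B, V = p.1.graft a p.2 := ⟨(T, U), h⟩
  rw [treeCocomp, dif_pos h']
  generalize_proofs h''
  generalize h'.choose = p at h''
  obtain ⟨T', U'⟩ := p
  obtain ⟨rfl, rfl⟩ := graft_injective (h''.symm.trans h)
  rfl

lemma treeCocomp_eq_zero {V : LTree (NFin.ins A a B)}
    (h : ∀ (T : LTree A) (U : LTree B), V ≠ T.graft a U) : treeCocomp P a V = 0 :=
  dif_neg fun ⟨p, hp⟩ => h p.1 p.2 hp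

lemma contract_barι_left {T : LTree A} (e : T.InternalEdge) {X Y : TopStar} {c c' D : C}
    (f : X ⟶ (T.contract e).wbar ⊗ Y) (g : c ⟶ PA P T ⊗ c') (x : tens Y c' ⟶ D) :
    tensHom f (g ≫ PAContract P e ▷ c') ≫ d _ _ _ _ ≫ (barι P (T.contract e) ⊗ₘ x) =
      tensHom (f ≫ wbarContract e ▷ Y) g ≫ d _ _ _ _ ≫ (barι P T ⊗ₘ x) := by
  have h1 := d_natural (𝟙 (T.contract e).wbar) (𝟙 Y) (PAContract P e) (𝟙 c')
  have h2 := d_natural (wbarContract e) (𝟙 Y) (𝟙 (PA P T)) (𝟙 c')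
  simp only [tensorHom_id, id_whiskerRight, tensHom_id] at h1 h2
  have h3 : tensHom f (g ≫ PAContract P e ▷ c') =
      tensHom f g ≫ tensHom (𝟙 _) (PAContract P e ▷ c') := by
    rw [tensHom_comp, Category.comp_id]
  have h4 : tensHom (f ≫ wbarContract e ▷ Y) g =
      tensHom f g ≫ tensHom (wbarContract e ▷ Y) (𝟙 _) := by
    rw [tensHom_comp, Category.comp_id]
  rw [h3, h4, Category.assoc, Category.assoc, reassoc_of% h1, reassoc_of% h2,
    whiskerRight_comp_tensorHom, whiskerRight_comp_tensorHom, barι_contract]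

lemma contract_barι_right {T : LTree A} (e : T.InternalEdge) {X Y : TopStar} {c c' D : C}
    (f : X ⟶ Y ⊗ (T.contract e).wbar) (g : c ⟶ c' ⊗ PA P T) (x : tens Y c' ⟶ D) :
    tensHom f (g ≫ c' ◁ PAContract P e) ≫ d _ _ _ _ ≫ (x ⊗ₘ barι P (T.contract e)) =
      tensHom (f ≫ Y ◁ wbarContract e) g ≫ d _ _ _ _ ≫ (x ⊗ₘ barι P T) := by
  have h1 := d_natural (𝟙 Y) (𝟙 (T.contract e).wbar) (𝟙 c') (PAContract P e)
  have h2 := d_natural (𝟙 Y) (wbarContract e) (𝟙 c') (𝟙 (PA P T))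
  simp only [id_tensorHom, whiskerLeft_id, tensHom_id] at h1 h2
  have h3 : tensHom f (g ≫ c' ◁ PAContract P e) =
      tensHom f g ≫ tensHom (𝟙 _) (c' ◁ PAContract P e) := by
    rw [tensHom_comp, Category.comp_id]
  have h4 : tensHom (f ≫ Y ◁ wbarContract e) g =
      tensHom f g ≫ tensHom (Y ◁ wbarContract e) (𝟙 _) := by
    rw [tensHom_comp, Category.comp_id]
  rw [h3, h4, Category.assoc, Category.assoc, reassoc_of% h1, reassoc_of% h2,
    whiskerLeft_comp_tensorHom, whiskerLeft_comp_tensorHom, barι_contract]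

lemma treeCocomp_contract (V : LTree (NFin.ins A a B)) (e : V.InternalEdge) :
    tensHom (𝟙 _) (PAContract P e) ≫ treeCocomp P a (V.contract e) =
      tensHom (wbarContract e) (𝟙 _) ≫ treeCocomp P a V := by
  by_cases hV : ∃ (T : LTree A) (U : LTree B), V = T.graft a U
  · obtain ⟨T, U, rfl⟩ := hV
    rcases edge_graft_cases e with ⟨e, rfl⟩ | ⟨e, rfl⟩ | he
    · have h' : (T.graft a U).contract ((isEmbPair_graft rfl).left.edge e) =
        (T.contract e).graft a U := (graft_contract_lower e).symm
      have h1 : PAContract P ((isEmbPair_graft (T := T) (a := a) (U := U) rfl).left.edge e) ≫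
          inv (graftPA P h') = inv (graftPA P rfl) ≫ PAContract P e ▷ PA P U := by
        rw [IsIso.comp_inv_eq, Category.assoc, ← graftPA_PAContract_lower P rfl e h',
          IsIso.inv_hom_id_assoc]
      change tensHom (𝟙 _) (PAContract P ((isEmbPair_graft rfl).left.edge e)) ≫
        treeCocomp P a ((T.graft a U).contract ((isEmbPair_graft rfl).left.edge e)) =
        tensHom (wbarContract ((isEmbPair_graft rfl).left.edge e)) (𝟙 _) ≫ _
      rw [treeCocomp_graft P h', treeCocomp_graft P rfl, barUngraft, barUngraft,
        tensHom_comp_assoc, tensHom_comp_assoc, h1, Category.id_comp, Category.id_comp,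
        contract_barι_left, wbarContract_ungraftWbar_lower rfl e h']
    · have h' : (T.graft a U).contract ((isEmbPair_graft rfl).right.edge e) =
        T.graft a (U.contract e) := (graft_contract_upper e).symm
      have h1 : PAContract P ((isEmbPair_graft (T := T) (a := a) (U := U) rfl).right.edge e) ≫
          inv (graftPA P h') = inv (graftPA P rfl) ≫ PA P T ◁ PAContract P e := by
        rw [IsIso.comp_inv_eq, Category.assoc, ← graftPA_PAContract_upper P rfl e h',
          IsIso.inv_hom_id_assoc]
      change tensHom (𝟙 _) (PAContract P ((isEmbPair_graft rfl).right.edge e)) ≫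
        treeCocomp P a ((T.graft a U).contract ((isEmbPair_graft rfl).right.edge e)) =
        tensHom (wbarContract ((isEmbPair_graft rfl).right.edge e)) (𝟙 _) ≫ _
      rw [treeCocomp_graft P h', treeCocomp_graft P rfl, barUngraft, barUngraft,
        tensHom_comp_assoc, tensHom_comp_assoc, h1, Category.id_comp, Category.id_comp,
        contract_barι_right, wbarContract_ungraftWbar_upper rfl e h']
    · rw [treeCocomp_eq_zero, treeCocomp_graft P rfl, barUngraft, tensHom_comp_assoc,
        wbarContract_ungraftWbar_eq_zero rfl e he, tensHom_zero_left, zero_comp, comp_zero]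
      intro T' U' h
      have h1 := (exists_eq_graft_iff _).1 ⟨T', U', h⟩
      exact Finset.notMem_erase _ _ (he ▸ h1)
  · rw [treeCocomp_eq_zero, treeCocomp_eq_zero, comp_zero, comp_zero]
    · exact fun T U h => hV ⟨T, U, h⟩
    · exact fun T U h => hV ((exists_eq_graft_iff V).2
        (Finset.mem_of_mem_erase ((exists_eq_graft_iff _).1 ⟨T, U, h⟩)))

/-- The cocomposition of the bar construction. -/
noncomputable def barCocomp (A : NFin) (a : A) (B : NFin) :
    barObj P (NFin.ins A a B) ⟶ barObj P A ⊗ barObj P B :=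
  barDesc P (treeCocomp P a) (treeCocomp_contract P)

lemma barι_barCocomp {T : LTree A} {U : LTree B} {V : LTree (NFin.ins A a B)}
    (h : V = T.graft a U) : barι P V ≫ barCocomp P A a B =
      tensHom (ungraftWbar h) (inv (graftPA P h)) ≫ d _ _ _ _ ≫ (barι P T ⊗ₘ barι P U) :=
  (barι_barDesc P _ _ V).trans (treeCocomp_graft P h)

lemma barι_barCocomp_eq_zero {V : LTree (NFin.ins A a B)}
    (h : ∀ (T : LTree A) (U : LTree B), V ≠ T.graft a U) : barι P V ≫ barCocomp P A a B = 0 :=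
  (barι_barDesc P _ _ V).trans (treeCocomp_eq_zero P h)

end BarCooperad

/-! ### The cooperad axioms -/

section BarCooperad

open SymmetricMonoidalVCategory (d)
open LTree

variable {C : Type u} [Category.{v} C] [MonoidalCategory C] [SymmetricCategory C]
  [EnrichedOrdinaryCategory TopStar C] [Tensoring TopStar C] (P : Operad C)
  [HasColimitsOfSize.{0, 0} C] {A A' A'' B B' D : NFin}

lemma barMap_refl (A : NFin) : barMap P (Equiv.refl A) = 𝟙 (barObj P A) :=
  barObj_hom_ext P fun T => by
    rw [barι_barMap P (relabel_refl T), relabelWbar_refl, relabelPA_refl, tensHom_id,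
      Category.id_comp, Category.comp_id]

lemma barMap_trans (σ : A ≃ A') (τ : A' ≃ A'') :
    barMap P (σ.trans τ) = barMap P σ ≫ barMap P τ :=
  barObj_hom_ext P fun T => by
    have h := relabel_trans T σ τ
    rw [barι_barMap P h.symm, ← Category.assoc, barι_barMap P (σ := σ) (T := T) rfl, Category.assoc,
      barι_barMap P (σ := τ) rfl, tensHom_comp_assoc, relabelWbar_trans rfl rfl h.symm,
      relabelPA_trans P rfl rfl h.symm]

variable [Cotensoring TopStar C] [SymmetricMonoidalVCategory TopStar C]

lemma barCocomp_natural (σ : A ≃ A') (τ : B ≃ B') (a : A) :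
    barCocomp P A a B ≫ (barMap P σ ⊗ₘ barMap P τ) =
      barMap P (NFin.insCongr σ τ a) ≫ barCocomp P A' (σ a) B' := by
  refine barObj_hom_ext P fun V => ?_
  rw [barι_barMap_assoc P (T := V) rfl, ← Category.assoc (barι P V)]
  by_cases hV : ∃ (T : LTree A) (U : LTree B), V = T.graft a U
  · obtain ⟨T, U, h⟩ := hV
    have h' : V.relabel (NFin.insCongr σ τ a) = (T.relabel σ).graft (σ a) (U.relabel τ) := by
      rw [h, graft_relabel]
    have hP : relabelPA P rfl ≫ inv (graftPA P h') =
        inv (graftPA P h) ≫ (relabelPA P rfl ⊗ₘ relabelPA P rfl) := by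
      rw [IsIso.comp_inv_eq, Category.assoc, ← graftPA_natural P rfl rfl h h' rfl,
        IsIso.inv_hom_id_assoc]
    rw [barι_barCocomp P h, barι_barCocomp P h', tensHom_comp_assoc, hP,
      ungraftWbar_natural rfl rfl h h' rfl, ← tensHom_comp, Category.assoc, Category.assoc,
      Category.assoc, reassoc_of% d_natural, tensorHom_comp_tensorHom, tensorHom_comp_tensorHom,
      barι_barMap P rfl, barι_barMap P rfl]
  · rw [barι_barCocomp_eq_zero P fun T U h => hV ⟨T, U, h⟩, barι_barCocomp_eq_zero P, comp_zero,
      zero_comp]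
    intro T' U' h
    obtain ⟨T, rfl⟩ := relabel_surjective σ T'
    obtain ⟨U, rfl⟩ := relabel_surjective τ U'
    exact hV ⟨T, U, relabel_injective _ (h.trans (graft_relabel T a U σ τ).symm)⟩

/-! #### Iterated cocompositions -/

section

variable {a : A} {T : LTree A} {U : LTree B}

lemma barι_barCocomp_whiskerRight {x : NFin.ins A a B} {W : LTree D}
    {V₁ : LTree (NFin.ins A a B)} {V₂ : LTree (NFin.ins (NFin.ins A a B) x D)}
    (h₁ : V₁ = T.graft a U) (h₂ : V₂ = V₁.graft x W) :
    barι P V₂ ≫ barCocomp P (NFin.ins A a B) x D ≫ barCocomp P A a B ▷ barObj P D =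
      tensHom (ungraftWbar h₂ ≫ ungraftWbar h₁ ▷ _) (inv (graftPA P h₂) ≫ inv (graftPA P h₁) ▷ _) ≫
        d _ _ _ _ ≫ d _ _ _ _ ▷ _ ≫ ((barι P T ⊗ₘ barι P U) ⊗ₘ barι P W) := by
  have h3 := d_natural (ungraftWbar h₁) (𝟙 W.wbar) (inv (graftPA P h₁)) (𝟙 (PA P W))
  simp only [tensorHom_id, tensHom_id] at h3
  rw [← Category.assoc, barι_barCocomp P h₂, ← tensHom_comp, Category.assoc, Category.assoc,
    Category.assoc, reassoc_of% h3, ← tensorHom_id, tensorHom_comp_tensorHom, Category.comp_id,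
    barι_barCocomp P h₁, whiskerRight_comp_tensorHom, whiskerRight_comp_tensorHom]

lemma barι_barCocomp_whiskerLeft {b : B} {W : LTree D}
    {V₃ : LTree (NFin.ins B b D)} {V₄ : LTree (NFin.ins A a (NFin.ins B b D))}
    (h₃ : V₃ = U.graft b W) (h₄ : V₄ = T.graft a V₃) :
    barι P V₄ ≫ barCocomp P A a (NFin.ins B b D) ≫ barObj P A ◁ barCocomp P B b D =
      tensHom (ungraftWbar h₄ ≫ _ ◁ ungraftWbar h₃) (inv (graftPA P h₄) ≫ _ ◁ inv (graftPA P h₃)) ≫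
        d _ _ _ _ ≫ _ ◁ d _ _ _ _ ≫ (barι P T ⊗ₘ (barι P U ⊗ₘ barι P W)) := by
  have h3 := d_natural (𝟙 T.wbar) (ungraftWbar h₃) (𝟙 (PA P T)) (inv (graftPA P h₃))
  simp only [id_tensorHom, tensHom_id] at h3
  rw [← Category.assoc, barι_barCocomp P h₄, ← tensHom_comp, Category.assoc, Category.assoc,
    Category.assoc, reassoc_of% h3, ← id_tensorHom, tensorHom_comp_tensorHom, Category.comp_id,
    barι_barCocomp P h₃, whiskerLeft_comp_tensorHom, whiskerLeft_comp_tensorHom]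

end

lemma barι_barCocomp_whiskerRight_eq_zero {a : A} {x : NFin.ins A a B}
    {V₂ : LTree (NFin.ins (NFin.ins A a B) x D)}
    (h : ∀ (T : LTree A) (U : LTree B) (W : LTree D), V₂ ≠ (T.graft a U).graft x W) :
    barι P V₂ ≫ barCocomp P (NFin.ins A a B) x D ≫ barCocomp P A a B ▷ barObj P D = 0 := by
  rw [← Category.assoc]
  by_cases hV : ∃ (V₁ : LTree (NFin.ins A a B)) (W : LTree D), V₂ = V₁.graft x W
  · obtain ⟨V₁, W, h₂⟩ := hV
    rw [barι_barCocomp P h₂, Category.assoc, Category.assoc, ← tensorHom_id,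
      tensorHom_comp_tensorHom, barι_barCocomp_eq_zero P fun T U h₁ => h T U W (h₁ ▸ h₂),
      d_zero_left, comp_zero]
  · rw [barι_barCocomp_eq_zero P fun T U h => hV ⟨T, U, h⟩, zero_comp]

lemma barι_barCocomp_whiskerLeft_eq_zero {a : A} {b : B}
    {V₄ : LTree (NFin.ins A a (NFin.ins B b D))}
    (h : ∀ (T : LTree A) (U : LTree B) (W : LTree D), V₄ ≠ T.graft a (U.graft b W)) :
    barι P V₄ ≫ barCocomp P A a (NFin.ins B b D) ≫ barObj P A ◁ barCocomp P B b D = 0 := by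
  rw [← Category.assoc]
  by_cases hV : ∃ (T : LTree A) (V₃ : LTree (NFin.ins B b D)), V₄ = T.graft a V₃
  · obtain ⟨T, V₃, h₄⟩ := hV
    rw [barι_barCocomp P h₄, Category.assoc, Category.assoc, ← id_tensorHom,
      tensorHom_comp_tensorHom, barι_barCocomp_eq_zero P fun U W h₃ => h T U W (h₃ ▸ h₄),
      d_zero_right, comp_zero]
  · rw [barι_barCocomp_eq_zero P fun T U h => hV ⟨T, U, h⟩, zero_comp]

lemma barCocomp_assoc (A : NFin) (a : A) (B : NFin) (b : B) (D : NFin) :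
    barCocomp P (NFin.ins A a B) (Sum.inr b) D ≫ barCocomp P A a B ▷ barObj P D ≫ (α_ _ _ _).hom =
      barMap P (NFin.insAssoc A a B b D) ≫ barCocomp P A a (NFin.ins B b D) ≫
        barObj P A ◁ barCocomp P B b D := by
  refine barObj_hom_ext P fun V => ?_
  have hL : barι P V ≫ barCocomp P (NFin.ins A a B) (Sum.inr b) D ≫
      barCocomp P A a B ▷ barObj P D ≫ (α_ _ _ _).hom = (barι P V ≫
        barCocomp P (NFin.ins A a B) (Sum.inr b) D ≫ barCocomp P A a B ▷ barObj P D) ≫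
          (α_ _ _ _).hom := by simp only [Category.assoc]
  refine hL.trans (Eq.trans ?_ (barι_barMap_assoc P (T := V) rfl _).symm)
  by_cases hV : ∃ (T : LTree A) (U : LTree B) (W : LTree D),
      V = (T.graft a U).graft (Sum.inr b) W
  · obtain ⟨T, U, W, h₂⟩ := hV
    have h₄ : V.relabel (NFin.insAssoc A a B b D) = T.graft a (U.graft b W) := by
      rw [h₂, graft_assoc]
    have hP := inv_comp_inv_comp_eq (graftPA_assoc P rfl h₂ rfl h₄ rfl)
    rw [inv_whiskerRight, inv_whiskerLeft] at hP
    rw [barι_barCocomp_whiskerRight P rfl h₂, barι_barCocomp_whiskerLeft P rfl h₄,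
      tensHom_comp_assoc, ← hP, ← ungraftWbar_assoc rfl h₂ rfl h₄ rfl]
    simp only [Category.assoc]
    rw [associator_naturality, reassoc_of% d_assoc, tensHom_comp_assoc]
    simp only [Category.assoc]
  · rw [barι_barCocomp_whiskerRight_eq_zero P fun T U W h => hV ⟨T, U, W, h⟩,
      barι_barCocomp_whiskerLeft_eq_zero P, comp_zero, zero_comp]
    intro T U W h
    exact hV ⟨T, U, W, relabel_injective _ (h.trans (graft_assoc T a U b W).symm)⟩

lemma barCocomp_comm (A : NFin) (a a' : A) (haa : a ≠ a') (B D : NFin) :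
    barCocomp P (NFin.ins A a B) (Sum.inl ⟨a', haa.symm⟩) D ≫ barCocomp P A a B ▷ barObj P D =
      barMap P (NFin.insComm A a a' haa B D) ≫ barCocomp P (NFin.ins A a' D) (Sum.inl ⟨a, haa⟩) B ≫
        barCocomp P A a' D ▷ barObj P B ≫ rightComm (barObj P A) (barObj P D) (barObj P B) := by
  refine barObj_hom_ext P fun V => ?_
  refine Eq.trans ?_ (barι_barMap_assoc P (T := V) rfl _).symm
  have hR (V : LTree (NFin.ins (NFin.ins A a' D) (Sum.inl ⟨a, haa⟩) B)) : barι P V ≫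
      barCocomp P (NFin.ins A a' D) (Sum.inl ⟨a, haa⟩) B ≫ barCocomp P A a' D ▷ barObj P B ≫
        rightComm (barObj P A) (barObj P D) (barObj P B) = (barι P V ≫
      barCocomp P (NFin.ins A a' D) (Sum.inl ⟨a, haa⟩) B ≫ barCocomp P A a' D ▷ barObj P B) ≫
        rightComm (barObj P A) (barObj P D) (barObj P B) := by simp only [Category.assoc]
  rw [hR]
  by_cases hV : ∃ (T : LTree A) (U : LTree B) (W : LTree D),
      V = (T.graft a U).graft (Sum.inl ⟨a', haa.symm⟩) W
  · obtain ⟨T, U, W, h₂⟩ := hV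
    have h₄ : V.relabel (NFin.insComm A a a' haa B D) =
        (T.graft a' W).graft (Sum.inl ⟨a, haa⟩) U := by
      rw [h₂, graft_comm]
    have hP : inv (graftPA P h₂) ≫ inv (graftPA P rfl) ▷ _ =
        relabelPA P rfl ≫ inv (graftPA P h₄) ≫ inv (graftPA P rfl) ▷ _ ≫ rightComm _ _ _ := by
      have h1 := inv_comp_inv_comp_eq (s := rightComm _ _ _) (c := graftPA P rfl ▷ _)
        (e := graftPA P h₄)
        ((graftPA_comm P haa rfl h₂ rfl h₄ rfl).trans (by simp only [rightComm, Category.assoc]))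
      rw [inv_whiskerRight, inv_whiskerRight] at h1
      have h2 := congrArg (fun x => x ≫ rightComm _ _ _) h1
      simp only [Category.assoc] at h2
      rw [← h2, rightComm_rightComm, Category.comp_id]
    rw [barι_barCocomp_whiskerRight P rfl h₂, barι_barCocomp_whiskerRight P rfl h₄, hP,
      ungraftWbar_comm haa rfl h₂ rfl h₄ rfl]
    simp only [Category.assoc]
    rw [rightComm_naturality, reassoc_of% d_rightComm, tensHom_comp_assoc, tensHom_comp_assoc]
    simp only [rightComm, Category.assoc]
  · rw [barι_barCocomp_whiskerRight_eq_zero P fun T U W h => hV ⟨T, U, W, h⟩,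
      barι_barCocomp_whiskerRight_eq_zero P, zero_comp, comp_zero]
    intro T W U h
    exact hV ⟨T, U, W, relabel_injective _ (h.trans (graft_comm T a a' haa U W).symm)⟩

/-! #### The counit axioms -/

lemma barCounit_barCocomp (A : NFin) :
    barCocomp P NFin.one () A ≫ barCounit P ▷ barObj P A ≫ (λ_ _).hom =
      barMap P (NFin.oneIns A) := by
  refine barObj_hom_ext P fun V => ?_
  have h : V = oneTree.graft () (V.relabel (NFin.oneIns A)) :=
    relabel_injective (NFin.oneIns A) (oneTree_graft _).symm
  have h1 : inv (graftPA P h) = relabelPA P rfl ≫ (λ_ _).inv ≫ PAOne P oneTree ▷ _ := by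
    refine IsIso.inv_eq_of_hom_inv_id ?_
    rw [← cancel_epi (PAOne P oneTree ▷ _)]
    have h2 := graftPA_one_left P h rfl
    rw [reassoc_of% h2, Iso.hom_inv_id_assoc, Category.comp_id]
  have h2 := d_natural (wbarOne oneTree) (𝟙 (V.relabel (NFin.oneIns A)).wbar) (PAOne P oneTree)
    (𝟙 (PA P (V.relabel (NFin.oneIns A))))
  simp only [tensorHom_id, tensHom_id] at h2
  have h3 := oneMap_barι_barCounit P oneTree
  rw [oneMap, Category.assoc, Category.assoc] at h3
  rw [← Category.assoc, barι_barCocomp P h, barι_barMap P (T := V) rfl, h1,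
    ungraftWbar_one_left h rfl, ← tensHom_comp, ← tensHom_comp]
  simp only [Category.assoc]
  rw [reassoc_of% h2, reassoc_of% d_unit_left, ← tensorHom_id (barCounit P),
    tensorHom_comp_tensorHom_assoc, whiskerRight_comp_tensorHom_assoc,
    whiskerRight_comp_tensorHom_assoc, h3, Category.comp_id, id_tensorHom,
    leftUnitor_naturality, Iso.inv_hom_id_assoc]

lemma barCocomp_barCounit (A : NFin) (a : A) :
    barMap P (NFin.insOne A a) ≫ barCocomp P A a NFin.one ≫ barObj P A ◁ barCounit P ≫
      (ρ_ _).hom = 𝟙 (barObj P A) := by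
  refine barObj_hom_ext P fun T => ?_
  have h : T.relabel (NFin.insOne A a) = T.graft a oneTree := graft_oneTree T a
  have h1 : relabelPA P rfl ≫ inv (graftPA P h) = (ρ_ _).inv ≫ _ ◁ PAOne P oneTree := by
    rw [IsIso.comp_inv_eq, Category.assoc, graftPA_one_right P h rfl, Iso.inv_hom_id_assoc]
  have h2 := d_natural (𝟙 T.wbar) (wbarOne oneTree) (𝟙 (PA P T)) (PAOne P oneTree)
  simp only [id_tensorHom, tensHom_id] at h2
  have h3 := oneMap_barι_barCounit P oneTree
  rw [oneMap, Category.assoc, Category.assoc] at h3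
  rw [barι_barMap_assoc P (T := T) rfl, ← Category.assoc (barι P _), barι_barCocomp P h]
  simp only [Category.assoc]
  rw [tensHom_comp_assoc, h1, relabelWbar_ungraftWbar_one_right h rfl, ← tensHom_comp,
    Category.assoc, reassoc_of% h2, reassoc_of% d_unit_right, ← id_tensorHom _ (barCounit P),
    tensorHom_comp_tensorHom_assoc, whiskerLeft_comp_tensorHom_assoc,
    whiskerLeft_comp_tensorHom_assoc, h3, Category.comp_id, tensorHom_id,
    rightUnitor_naturality, Iso.inv_hom_id_assoc]

/-- The cooperad structure of the bar construction. -/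
noncomputable def barCooperad : CooperadStructure (barObj P) where
  map := barMap P
  cocomp := barCocomp P
  counit := barCounit P
  map_refl := barMap_refl P
  map_trans := barMap_trans P
  cocomp_natural := barCocomp_natural P
  cocomp_assoc := barCocomp_assoc P
  cocomp_comm := barCocomp_comm P
  counit_cocomp := barCounit_barCocomp P
  cocomp_counit := barCocomp_barCounit P

lemma isUngrafting_barCooperad : IsUngrafting P (barCooperad P) where
  map_eq σ T := by
    rw [relabelWbar_rfl, PARelabel_eq]
    exact barι_barMap P rfl
  cocomp_graft T a _ U := by
    rw [ungraftWbar_rfl, PAUngraft_eq]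
    exact barι_barCocomp P rfl
  cocomp_zero a _ V hV := by
    obtain ⟨Z, hZ⟩ := exists_isZero (C := C)
    exact ⟨Z, hZ, 0, 0, (barι_barCocomp_eq_zero P hV).trans zero_comp.symm⟩
  counit_eq T := by
    have h := oneMap_barι_barCounit P T
    rw [oneMap, Category.assoc, Category.assoc] at h
    exact h

variable {P}

lemma IsUngrafting.oneMap_comp {S : CooperadStructure (barObj P)} (h : IsUngrafting P S) :
    (oneMap P oneTree ≫ barι P oneTree) ≫ S.counit = 𝟙 _ := by
  rw [oneMap, Category.assoc, Category.assoc]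
  exact h.counit_eq oneTree

lemma IsUngrafting.counit_eq_barCounit {S : CooperadStructure (barObj P)}
    (h : IsUngrafting P S) : S.counit = barCounit P := by
  have := congrArg (fun x => barCounit P ≫ x) h.oneMap_comp
  rwa [← Category.assoc, barCounit_oneMap_barι, Category.id_comp, Category.comp_id] at this

/-- A structure of the required kind is determined by its values on the summands of all trees. -/
lemma IsUngrafting.eq_barCooperad {S : CooperadStructure (barObj P)} (h : IsUngrafting P S) :
    S = barCooperad P := by
  have h' := isUngrafting_barCooperad P
  refine CooperadStructure.ext ?_ ?_ ?_
  · funext A B σ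
    exact barObj_hom_ext P fun T => (h.map_eq σ T).trans (h'.map_eq σ T).symm
  · funext A a B
    refine barObj_hom_ext P fun V => ?_
    by_cases hV : ∃ (T : LTree A) (U : LTree B), V = T.graft a U
    · obtain ⟨T, U, rfl⟩ := hV
      exact (h.cocomp_graft T a U).trans (h'.cocomp_graft T a U).symm
    · obtain ⟨Z, hZ, f, g, e⟩ := h.cocomp_zero a V fun T U e => hV ⟨T, U, e⟩
      refine e.trans (Eq.trans ?_ (barι_barCocomp_eq_zero P fun T U e => hV ⟨T, U, e⟩).symm)
      rw [hZ.eq_zero_of_tgt f, zero_comp]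
  · exact h.counit_eq_barCounit

end BarCooperad

end BarCooperad

theorem theorem4 (C : Type u) [Category.{v} C] [MonoidalCategory C] [SymmetricCategory C]
    [EnrichedOrdinaryCategory BarCooperad.TopStar C] [BarCooperad.Tensoring BarCooperad.TopStar C]
    [BarCooperad.Cotensoring BarCooperad.TopStar C]
    [BarCooperad.SymmetricMonoidalVCategory BarCooperad.TopStar C]
    [Limits.HasLimitsOfSize.{0, 0} C] [Limits.HasColimitsOfSize.{0, 0} C]
    (P : BarCooperad.Operad C) (hP : P.IsReduced) :
    (∃! S : BarCooperad.CooperadStructure (BarCooperad.barObj P), BarCooperad.IsUngrafting P S) ∧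
      ∀ S : BarCooperad.CooperadStructure (BarCooperad.barObj P),
        BarCooperad.IsUngrafting P S → S.IsReduced := by
  refine ⟨⟨BarCooperad.barCooperad P, BarCooperad.isUngrafting_barCooperad P,
    fun S h => h.eq_barCooperad⟩, fun S h => ?_⟩
  rw [h.eq_barCooperad]
  exact inferInstanceAs (IsIso (BarCooperad.barCounit P))
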